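/- Let $\mathbb F$ be a non-archimedean local field of characteristic $0$ with ring of integers $\mathfrak o$ and module $|\cdot|_{\mathbb F}$, and let $\chi$ be a unitary character of the additive group $\mathbb F$ with kernel $\mathfrak o$. Let $\mathsf W\neq 0$ be a finite-dimensional $\mathbb F$-vector space with a non-degenerate symplectic form $\langle\cdot,\cdot\rangle$ and a complete polarization $\mathsf W=\mathsf X\oplus\mathsf Y$, and let $n=\dim\mathsf X$. Let $\operatorname{End}(\mathsf X)$ act on $\mathsf W$ through the embedding $\operatorname{End}(\mathsf X)\to\mathfrak{sp}(\mathsf W)$ that sends $x$ to the element of $\mathfrak{sp}(\mathsf W)$ which preserves $\mathsf X$ and $\mathsf Y$ and restricts to $x$ on $\mathsf X$, and let $\tau:\mathsf W\to\operatorname{End}(\mathsf X)^*$, $\tau(w)(e)=\langle e(w),w\rangle$, be the moment map. Let $\mathbb F^\times$ act on $\mathsf W$ by $a(x+y)=ax+a^{-1}y$ for $x\in\mathsf X$, $y\in\mathsf Y$, and put $\mathsf W_{\mathbb F^\times}=(\mathsf X\setminus 0)\oplus(\mathsf Y\setminus 0)$. Fix Haar measures $dw$ on $\mathsf W$, $dx$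 on $\operatorname{End}(\mathsf X)$ and $d^\times a$ on $\mathbb F^\times$ (for instance $d^\times a=da/|a|_{\mathbb F}$). For a finite-dimensional $\mathbb F$-vector space $V$ let $\mathcal S(V)$ be the space of locally constant compactly supported functions $V\to\mathbb C$ and $\mathcal S^*(V)$ its algebraic dual, whose elements are called distributions. Fix a subgroup $\Lambda\subseteq\mathbb F^\times$ of finite index that contains a uniformizer; a cone in $V^*\setminus 0$ is a subset stable under $\Lambda$, and the asymptotic cone $\mathrm{AC}(A)$ of $A\subseteq V^*$ is the complement in $V^*\setminus0$ of the union of all open cones whose intersection with $A$ is bounded. For $u\in\mathcal S^*(V)$ and $\varphi\in\mathcal S(V)$ put $\mathcal F(\varphi u)(\xi)=u\big(\varphi\,\chi(-\xi(\cdot))\big)$ for $\xi\in V^*$. The wave front set $\mathrm{WF}(u)$ is the set of all $(x,\xi)\in V\times(V^*\setminus0)$ such that $\xi\in\mathrm{AC}(\operatorname{supp}\mathcal F(\varphi u))$ for every $\varphi\in\mathcal S(V)$ with $\varphi(x)\neq0$. For $0\le k\le n$ let $\mathcal O_k\subseteq\operatorname{End}(\mathsf X)$ be the set of endomorphisms of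 rank $k$. A measure $\mu_{\mathcal O_k}$ is a nonzero positive measure on $\operatorname{End}(\mathsf X)$, finite on compact sets and concentrated on $\mathcal O_k$, such that $$\int\psi(g^{-1}xh)\,d\mu_{\mathcal O_k}(x)=|\det g|_{\mathbb F}^{k}\,|\det h|_{\mathbb F}^{-k}\int\psi\,d\mu_{\mathcal O_k}$$ for all $g,h\in\mathrm{GL}(\mathsf X)$ and all nonnegative Borel functions $\psi$. Then the following hold. (a) There is a unique measure $d(\mathbb F^\times w)$ on the orbit space $\mathbb F^\times\backslash\mathsf W_{\mathbb F^\times}$ such that $$\int_{\mathsf W_{\mathbb F^\times}}\phi(w)\,dw=\int_{\mathbb F^\times\backslash\mathsf W_{\mathbb F^\times}}\int_{\mathbb F^\times}\phi(a(w))\,d^\times a\,d(\mathbb F^\times w)$$ for all nonnegative Borel functions $\phi$ on $\mathsf W$, and the formula $$\mathrm{chc}(\psi)=\int_{\mathbb F^\times\backslash\mathsf W_{\mathbb F^\times}}\int_{\operatorname{End}(\mathsf X)}\chi(\langle xw,w\rangle)\,\psi(x)\,dx\,d(\mathbb F^\times w)\qquad(\psi\in\mathcal S(\operatorname{End}(\mathsf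 X))),$$ in which each consecutive integral converges absolutely, defines a distribution $\mathrm{chc}\in\mathcal S^*(\operatorname{End}(\mathsf X))$. (b) Identify $\operatorname{End}(\mathsf X)$ with $\operatorname{End}(\mathsf X)^*$ by $y\mapsto\operatorname{tr}(\,\cdot\,y)$. There are measures $\mu_{\mathcal O_{n-1}}$ and $\mu_{\mathcal O_1}$ as above such that $\mathrm{chc}(\psi)=\int\psi\,d\mu_{\mathcal O_{n-1}}$ for all $\psi\in\mathcal S(\operatorname{End}(\mathsf X))$ and $$\mathrm{WF}(\mu_{\mathcal O_{n-1}})=\{(x,y):\ \operatorname{rk}x\le n-1,\ \operatorname{rk}y\le1,\ y\ne0,\ xy=yx=0\},$$ $$\mathrm{WF}(\mu_{\mathcal O_{1}})=\{(x,y):\ \operatorname{rk}x\le 1,\ \operatorname{rk}y\le n-1,\ y\ne0,\ xy=yx=0\}.$$ (c) $\mathrm{WF}(\mathrm{chc})=\{(x,\tau(w)):\ x\in\operatorname{End}(\mathsf X),\ w\in\mathsf W,\ \tau(w)\neq0,\ x(w)=0\}.$ -/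

import Mathlib

open MeasureTheory
open scoped ENNReal NNReal

noncomputable section

/-! ### Distributions and wave front sets over a non-archimedean local field -/

/-- A unitary character of the additive group of `F` whose kernel is the ring of integers. -/
structure UnramifiedCharacter (F : Type*) [NontriviallyNormedField F] where
  toAddChar : AddChar F Circle
  apply_eq_one_iff : ∀ a : F, toAddChar a = 1 ↔ ‖a‖ ≤ 1

/-- A uniformizer: a generator of the maximal ideal of the ring of integers. -/
def IsUniformizer {F : Type*} [NontriviallyNormedField F] (ϖ : F) : Prop :=
  ϖ ≠ 0 ∧ ‖ϖ‖ < 1 ∧ ∀ a : F, ‖a‖ < 1 → ‖a‖ ≤ ‖ϖ‖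

/-- The Schwartz-Bruhat space: locally constant, compactly supported complex functions. -/
def SchwartzBruhat (V : Type*) [TopologicalSpace V] : Submodule ℂ (V → ℂ) where
  carrier := {f | IsLocallyConstant f ∧ HasCompactSupport f}
  add_mem' := fun hf hg => ⟨hf.1.add hg.1, hf.2.add hg.2⟩
  zero_mem' := ⟨IsLocallyConstant.const 0, HasCompactSupport.zero⟩
  smul_mem' := fun c _ hf => ⟨hf.1.comp (c • ·), hf.2.comp_left (smul_zero c)⟩

/-- Distributions: all linear functionals on the Schwartz-Bruhat space. -/
abbrev BruhatDistribution (V : Type*) [TopologicalSpace V] : Type _ :=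
  SchwartzBruhat V →ₗ[ℂ] ℂ

/-- The distribution defined by a measure that is finite on compact sets. -/
def BruhatDistribution.ofMeasure {V : Type*} [TopologicalSpace V] [T2Space V] [MeasurableSpace V]
    [BorelSpace V] (μ : Measure V) (hμ : IsFiniteMeasureOnCompacts μ) :
    BruhatDistribution V where
  toFun ψ := ∫ x, (ψ : V → ℂ) x ∂μ
  map_add' := fun f g => integral_add
    (f.2.1.continuous.integrable_of_hasCompactSupport f.2.2)
    (g.2.1.continuous.integrable_of_hasCompactSupport g.2.2)
  map_smul' := fun c f => integral_const_mul c (f : V → ℂ)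

section WaveFront

variable {F : Type*} [NontriviallyNormedField F]
variable {V : Type*} [NormedAddCommGroup V] [NormedSpace F V]

lemma UnramifiedCharacter.isLocallyConstant (χ : UnramifiedCharacter F) :
    IsLocallyConstant χ.toAddChar := by
  rw [IsLocallyConstant.iff_eventually_eq]
  intro x
  filter_upwards [Metric.ball_mem_nhds x one_pos] with y hy
  have h : χ.toAddChar (y - x) = 1 := by
    rw [χ.apply_eq_one_iff, ← dist_eq_norm]
    exact (Metric.mem_ball.1 hy).le
  calc χ.toAddChar y = χ.toAddChar ((y - x) + x) := by rw [sub_add_cancel]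
    _ = χ.toAddChar x := by rw [AddChar.map_add_eq_mul, h, one_mul]

/-- The test function `x ↦ φ(x) χ(-ξ(x))`. -/
def SchwartzBruhat.twist (χ : UnramifiedCharacter F) (φ : SchwartzBruhat V)
    (ξ : StrongDual F V) : SchwartzBruhat V :=
  ⟨fun x => (φ : V → ℂ) x * (χ.toAddChar (-(ξ x)) : ℂ),
    φ.2.1.mul ((χ.isLocallyConstant.comp_continuous (f := fun x => -(ξ x))
      ξ.continuous.neg).comp (fun z : Circle => (z : ℂ))),
    φ.2.2.mul_right⟩

/-- The Fourier transform `ξ ↦ (φ u)(χ(-ξ(·)))` of the compactly supported distribution `φ u`. -/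
def fourierCutoff (χ : UnramifiedCharacter F) (u : BruhatDistribution V)
    (φ : SchwartzBruhat V) (ξ : StrongDual F V) : ℂ :=
  u (SchwartzBruhat.twist χ φ ξ)

/-- Cones: subsets of `V ∖ 0` closed under multiplication by `Λ`. -/
def IsScalingCone (Λ : Subgroup Fˣ) (C : Set V) : Prop :=
  (0 : V) ∉ C ∧ ∀ a ∈ Λ, ∀ v ∈ C, (a : F) • v ∈ C

/-- The asymptotic cone of `A`: the complement in `V ∖ 0` of the union of all the open cones
whose intersection with `A` is bounded. -/
def conicAsymptote (Λ : Subgroup Fˣ) (A : Set V) : Set V :=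
  {v | v ≠ 0 ∧ ∀ C : Set V, IsOpen C → IsScalingCone Λ C → v ∈ C →
    ¬ Bornology.IsBounded (C ∩ A)}

/-- The wave front set of a distribution, as a subset of `V × (V* ∖ 0)`. -/
def waveFrontSet (Λ : Subgroup Fˣ) (χ : UnramifiedCharacter F) (u : BruhatDistribution V) :
    Set (V × StrongDual F V) :=
  {p | p.2 ≠ 0 ∧ ∀ φ : SchwartzBruhat V, (φ : V → ℂ) p.1 ≠ 0 →
    p.2 ∈ conicAsymptote Λ (tsupport (fourierCutoff χ u φ))}

end WaveFront

/-! ### Polarized symplectic spaces -/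

/-- A symplectic form on `W` together with a complete polarization `W = X ⊕ Y`. -/
structure PolarizedSymplectic (F W : Type*) [Field F] [AddCommGroup W] [Module F W] where
  form : LinearMap.BilinForm F W
  alt : form.IsAlt
  nondegenerate : form.Nondegenerate
  X : Submodule F W
  Y : Submodule F W
  isCompl : IsCompl X Y
  isotropic_X : ∀ u ∈ X, ∀ v ∈ X, form u v = 0
  isotropic_Y : ∀ u ∈ Y, ∀ v ∈ Y, form u v = 0

namespace PolarizedSymplectic

section Torus

variable {F W : Type*} [Field F] [AddCommGroup W] [Module F W] (P : PolarizedSymplectic F W)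

/-- The projection of `W` onto `X` along `Y`. -/
abbrev projX : W →ₗ[F] W := P.X.projection P.Y P.isCompl

/-- The projection of `W` onto `Y` along `X`. -/
abbrev projY : W →ₗ[F] W := P.Y.projection P.X P.isCompl.symm

lemma projX_mem (w : W) : P.projX w ∈ P.X := Subtype.property (P.X.projectionOnto P.Y P.isCompl w)

lemma projY_mem (w : W) : P.projY w ∈ P.Y :=
  Subtype.property (P.Y.projectionOnto P.X P.isCompl.symm w)

lemma projX_add_projY (w : W) : P.projX w + P.projY w = w :=
  Submodule.projection_add_projection_eq_self P.isCompl w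

/-- The action `a (x + y) = a x + a⁻¹ y` of `Fˣ` on `W = X ⊕ Y`. -/
def torusAct (a : Fˣ) (w : W) : W := a • P.projX w + a⁻¹ • P.projY w

lemma projX_torusAct (a : Fˣ) (w : W) : P.projX (P.torusAct a w) = a • P.projX w := by
  have h1 : P.projX (P.projY w) = 0 := by simp
  have h2 : P.projX (P.projX w) = P.projX w := by simp
  rw [torusAct, map_add, Units.smul_def, Units.smul_def, map_smul, map_smul, h1, h2, smul_zero,
    add_zero]

lemma projY_torusAct (a : Fˣ) (w : W) : P.projY (P.torusAct a w) = a⁻¹ • P.projY w := by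
  have h1 : P.projY (P.projX w) = 0 := by simp
  have h2 : P.projY (P.projY w) = P.projY w := by simp
  rw [torusAct, map_add, Units.smul_def, Units.smul_def, map_smul, map_smul, h1, h2, smul_zero,
    zero_add]

lemma torusAct_mul (a b : Fˣ) (w : W) :
    P.torusAct (a * b) w = P.torusAct a (P.torusAct b w) := by
  rw [torusAct, torusAct, projX_torusAct, projY_torusAct, mul_smul, mul_inv, mul_smul]

lemma torusAct_one (w : W) : P.torusAct 1 w = w := by
  rw [torusAct, inv_one, one_smul, one_smul, projX_add_projY]

/-- The subset `(X ∖ 0) ⊕ (Y ∖ 0)` of `W`. -/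
def regularSet : Set W := {w | P.projX w ≠ 0 ∧ P.projY w ≠ 0}

/-- The orbit relation of `Fˣ` on `(X ∖ 0) ⊕ (Y ∖ 0)`. -/
def orbitSetoid : Setoid P.regularSet where
  r w w' := ∃ a : Fˣ, P.torusAct a (w : W) = w'
  iseqv :=
    { refl := fun w => ⟨1, P.torusAct_one w⟩
      symm := by
        rintro w w' ⟨a, ha⟩
        exact ⟨a⁻¹, by rw [← ha, ← torusAct_mul, inv_mul_cancel, torusAct_one]⟩
      trans := by
        rintro w w' w'' ⟨a, ha⟩ ⟨b, hb⟩
        exact ⟨b * a, by rw [torusAct_mul, ha, hb]⟩ }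

/-- The orbit space `Fˣ \ ((X ∖ 0) ⊕ (Y ∖ 0))`, with the quotient measurable structure. -/
abbrev OrbitSpace : Type _ := Quotient P.orbitSetoid

end Torus

section Normed

variable {F : Type*} [NontriviallyNormedField F]
variable {W : Type*} [NormedAddCommGroup W] [NormedSpace F W] [FiniteDimensional F W]
variable (P : PolarizedSymplectic F W)

/-- The algebra `End(X)`; every linear endomorphism of the finite-dimensional space `X` is
continuous. -/
abbrev EndX : Type _ := P.X →L[F] P.X

/-- The endomorphism of `W` equal to `x` on `X` and to zero on `Y`. -/
def extendByZero (x : P.EndX) : W →ₗ[F] W :=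
  P.X.subtype ∘ₗ (x : P.X →ₗ[F] P.X) ∘ₗ P.X.projectionOnto P.Y P.isCompl

/-- The embedding `End(X) → sp(W)`: the element of `sp(W)` which preserves `X` and `Y` and
restricts to `x` on `X`. -/
def toSp (x : P.EndX) : W →ₗ[F] W :=
  P.extendByZero x - P.form.leftAdjointOfNondegenerate P.nondegenerate (P.extendByZero x)

lemma form_adjoint (x : P.EndX) (u v : W) :
    P.form (P.form.leftAdjointOfNondegenerate P.nondegenerate (P.extendByZero x) u) v =
      P.form u (P.extendByZero x v) :=
  LinearMap.BilinForm.isAdjointPairLeftAdjointOfNondegenerate P.form P.nondegenerate _ u v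

/-- The element `toSp x` lies in the Lie algebra `sp(W)`. -/
lemma form_toSp (x : P.EndX) (u v : W) :
    P.form (P.toSp x u) v + P.form u (P.toSp x v) = 0 := by
  have h := P.form_adjoint x v u
  rw [← P.alt.neg_eq u, ← P.alt.neg_eq (P.extendByZero x u)] at h
  simp only [toSp, LinearMap.sub_apply, map_sub, form_adjoint]
  linear_combination h

lemma toSp_apply_X (x : P.EndX) (u : P.X) : P.toSp x u = x u := by
  have h : P.form.leftAdjointOfNondegenerate P.nondegenerate (P.extendByZero x) u = 0 := by
    refine P.nondegenerate.1 _ fun v => ?_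
    rw [form_adjoint]
    exact P.isotropic_X _ u.2 _ (Subtype.property _)
  rw [toSp, LinearMap.sub_apply, h, sub_zero]
  simp [extendByZero]

lemma toSp_mem_Y (x : P.EndX) (v : P.Y) : P.toSp x v ∈ P.Y := by
  have hx : P.projX (P.toSp x v) = 0 := by
    refine P.nondegenerate.1 _ fun w => ?_
    have h0 : ∀ y ∈ P.Y, P.form (P.toSp x v) y = 0 := by
      intro y hy
      have e1 : P.extendByZero x v = 0 := by simp [extendByZero]
      have e2 : P.extendByZero x y = 0 := by
        simp [extendByZero, (Submodule.projectionOnto_apply_eq_zero_iff P.isCompl).2 hy]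
      simp [toSp, form_adjoint, e1, e2]
    rw [← P.projX_add_projY w, map_add,
      P.isotropic_X _ (P.projX_mem _) _ (P.projX_mem _), zero_add]
    have h1 := h0 (P.projY w) (P.projY_mem _)
    rw [← P.projX_add_projY (P.toSp x v), map_add, LinearMap.add_apply,
      P.isotropic_Y _ (P.projY_mem _) _ (P.projY_mem _), add_zero] at h1
    exact h1
  have h2 : P.X.projectionOnto P.Y P.isCompl (P.toSp x v) = 0 := Subtype.ext hx
  exact (Submodule.projectionOnto_apply_eq_zero_iff P.isCompl).1 h2

lemma toSp_add (x y : P.EndX) : P.toSp (x + y) = P.toSp x + P.toSp y := by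
  have h : P.extendByZero (x + y) = P.extendByZero x + P.extendByZero y := by
    ext w; simp [extendByZero]
  have h2 : P.form.leftAdjointOfNondegenerate P.nondegenerate (P.extendByZero x) +
      P.form.leftAdjointOfNondegenerate P.nondegenerate (P.extendByZero y) =
      P.form.leftAdjointOfNondegenerate P.nondegenerate (P.extendByZero (x + y)) := by
    refine (LinearMap.BilinForm.isAdjointPair_iff_eq_of_nondegenerate P.form P.nondegenerate
      _ _).1 fun u v => ?_
    simp [form_adjoint, h]
  rw [toSp, ← h2, h, toSp, toSp]; abel

lemma toSp_smul (c : F) (x : P.EndX) : P.toSp (c • x) = c • P.toSp x := by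
  have h : P.extendByZero (c • x) = c • P.extendByZero x := by
    ext w; simp [extendByZero]
  have h2 : c • P.form.leftAdjointOfNondegenerate P.nondegenerate (P.extendByZero x) =
      P.form.leftAdjointOfNondegenerate P.nondegenerate (P.extendByZero (c • x)) := by
    refine (LinearMap.BilinForm.isAdjointPair_iff_eq_of_nondegenerate P.form P.nondegenerate
      _ _).1 fun u v => ?_
    simp [form_adjoint, h]
  rw [toSp, ← h2, h, toSp, smul_sub]

/-- The action of `Fˣ` preserves the symplectic form and commutes with `End(X)`. -/
lemma form_toSp_torusAct (x : P.EndX) (a : Fˣ) (w : W) :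
    P.form (P.toSp x (P.torusAct a w)) (P.torusAct a w) = P.form (P.toSp x w) w := by
  have hX : P.toSp x (P.projX w) ∈ P.X := by
    have := P.toSp_apply_X x (P.X.projectionOnto P.Y P.isCompl w)
    rw [Submodule.coe_projectionOnto_apply] at this
    rw [projX, this]; exact Subtype.property _
  have hY : P.toSp x (P.projY w) ∈ P.Y :=
    P.toSp_mem_Y x (P.Y.projectionOnto P.X P.isCompl.symm w)
  have h1 := P.isotropic_X _ hX (P.projX w) (P.projX_mem w)
  have h2 := P.isotropic_Y _ hY (P.projY w) (P.projY_mem w)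
  have hs := P.projX_add_projY w
  have ha : (a : F) ≠ 0 := a.ne_zero
  have e : P.form (P.toSp x w) w =
      P.form (P.toSp x (P.projX w + P.projY w)) (P.projX w + P.projY w) := by rw [hs]
  rw [e]
  simp only [torusAct, Units.smul_def, map_add, map_smul, LinearMap.add_apply,
    LinearMap.smul_apply, smul_eq_mul, h1, h2, Units.val_inv_eq_inv_val]
  field_simp
  ring

variable [ProperSpace F]

/-- The moment map `τ : W → End(X)*`, `τ(w)(e) = ⟨e w, w⟩`. -/
def momentMap (w : W) : StrongDual F P.EndX :=
  LinearMap.toContinuousLinearMap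
    { toFun := fun e => P.form (P.toSp e w) w
      map_add' := fun e e' => by simp [toSp_add]
      map_smul' := fun c e => by simp [toSp_smul] }

/-- The covector `e ↦ tr(e y)` on `End(X)`. -/
def traceCovector (y : P.EndX) : StrongDual F P.EndX :=
  LinearMap.toContinuousLinearMap
    { toFun := fun e => LinearMap.trace F P.X ((e * y : P.EndX) : P.X →ₗ[F] P.X)
      map_add' := fun e e' => by simp [add_mul]
      map_smul' := fun c e => by simp }

/-- The rank of an endomorphism of `X`. -/
def rank (x : P.EndX) : ℕ := Module.finrank F (LinearMap.range (x : P.X →ₗ[F] P.X))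

/-- The inner integral `∫_{End(X)} χ(⟨x w, w⟩) ψ(x) dx`, a function on the orbit space. -/
def innerIntegral (χ : UnramifiedCharacter F) (dx : Measure P.EndX) (ψ : P.EndX → ℂ) :
    P.OrbitSpace → ℂ :=
  Quotient.lift
    (fun w : P.regularSet =>
      ∫ x, (χ.toAddChar (P.form (P.toSp x (w : W)) w) : ℂ) * ψ x ∂dx)
    (by
      rintro w w' ⟨a, ha⟩
      simp only [← ha, form_toSp_torusAct])

instance units_measurableMul (F : Type*) [NontriviallyNormedField F] [MeasurableSpace F]
    [BorelSpace F] : MeasurableMul Fˣ where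
  measurable_const_mul := fun c =>
    measurable_comap_iff.2 ((comap_measurable Units.val).const_mul (c : F))
  measurable_mul_const := fun c =>
    measurable_comap_iff.2 ((comap_measurable Units.val).mul_const (c : F))

/-- The integral `∫_{Fˣ} φ(a w) d a` over an orbit. -/
def orbitIntegral [MeasurableSpace F] [BorelSpace F] (da : Measure Fˣ) [da.IsHaarMeasure]
    (φ : W → ℝ≥0∞) : P.OrbitSpace → ℝ≥0∞ :=
  Quotient.lift (fun w : P.regularSet => ∫⁻ a : Fˣ, φ (P.torusAct a (w : W)) ∂da)
    (by
      rintro w w' ⟨b, hb⟩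
      simp only [← hb, ← torusAct_mul]
      exact (lintegral_mul_right_eq_self (fun a => φ (P.torusAct a (w : W))) b).symm)

/-- The measure `m` on the orbit space is the quotient of `dw` by `da`:
`∫_{(X∖0)⊕(Y∖0)} φ(w) dw = ∫_{orbits} ∫_{Fˣ} φ(a w) da dm`. -/
def IsQuotientMeasure [MeasurableSpace F] [BorelSpace F] [MeasurableSpace W]
    (dw : Measure W) (da : Measure Fˣ) [da.IsHaarMeasure] (m : Measure P.OrbitSpace) : Prop :=
  ∀ φ : W → ℝ≥0∞, Measurable φ →
    ∫⁻ w in P.regularSet, φ w ∂dw = ∫⁻ q, P.orbitIntegral da φ q ∂m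

/-- A nonzero positive measure on `End(X)`, finite on compact sets and concentrated on the
endomorphisms of rank `k`, such that
`∫ ψ(g⁻¹ x h) dμ(x) = |det g|ᵏ |det h|⁻ᵏ ∫ ψ dμ` for all `g, h ∈ GL(X)`. Here `distribHaarChar F a`
is the module `|a|_F = d(a t)/dt`. -/
structure IsRankOrbitMeasure [MeasurableSpace F] [BorelSpace F]
    (k : ℕ) (μ : Measure P.EndX) : Prop where
  ne_zero : μ ≠ 0
  finite_on_compacts : IsFiniteMeasureOnCompacts μ
  concentrated : μ {x | P.rank x ≠ k} = 0
  map_eq : ∀ g h : P.X ≃L[F] P.X,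
    μ.map (fun x : P.EndX =>
      ((g.symm : P.X →L[F] P.X) ∘L x ∘L (h : P.X →L[F] P.X) : P.EndX)) =
    (distribHaarChar F (LinearEquiv.det g.toLinearEquiv) ^ k *
      (distribHaarChar F (LinearEquiv.det h.toLinearEquiv) ^ k)⁻¹ : ℝ≥0) • μ

end Normed

end PolarizedSymplectic

end

/-! A basis of `X` identifies `W` with pairs `(p, q)` in `F^n × F^n`, where `q` records the pairings
with the basis. The torus then acts by `(a p, a⁻¹ q)` and `⟨x w, w⟩ = tr(x · 2 p ᵗq)`
(`form_toSp_self`). The matrix `p ᵗq` is an invariant of the orbit. Each regular orbit meets the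
section `‖p‖ = 1` in a set of torus parameters of fixed finite measure, so `dw` restricted to that
section represents the quotient measure, and its image under `(p, q) ↦ p ᵗq` is a multiple of the
measure `rankOneMeasure` on the matrices of rank one (`exists_map_orbitMatrix`). The inner integral
of `chc` is the Fourier transform of the test function at twice this matrix (`innerIntegral_eq`).
Hence `chc` is, up to a dilation and a constant, the Fourier transform of `rankOneMeasure`.

This Fourier transform is computed by hand in `integral_corankOneMeasure`. For a unit vector `p`,
integrating over a large ball in `q` concentrates the integral on the matrices `e` with `‖e p‖`
small. A linear contraction in the direction of `p` turns this thin set into `‖e p‖ ≤ 1` and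
replaces `e` by a matrix killing `p`. The result is a positive measure carried by the matrices of
rank `n - 1`, and its equivariance is inherited through the Fourier transform.

Upper bounds for the wave front sets have three sources. Invariance under `z ↦ g⁻¹ z h` with
determinants of norm one gives `x y = y x = 0` (`notMem_waveFrontSet_of_invariant`,
`mul_eq_zero_of_mem_waveFrontSet`). The support bounds the rank of `x`. For the rank of `y`, the
local Fourier transform of the corank one measure at `t y` is by duality an integral of the rank one
measure over a box around `t y` (`setIntegral_corankOneMeasure`), and such a box far out contains no
matrix of rank one if `y` has rank at least two. For the rank one measure at `x = 0` an invertible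
`y` produces a phase that oscillates in `q`.

Lower bounds rest on `mem_waveFrontSet_of_integral_ne_zero`. The indicator of a box is an average of
characters, so vanishing of a cutoff transform far out in a cone would force vanishing for the
restriction to every small box. By duality, or directly for the rank one measure at `x ≠ 0`,
everything reduces to an integral of the rank one measure near an idempotent `E`, with a phase `X`
such that `E X = X E = 0`; it is nonzero because the integral over `q` is a positive multiple of an
indicator function (`setIntegral_rankOneMeasure_ne_zero`). The remaining point `x = 0` follows
because the wave front set is closed. Finally `toSp_eq_zero_iff` rewrites `x y = y x = 0` as `x(w) =
0` (`conormal_eq`). -/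

noncomputable section

namespace OrbitalMeasure

set_option linter.unusedSectionVars false

variable {F : Type*} [NontriviallyNormedField F] [IsUltrametricDist F] [ProperSpace F]
  [MeasurableSpace F] [BorelSpace F]
variable {ι : Type*} [Fintype ι] [DecidableEq ι]

/-! ### Haar measures on coordinate spaces and matrices -/

/-- The ring of integers as a compact set with nonempty interior. -/
def integerCompacts (F : Type*) [NontriviallyNormedField F] [ProperSpace F] :
    TopologicalSpace.PositiveCompacts F where
  carrier := Metric.closedBall 0 1
  isCompact' := isCompact_closedBall 0 1
  interior_nonempty' :=
    ⟨0, mem_interior_iff_mem_nhds.2 (Metric.closedBall_mem_nhds 0 one_pos)⟩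

/-- The Haar measure on `F` giving mass one to the ring of integers. -/
def fieldHaar (F : Type*) [NontriviallyNormedField F] [ProperSpace F]
    [MeasurableSpace F] [BorelSpace F] : Measure F :=
  Measure.addHaarMeasure (integerCompacts F)

instance : (fieldHaar F).IsAddHaarMeasure := by unfold fieldHaar; infer_instance

lemma fieldHaar_closedBall : fieldHaar F (Metric.closedBall 0 1) = 1 :=
  Measure.addHaarMeasure_self (K₀ := integerCompacts F)

/-- The product Haar measure on `F^ι`. -/
def vecHaar (F ι : Type*) [NontriviallyNormedField F] [ProperSpace F]
    [MeasurableSpace F] [BorelSpace F] [Fintype ι] : Measure (ι → F) :=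
  Measure.pi fun _ => fieldHaar F

instance : (vecHaar F ι).IsAddHaarMeasure := by unfold vecHaar; infer_instance

instance : MeasurableSpace (Matrix ι ι F) := inferInstanceAs (MeasurableSpace (ι → ι → F))
instance : BorelSpace (Matrix ι ι F) := inferInstanceAs (BorelSpace (ι → ι → F))
instance : SecondCountableTopology (Matrix ι ι F) :=
  inferInstanceAs (SecondCountableTopology (ι → ι → F))
instance : LocallyCompactSpace (Matrix ι ι F) :=
  inferInstanceAs (LocallyCompactSpace (ι → ι → F))

/-- The product Haar measure on matrices. -/
def matHaar (F ι : Type*) [NontriviallyNormedField F] [ProperSpace F]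
    [MeasurableSpace F] [BorelSpace F] [Fintype ι] : Measure (Matrix ι ι F) :=
  (Measure.pi fun _ : ι => vecHaar F ι : Measure (ι → ι → F))

instance : (matHaar F ι).IsAddHaarMeasure :=
  Measure.pi.isAddHaarMeasure (α := fun _ : ι => ι → F) fun _ => vecHaar F ι

lemma vecHaar_closedBall : vecHaar F ι (Metric.closedBall 0 1) = 1 := by
  rw [closedBall_pi _ zero_le_one, vecHaar, Measure.pi_pi]
  simp [fieldHaar_closedBall]

/-- Pushing forward under multiplication by `a` divides the measure by the module of `a`; the
compensating factor is therefore the module itself, and all later scaling laws keep this form. -/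
lemma map_mul_fieldHaar (a : Fˣ) :
    distribHaarChar F a • (fieldHaar F).map (fun x => (a : F) * x) = fieldHaar F := by
  ext s hs
  have hm : Measurable fun x : F => (a : F) * x := measurable_const_mul _
  rw [Measure.smul_apply, Measure.map_apply hm hs, ENNReal.smul_def, smul_eq_mul,
    distribHaarChar_mul]
  congr 1
  ext x
  rw [Set.mem_smul_set_iff_inv_smul_mem]
  simp [Units.smul_def]

lemma distribHaarChar_eq_one {a : Fˣ} (ha : ‖(a : F)‖ = 1) : distribHaarChar F a = 1 := by
  refine distribHaarChar_eq_of_measure_smul_eq_mul (μ := fieldHaar F)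
    (s := Metric.closedBall 0 1) ?_ ?_ ?_
  · rw [fieldHaar_closedBall]; exact one_ne_zero
  · rw [fieldHaar_closedBall]; exact ENNReal.one_ne_top
  · rw [ENNReal.coe_one, one_mul]
    congr 1
    ext x
    rw [Set.mem_smul_set_iff_inv_smul_mem]
    simp [Units.smul_def, ha]

lemma pi_smul_eq {κ α : Type*} [Fintype κ] [MeasurableSpace α] (μ ν : Measure α) [SigmaFinite μ]
    [SigmaFinite ν] (c : κ → ℝ≥0) (f : κ → α → α) (hf : ∀ i, Measurable (f i))
    (h : ∀ i, c i • μ.map (f i) = ν) :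
    (∏ i, c i) • (Measure.pi fun _ : κ => μ).map (fun x i => f i (x i)) =
      Measure.pi fun _ : κ => ν := by
  symm
  refine Measure.pi_eq fun s hs => ?_
  have hm : Measurable fun (x : κ → α) i => f i (x i) :=
    measurable_pi_lambda _ fun i => (hf i).comp (measurable_pi_apply i)
  rw [Measure.smul_apply, Measure.map_apply hm (.univ_pi hs)]
  have : (fun (x : κ → α) i => f i (x i)) ⁻¹' Set.univ.pi s =
      Set.univ.pi fun i => f i ⁻¹' s i := by
    ext x; simp
  rw [this, Measure.pi_pi, ENNReal.smul_def, smul_eq_mul, ENNReal.ofNNReal_finsetProd,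
    ← Finset.prod_mul_distrib]
  refine Finset.prod_congr rfl fun i _ => ?_
  rw [← h i, Measure.smul_apply, Measure.map_apply (hf i) (hs i), ENNReal.smul_def, smul_eq_mul]

/-- The lattice preserved by a transvection. -/
lemma transvection_preimage (t : Matrix.TransvectionStruct ι F) :
    (fun x => t.toMatrix.mulVec x) ⁻¹'
      (Set.univ.pi fun k => Metric.closedBall (0 : F) (if k = t.i then max 1 ‖t.c‖ else 1)) =
      Set.univ.pi fun k => Metric.closedBall (0 : F) (if k = t.i then max 1 ‖t.c‖ else 1) := by
  have key : ∀ x : ι → F, t.toMatrix.mulVec x = x + Pi.single t.i (t.c * x t.j) := by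
    intro x
    ext k
    simp [Matrix.TransvectionStruct.toMatrix, Matrix.transvection, Matrix.add_mulVec,
      Matrix.single_mulVec_eq, Pi.single_apply]
  ext x
  simp only [Set.mem_preimage, Set.mem_univ_pi, mem_closedBall_zero_iff, key]
  have hji : t.j ≠ t.i := t.hij.symm
  have aux : ‖x t.j‖ ≤ 1 → ‖t.c * x t.j‖ ≤ max 1 ‖t.c‖ := fun h => by
    rw [norm_mul]
    exact le_max_of_le_right (mul_le_of_le_one_right (norm_nonneg _) h)
  constructor
  · intro h k
    have hj := h t.j
    simp only [Pi.add_apply, Pi.single_eq_of_ne hji, add_zero, if_neg hji] at hj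
    by_cases hk : k = t.i
    · subst hk
      have := h t.i
      simp only [Pi.add_apply, Pi.single_eq_same, if_true] at this ⊢
      have e : x t.i = (x t.i + t.c * x t.j) - t.c * x t.j := by ring
      rw [e, sub_eq_add_neg]
      exact (IsUltrametricDist.norm_add_le_max _ _).trans
        (max_le this ((norm_neg _).trans_le (aux hj)))
    · simpa [hk] using h k
  · intro h k
    have hj := h t.j
    simp only [if_neg hji] at hj
    by_cases hk : k = t.i
    · subst hk
      have := h t.i
      simp only [Pi.add_apply, Pi.single_eq_same, if_true] at this ⊢
      exact (IsUltrametricDist.norm_add_le_max _ _).trans (max_le this (aux hj))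
    · simpa [hk] using h k

/-- An invertible matrix as a topological automorphism of the coordinate space. -/
def mulVecEquiv (g : GL ι F) : (ι → F) ≃ₜ+ (ι → F) where
  toFun x := (g : Matrix ι ι F).mulVec x
  invFun x := (g⁻¹ : GL ι F).1.mulVec x
  left_inv x := by simp [Matrix.mulVec_mulVec]
  right_inv x := by simp [Matrix.mulVec_mulVec]
  map_add' := Matrix.mulVec_add _
  continuous_toFun := by fun_prop
  continuous_invFun := by fun_prop

lemma measurable_mulVec (g : Matrix ι ι F) : Measurable fun x : ι → F => g.mulVec x :=
  Continuous.measurable (by fun_prop)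

/-- By uniqueness of Haar measure a transvection scales volume by a constant. The constant is read
off on a box mapped onto itself, whose side in the direction `t.i` is widened to `max 1 ‖t.c‖` to
absorb the shear. -/
lemma map_transvection_vecHaar (t : Matrix.TransvectionStruct ι F) :
    (vecHaar F ι).map (fun x => t.toMatrix.mulVec x) = vecHaar F ι := by
  have hdet : t.toMatrix.det ≠ 0 := by simp
  set φ := mulVecEquiv (Matrix.GeneralLinearGroup.mkOfDetNeZero t.toMatrix hdet) with hφ
  have h := addEquivAddHaarChar_smul_map (vecHaar F ι) φ
  have hφ' : (φ : (ι → F) → ι → F) = fun x => t.toMatrix.mulVec x := rfl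
  rw [hφ'] at h
  set S : Set (ι → F) :=
    Set.univ.pi fun k => Metric.closedBall (0 : F) (if k = t.i then max 1 ‖t.c‖ else 1) with hS
  have hScpt : IsCompact S := isCompact_univ_pi fun k => isCompact_closedBall _ _
  have hSn : S ∈ nhds (0 : ι → F) := by
    refine set_pi_mem_nhds Set.finite_univ fun k _ => Metric.closedBall_mem_nhds _ ?_
    split_ifs
    · exact lt_max_of_lt_left one_pos
    · exact one_pos
  have h1 : addEquivAddHaarChar φ = 1 := by
    have h2 := congrArg (fun μ => μ S) h
    simp only [Measure.smul_apply] at h2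
    rw [Measure.map_apply (measurable_mulVec _) hScpt.isClosed.measurableSet,
      transvection_preimage, ENNReal.smul_def, smul_eq_mul] at h2
    have h0 : vecHaar F ι S ≠ 0 := (Measure.measure_pos_of_mem_nhds _ hSn).ne'
    have h3 : vecHaar F ι S ≠ ∞ := hScpt.measure_lt_top.ne
    have : (addEquivAddHaarChar φ : ℝ≥0∞) = 1 := by
      rw [← ENNReal.mul_left_inj h0 h3, h2, one_mul]
    exact_mod_cast this
  rw [h1, one_smul] at h
  exact h

/-- The Haar measure of `F^ι` scales by the module of the determinant. -/
lemma map_mulVec_vecHaar (g : GL ι F) :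
    distribHaarChar F (Matrix.GeneralLinearGroup.det g) •
      (vecHaar F ι).map (fun x => (g : Matrix ι ι F).mulVec x) = vecHaar F ι := by
  have key := Matrix.diagonal_transvection_induction_of_det_ne_zero
    (fun A : Matrix ι ι F => ∀ h : A.det ≠ 0, distribHaarChar F (Units.mk0 A.det h) •
      (vecHaar F ι).map (fun x => A.mulVec x) = vecHaar F ι) (g : Matrix ι ι F)
    (Matrix.GeneralLinearGroup.det g).ne_zero ?_ ?_ ?_
  · have := key (Matrix.GeneralLinearGroup.det g).ne_zero
    convert this using 3
    ext; rfl
  · intro D hD h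
    have hDi : ∀ i, D i ≠ 0 := by
      rw [Matrix.det_diagonal, Finset.prod_ne_zero_iff] at hD
      exact fun i => hD i (Finset.mem_univ i)
    have h1 := pi_smul_eq (fieldHaar F) (fieldHaar F)
      (fun i => distribHaarChar F (Units.mk0 (D i) (hDi i))) (fun i x => D i * x)
      (fun i => measurable_const_mul _) (fun i => map_mul_fieldHaar (Units.mk0 (D i) (hDi i)))
    have e : Units.mk0 (Matrix.diagonal D).det h = ∏ i, Units.mk0 (D i) (hDi i) := by
      ext; simp [Matrix.det_diagonal]
    have e2 : (fun x : ι → F => (Matrix.diagonal D).mulVec x) = fun x i => D i * x i := by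
      ext x i; simp [Matrix.mulVec_diagonal]
    rw [e, map_prod, e2]
    exact h1
  · intro t h
    have e : Units.mk0 t.toMatrix.det h = 1 := by ext; simp
    rw [e, map_one, one_smul]
    exact map_transvection_vecHaar t
  · intro A B hA hB ihA ihB h
    have e : Units.mk0 (A * B).det h = Units.mk0 A.det hA * Units.mk0 B.det hB := by
      ext; simp
    have e2 : (fun x : ι → F => (A * B).mulVec x) =
        (fun x => A.mulVec x) ∘ fun x => B.mulVec x := by
      ext x; simp [Matrix.mulVec_mulVec]
    rw [e, map_mul, e2, ← Measure.map_map (measurable_mulVec A) (measurable_mulVec B), mul_smul]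
    conv_rhs => rw [← ihA hA]
    congr 1
    conv_rhs => rw [← ihB hB]
    rw [Measure.map_smul]

lemma det_transpose_GL (g : GL ι F) :
    Matrix.GeneralLinearGroup.det (Matrix.GeneralLinearGroup.mkOfDetNeZero
        (g : Matrix ι ι F).transpose
      (by rw [Matrix.det_transpose]; exact (Matrix.GeneralLinearGroup.det g).ne_zero)) =
      Matrix.GeneralLinearGroup.det g := by
  ext
  exact Matrix.det_transpose _

lemma measurable_vecMul (g : Matrix ι ι F) : Measurable fun x : ι → F => g.vecMul x :=
  Continuous.measurable (by fun_prop)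

lemma map_vecMul_vecHaar (g : GL ι F) :
    distribHaarChar F (Matrix.GeneralLinearGroup.det g) •
      (vecHaar F ι).map (fun x => (g : Matrix ι ι F).vecMul x) = vecHaar F ι := by
  have := map_mulVec_vecHaar (Matrix.GeneralLinearGroup.mkOfDetNeZero (g : Matrix ι ι F).transpose
      (by rw [Matrix.det_transpose]; exact (Matrix.GeneralLinearGroup.det g).ne_zero))
  rw [det_transpose_GL] at this
  have e : (fun x => (g : Matrix ι ι F).vecMul x) =
      fun x => (g : Matrix ι ι F).transpose.mulVec x := by
    ext1 x; rw [Matrix.mulVec_transpose]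
  rw [e]
  exact this

/-- The rows are multiplied by `h` independently, and each contributes one factor of the module of
the determinant. -/
lemma map_mul_right_matHaar (h : GL ι F) :
    distribHaarChar F (Matrix.GeneralLinearGroup.det h) ^ Fintype.card ι •
      (matHaar F ι).map (fun e => e * (h : Matrix ι ι F)) = matHaar F ι := by
  have := pi_smul_eq (κ := ι) (vecHaar F ι) (vecHaar F ι)
    (fun _ => distribHaarChar F (Matrix.GeneralLinearGroup.det h))
    (fun _ x => (h : Matrix ι ι F).vecMul x) (fun _ => measurable_vecMul _)
    (fun _ => map_vecMul_vecHaar h)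
  rw [Finset.prod_const, Finset.card_univ] at this
  exact this

lemma integerMatrices_eq : {e : Matrix ι ι F | ∀ i j, ‖e i j‖ ≤ 1} =
    (Set.univ.pi fun _ : ι => Metric.closedBall (0 : ι → F) 1 : Set (ι → ι → F)) := by
  ext e
  constructor
  · intro h i _
    rw [mem_closedBall_zero_iff, pi_norm_le_iff_of_nonneg zero_le_one]
    exact h i
  · intro h i
    have := h i (Set.mem_univ i)
    rwa [mem_closedBall_zero_iff, pi_norm_le_iff_of_nonneg zero_le_one] at this

lemma matHaar_integerMatrices : matHaar F ι {e | ∀ i j, ‖e i j‖ ≤ 1} = 1 := by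
  rw [integerMatrices_eq]
  refine (Measure.pi_pi (fun _ : ι => vecHaar F ι) _).trans ?_
  simp [vecHaar_closedBall]

/-- Transposition is an automorphism preserving the integer matrices, a set of measure one, so its
scaling constant is one. -/
lemma map_transpose_matHaar : (matHaar F ι).map Matrix.transpose = matHaar F ι := by
  let φ : Matrix ι ι F ≃ₜ+ Matrix ι ι F :=
    { Matrix.transposeAddEquiv ι ι F with
      continuous_toFun := continuous_id.matrix_transpose
      continuous_invFun := continuous_id.matrix_transpose }
  have h := addEquivAddHaarChar_smul_map (matHaar F ι) φ
  have hφ : (φ : Matrix ι ι F → Matrix ι ι F) = Matrix.transpose := rfl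
  rw [hφ] at h
  have hm : MeasurableSet {e : Matrix ι ι F | ∀ i j, ‖e i j‖ ≤ 1} := by
    rw [integerMatrices_eq]
    exact MeasurableSet.univ_pi fun _ => Metric.isClosed_closedBall.measurableSet
  have h1 : addEquivAddHaarChar φ = 1 := by
    have h2 := congrArg (fun μ => μ {e : Matrix ι ι F | ∀ i j, ‖e i j‖ ≤ 1}) h
    have h3 : Matrix.transpose ⁻¹' {e : Matrix ι ι F | ∀ i j, ‖e i j‖ ≤ 1} =
        {e : Matrix ι ι F | ∀ i j, ‖e i j‖ ≤ 1} := by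
      ext e
      exact forall_comm
    have ht : Measurable (Matrix.transpose : Matrix ι ι F → Matrix ι ι F) :=
      continuous_id.matrix_transpose.measurable
    simp only [Measure.smul_apply] at h2
    rw [Measure.map_apply ht hm, h3,
      matHaar_integerMatrices, ENNReal.smul_def, smul_eq_mul, mul_one] at h2
    exact_mod_cast h2
  rwa [h1, one_smul] at h

lemma map_mul_left_matHaar (g : GL ι F) :
    distribHaarChar F (Matrix.GeneralLinearGroup.det g) ^ Fintype.card ι •
      (matHaar F ι).map (fun e => (g : Matrix ι ι F) * e) = matHaar F ι := by
  have := map_mul_right_matHaar (Matrix.GeneralLinearGroup.mkOfDetNeZero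
    (g : Matrix ι ι F).transpose
      (by rw [Matrix.det_transpose]; exact (Matrix.GeneralLinearGroup.det g).ne_zero))
  rw [det_transpose_GL] at this
  have ht : Measurable (Matrix.transpose : Matrix ι ι F → Matrix ι ι F) :=
    continuous_id.matrix_transpose.measurable
  have hr : Measurable fun e : Matrix ι ι F => e * (g : Matrix ι ι F).transpose :=
    Continuous.measurable (by fun_prop)
  have e : (fun e => (g : Matrix ι ι F) * e) = Matrix.transpose ∘
      (fun e => e * (g : Matrix ι ι F).transpose) ∘ Matrix.transpose := by
    ext1 x; simp [Matrix.transpose_mul]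
  rw [e, ← Measure.map_map ht (hr.comp ht), ← Measure.map_map hr ht, map_transpose_matHaar,
    ← Measure.map_smul]
  conv_rhs => rw [← map_transpose_matHaar]
  congr 1

/-! ### Integrals of characters -/

/-- The character as a complex-valued function. -/
def chi (χ : UnramifiedCharacter F) (a : F) : ℂ := (χ.toAddChar a : ℂ)

variable (χ : UnramifiedCharacter F)

lemma chi_add (a b : F) : chi χ (a + b) = chi χ a * chi χ b := by
  simp [chi, AddChar.map_add_eq_mul]

lemma norm_chi (a : F) : ‖chi χ a‖ = 1 := Circle.norm_coe _

lemma chi_eq_one_iff {a : F} : chi χ a = 1 ↔ ‖a‖ ≤ 1 := by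
  rw [← χ.apply_eq_one_iff, chi, Circle.coe_eq_one]

lemma continuous_chi : Continuous (chi χ) :=
  Continuous.comp (g := fun z : Circle => (z : ℂ)) (by fun_prop) χ.isLocallyConstant.continuous

section

variable {A : Type*} [AddCommGroup A] [MeasurableSpace A] [MeasurableAdd A] (μ : Measure A)
  [μ.IsAddLeftInvariant] (K : AddSubgroup A) (ψ : A → ℂ)

lemma setIntegral_character_of_trivial (hK : MeasurableSet (K : Set A)) (h : ∀ a ∈ K, ψ a = 1) :
    ∫ a in (K : Set A), ψ a ∂μ = μ.real K := by
  rw [setIntegral_congr_fun hK (g := fun _ => (1 : ℂ)) h]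
  simp

/-- Translation by `a₀` preserves `K` and the measure but multiplies the integral by `ψ a₀ ≠ 1`. -/
lemma setIntegral_character_of_nontrivial (hK : MeasurableSet (K : Set A))
    (hψ : ∀ a b, ψ (a + b) = ψ a * ψ b) {a₀ : A} (ha₀ : a₀ ∈ K) (h : ψ a₀ ≠ 1) :
    ∫ a in (K : Set A), ψ a ∂μ = 0 := by
  have e : ∫ a in (K : Set A), ψ a ∂μ = ψ a₀ * ∫ a in (K : Set A), ψ a ∂μ := by
    rw [← integral_indicator hK]
    conv_lhs => rw [← integral_add_left_eq_self _ a₀]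
    rw [← integral_const_mul]
    congr 1
    ext a
    by_cases ha : a ∈ (K : Set A)
    · rw [Set.indicator_of_mem ha, Set.indicator_of_mem (K.add_mem ha₀ ha), hψ]
    · rw [Set.indicator_of_notMem ha, Set.indicator_of_notMem, mul_zero]
      exact fun h' => ha ((K.add_mem_cancel_left ha₀).1 h')
  have : (1 - ψ a₀) * ∫ a in (K : Set A), ψ a ∂μ = 0 := by linear_combination e
  exact (mul_eq_zero.1 this).resolve_left (sub_ne_zero.2 h.symm)

end

lemma vecHaar_closedBall_norm (c : Fˣ) : vecHaar F ι (Metric.closedBall 0 ‖(c : F)‖) =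
    (distribHaarChar F c : ℝ≥0∞) ^ Fintype.card ι := by
  have h : fieldHaar F (Metric.closedBall 0 ‖(c : F)‖) = distribHaarChar F c := by
    have := distribHaarChar_mul (fieldHaar F) c (Metric.closedBall 0 1)
    rw [fieldHaar_closedBall, mul_one] at this
    rw [this]
    congr 1
    ext x
    rw [Set.mem_smul_set_iff_inv_smul_mem, mem_closedBall_zero_iff, mem_closedBall_zero_iff,
      Units.smul_def, smul_eq_mul, norm_mul, Units.val_inv_eq_inv_val, norm_inv,
      inv_mul_le_iff₀ (norm_pos_iff.2 c.ne_zero), mul_one]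
  rw [closedBall_pi _ (norm_nonneg _), vecHaar, Measure.pi_pi]
  simp [h]

lemma norm_dotProduct_le {p q : ι → F} {r s : ℝ} (hs : 0 ≤ s) (hp : ‖p‖ ≤ r) (hq : ‖q‖ ≤ s) :
    ‖p ⬝ᵥ q‖ ≤ r * s := by
  have hr : 0 ≤ r := (norm_nonneg _).trans hp
  refine IsUltrametricDist.norm_sum_le_of_forall_le_of_nonneg (mul_nonneg hr hs) fun i _ => ?_
  rw [norm_mul]
  exact mul_le_mul ((norm_le_pi_norm _ i).trans hp) ((norm_le_pi_norm _ i).trans hq)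
    (norm_nonneg _) hr

/-- The integral of a character over a ball is the indicator function of the dual ball. -/
lemma setIntegral_chi_ball (c : Fˣ) (v : ι → F) :
    ∫ q in Metric.closedBall 0 ‖(c : F)‖, chi χ (q ⬝ᵥ v) ∂vecHaar F ι =
      ((distribHaarChar F c : ℝ) ^ Fintype.card ι : ℝ) *
        (if ‖(c : F)‖ * ‖v‖ ≤ 1 then 1 else 0) := by
  have hc : 0 < ‖(c : F)‖ := norm_pos_iff.2 c.ne_zero
  set K := (IsUltrametricDist.closedBall_openAddSubgroup (ι → F) hc).toAddSubgroup with hKdef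
  have hK : (K : Set (ι → F)) = Metric.closedBall 0 ‖(c : F)‖ := rfl
  have hKm : MeasurableSet (K : Set (ι → F)) := by
    rw [hK]; exact Metric.isClosed_closedBall.measurableSet
  rw [← hK]
  split_ifs with h
  · rw [setIntegral_character_of_trivial _ _ _ hKm, mul_one, Measure.real, hK,
      vecHaar_closedBall_norm]
    · simp
    · intro q hq
      rw [chi_eq_one_iff]
      exact (norm_dotProduct_le (norm_nonneg _) (mem_closedBall_zero_iff.1 hq) le_rfl).trans h
  · rw [mul_zero]
    -- The sup norm is large because of one coordinate. The vector `Pi.single i c` lies in the ball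
    -- and the character is nontrivial on it, since the kernel of `χ` is exactly the unit ball.
    have : ∃ i, 1 < ‖(c : F)‖ * ‖v i‖ := by
      by_contra! hcon
      refine h ?_
      rw [← le_div_iff₀' hc]
      exact (pi_norm_le_iff_of_nonneg (by positivity)).2 fun i => (le_div_iff₀' hc).2 (hcon i)
    obtain ⟨i, hi⟩ := this
    refine setIntegral_character_of_nontrivial _ K (fun q => chi χ (q ⬝ᵥ v)) hKm
      (fun a b => by rw [add_dotProduct, chi_add]) (a₀ := Pi.single i (c : F)) ?_ ?_
    · refine mem_closedBall_zero_iff.2 ?_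
      rw [Pi.norm_single]
    · rw [Ne, chi_eq_one_iff, single_dotProduct, norm_mul]
      exact not_le.2 hi

end OrbitalMeasure
end

noncomputable section

namespace OrbitalMeasure

set_option linter.unusedSectionVars false

variable {F : Type*} [NontriviallyNormedField F] [IsUltrametricDist F] [ProperSpace F]
  [MeasurableSpace F] [BorelSpace F]
variable {ι : Type*} [Fintype ι] [DecidableEq ι]

/-! ### The multiplicative group and its orbits -/

instance : BorelSpace Fˣ where
  measurable_eq := by
    rw [(Units.isEmbedding_val₀ (G₀ := F)).eq_induced, borel_comap, ← ‹BorelSpace F›.measurable_eq]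
    rfl

instance : SecondCountableTopology Fˣ :=
  (Units.isEmbedding_val₀ (G₀ := F)).secondCountableTopology

/-- The group of units of the ring of integers. -/
def unitSphere (F : Type*) [NontriviallyNormedField F] : Set Fˣ := {u | ‖(u : F)‖ = 1}

lemma isOpen_unitSphere : IsOpen (unitSphere F) := by
  have : unitSphere F = Units.val ⁻¹' Metric.sphere (0 : F) 1 := by
    ext u; simp [unitSphere]
  rw [this]
  exact (IsUltrametricDist.isOpen_sphere _ one_ne_zero).preimage Units.continuous_val

lemma isCompact_unitSphere : IsCompact (unitSphere F) := by
  have : unitSphere F = Units.val ⁻¹' Metric.sphere (0 : F) 1 := by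
    ext u; simp [unitSphere]
  rw [this]
  refine (Units.isEmbedding_val₀ (G₀ := F)).isInducing.isCompact_preimage'
    (isCompact_sphere _ _) fun x hx => ?_
  have hx0 : x ≠ 0 := by
    rintro rfl
    simp at hx
  exact ⟨Units.mk0 x hx0, rfl⟩

section

variable (da : Measure Fˣ) [da.IsHaarMeasure]

lemma measure_unitSphere_ne_zero : da (unitSphere F) ≠ 0 :=
  (isOpen_unitSphere.measure_pos da ⟨1, by simp [unitSphere]⟩).ne'

lemma measure_unitSphere_ne_top : da (unitSphere F) ≠ ∞ :=
  isCompact_unitSphere.measure_lt_top.ne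

lemma exists_norm_eq {p : ι → F} (hp : p ≠ 0) : ∃ b : Fˣ, ‖(b : F)‖ = ‖p‖ := by
  obtain ⟨j, hj⟩ := Function.ne_iff.1 hp
  have : Nonempty ι := ⟨j⟩
  obtain ⟨i, hi⟩ := Finite.exists_max fun i => ‖p i‖
  have h : ‖p i‖ = ‖p‖ := le_antisymm (norm_le_pi_norm p i)
    ((pi_norm_le_iff_of_nonneg (norm_nonneg _)).2 hi)
  refine ⟨Units.mk0 (p i) ?_, h⟩
  rw [← norm_ne_zero_iff, h]
  exact norm_ne_zero_iff.2 hp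

/-- Almost all information on the orbit of `p`: the measure of the part on the unit sphere. -/
lemma measure_norm_smul_eq_one {p : ι → F} (hp : p ≠ 0) :
    da {a : Fˣ | ‖(a : F) • p‖ = 1} = da (unitSphere F) := by
  obtain ⟨b, hb⟩ := exists_norm_eq hp
  rw [← measure_preimage_mul_right da b (unitSphere F)]
  congr 1
  ext a
  simp [unitSphere, norm_smul, hb]

end

/-- Unfolding along the orbits of a measure preserving action. -/
lemma lintegral_mul_orbit {G Ω : Type*} [Group G] [MeasurableSpace G] [MeasurableInv G]
    [MeasurableSpace Ω] (μ : Measure Ω) [SFinite μ] (da : Measure G) [SFinite da]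
    [da.IsInvInvariant] (act : G → Ω → Ω) (hact : Measurable (Function.uncurry act))
    (hpres : ∀ a, μ.map (act a) = μ) (hinv : ∀ a w, act a⁻¹ (act a w) = w)
    {k φ : Ω → ℝ≥0∞} (hk : Measurable k) (hφ : Measurable φ) :
    ∫⁻ w, k w * ∫⁻ a, φ (act a w) ∂da ∂μ = ∫⁻ w, φ w * ∫⁻ a, k (act a w) ∂da ∂μ := by
  have hact' : ∀ a, Measurable (act a) := fun a => hact.comp measurable_prodMk_left
  have hact2 : ∀ w, Measurable fun a => act a w := fun w => hact.comp measurable_prodMk_right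
  have hswap : Measurable fun x : Ω × G => act x.2 x.1 := hact.comp measurable_swap
  calc ∫⁻ w, k w * ∫⁻ a, φ (act a w) ∂da ∂μ
      = ∫⁻ w, ∫⁻ a, k w * φ (act a w) ∂da ∂μ := by
        congr 1; ext w
        exact (lintegral_const_mul _ (hφ.comp (hact2 w))).symm
    _ = ∫⁻ a, ∫⁻ w, k w * φ (act a w) ∂μ ∂da :=
        lintegral_lintegral_swap
          ((hk.comp measurable_fst).mul (hφ.comp hswap)).aemeasurable
    -- For fixed `a`, the measure preserving substitution `w ↦ act a w` moves the action from `φ` to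
    -- `k`.
    _ = ∫⁻ a, ∫⁻ w, k (act a⁻¹ w) * φ w ∂μ ∂da := by
        congr 1; ext a
        conv_rhs => rw [← hpres a]
        refine Eq.trans ?_ (lintegral_map ((hk.comp (hact' _)).mul hφ) (hact' a)).symm
        simp only [Function.comp_apply, Pi.mul_apply, hinv]
    _ = ∫⁻ w, ∫⁻ a, k (act a⁻¹ w) * φ w ∂da ∂μ :=
        (lintegral_lintegral_swap
          ((hk.comp (hact.comp (measurable_snd.inv.prodMk measurable_fst))).mul
            (hφ.comp measurable_fst)).aemeasurable).symm
    _ = ∫⁻ w, φ w * ∫⁻ a, k (act a w) ∂da ∂μ := by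
        congr 1; ext w
        refine (lintegral_mul_const _ (hk.comp ((hact2 w).comp measurable_inv))).trans ?_
        rw [mul_comm]
        congr 1
        exact lintegral_inv_eq_self (fun a => k (act a w))

/-! ### The orbital measure of the matrices of rank one -/

/-- The action `a (p, q) = (a p, a⁻¹ q)`. -/
def pairAct (a : Fˣ) (x : (ι → F) × (ι → F)) : (ι → F) × (ι → F) :=
  ((a : F) • x.1, ((a⁻¹ : Fˣ) : F) • x.2)

lemma measurable_pairAct :
    Measurable (Function.uncurry (pairAct : Fˣ → (ι → F) × (ι → F) → _)) := by
  unfold pairAct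
  have h : Continuous fun z : Fˣ × ((ι → F) × (ι → F)) => ((z.1⁻¹ : Fˣ) : F) :=
    Units.continuous_val.comp (continuous_inv.comp continuous_fst)
  have h' : Continuous fun z : Fˣ × ((ι → F) × (ι → F)) => (z.1 : F) :=
    Units.continuous_val.comp continuous_fst
  exact Continuous.measurable (by unfold Function.uncurry; fun_prop)

lemma pairAct_inv_pairAct (a : Fˣ) (x : (ι → F) × (ι → F)) : pairAct a⁻¹ (pairAct a x) = x := by
  ext <;> simp [pairAct]

lemma map_smul_vecHaar (a : Fˣ) :
    distribHaarChar F a ^ Fintype.card ι • (vecHaar F ι).map (fun x => (a : F) • x) =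
      vecHaar F ι := by
  have := pi_smul_eq (κ := ι) (fieldHaar F) (fieldHaar F) (fun _ => distribHaarChar F a)
    (fun _ x => (a : F) * x) (fun _ => measurable_const_mul _) (fun _ => map_mul_fieldHaar a)
  rw [Finset.prod_const, Finset.card_univ] at this
  exact this

lemma smul_eq_iff_eq_inv_smul {Ω : Type*} [MeasurableSpace Ω] {μ ν : Measure Ω} {c : ℝ≥0}
    (hc : c ≠ 0) (h : c • μ = ν) : μ = c⁻¹ • ν := by
  rw [← h, smul_smul, inv_mul_cancel₀ hc, one_smul]

lemma distribHaarChar_ne_zero (a : Fˣ) : distribHaarChar F a ≠ 0 := distribHaarChar_pos.ne'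

/-- The two factors scale by opposite powers of the module of `a`. -/
lemma map_pairAct (a : Fˣ) :
    ((vecHaar F ι).prod (vecHaar F ι)).map (pairAct a) = (vecHaar F ι).prod (vecHaar F ι) := by
  have h1 := smul_eq_iff_eq_inv_smul (pow_ne_zero _ (distribHaarChar_ne_zero a))
    (map_smul_vecHaar (ι := ι) a)
  have h2 := smul_eq_iff_eq_inv_smul (pow_ne_zero _ (distribHaarChar_ne_zero a⁻¹))
    (map_smul_vecHaar (ι := ι) a⁻¹)
  have e : (pairAct a : (ι → F) × (ι → F) → _) =
    Prod.map (fun x => (a : F) • x) (fun x => ((a⁻¹ : Fˣ) : F) • x) := rfl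
  rw [e, ← Measure.map_prod_map _ _ (measurable_const_smul _) (measurable_const_smul _), h1, h2]
  simp only [ENNReal.smul_def, Measure.prod_smul_left, Measure.prod_smul_right,
    smul_smul]
  rw [← ENNReal.coe_mul, ← mul_inv, ← mul_pow, ← map_mul]
  simp

/-- The map `(p, q) ↦ p ᵗq`. -/
def rankOne (x : (ι → F) × (ι → F)) : Matrix ι ι F := Matrix.vecMulVec x.1 x.2

lemma continuous_rankOne : Continuous (rankOne : (ι → F) × (ι → F) → Matrix ι ι F) := by
  unfold rankOne
  fun_prop

lemma rankOne_pairAct (a : Fˣ) (x : (ι → F) × (ι → F)) : rankOne (pairAct a x) = rankOne x := by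
  ext i j
  simp [rankOne, pairAct, Matrix.vecMulVec_apply]
  field_simp

/-- The pairs of vectors the first of which has norm one. -/
def unitPairs (F ι : Type*) [NontriviallyNormedField F] [Fintype ι] : Set ((ι → F) × (ι → F)) :=
  {x | ‖x.1‖ = 1}

lemma measurableSet_unitPairs : MeasurableSet (unitPairs F ι) :=
  (isClosed_eq (by fun_prop) (by fun_prop)).measurableSet

/-- The orbital measure of the matrices of rank one. -/
def rankOneMeasure (F ι : Type*) [NontriviallyNormedField F] [ProperSpace F]
    [MeasurableSpace F] [BorelSpace F] [Fintype ι] : Measure (Matrix ι ι F) :=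
  (((vecHaar F ι).prod (vecHaar F ι)).restrict (unitPairs F ι)).map rankOne

lemma lintegral_rankOneMeasure {f : Matrix ι ι F → ℝ≥0∞} (hf : Measurable f) :
    ∫⁻ z, f z ∂rankOneMeasure F ι = ∫⁻ x in unitPairs F ι, f (rankOne x)
      ∂(vecHaar F ι).prod (vecHaar F ι) := by
  rw [rankOneMeasure, lintegral_map hf continuous_rankOne.measurable]

/-- The integral of an invariant function does not depend on the choice of a sphere. -/
lemma setLIntegral_sphere_eq (g : GL ι F) {f : Matrix ι ι F → ℝ≥0∞} (hf : Measurable f) :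
    ∫⁻ x in {x | ‖(g : Matrix ι ι F).mulVec x.1‖ = 1}, f (rankOne x)
      ∂(vecHaar F ι).prod (vecHaar F ι) = ∫⁻ z, f z ∂rankOneMeasure F ι := by
  let da : Measure Fˣ := Measure.haar
  rw [lintegral_rankOneMeasure hf]
  have hD : MeasurableSet {x : (ι → F) × (ι → F) | ‖(g : Matrix ι ι F).mulVec x.1‖ = 1} :=
    (isClosed_eq (by fun_prop) (by fun_prop)).measurableSet
  have hf' : Measurable fun x : (ι → F) × (ι → F) => f (rankOne x) :=
    hf.comp continuous_rankOne.measurable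
  -- Unfold with the integrand cut to the `g`-sphere on one side and the indicator of the standard
  -- sphere on the other. An orbit with `p ≠ 0` meets either sphere in a set of parameters of
  -- measure `da (unitSphere F)`, and `rankOne` is constant on orbits, so both sides become this
  -- constant times one of the two integrals.
  have key := lintegral_mul_orbit ((vecHaar F ι).prod (vecHaar F ι)) da pairAct
    measurable_pairAct map_pairAct pairAct_inv_pairAct
    (k := Set.indicator {x | ‖(g : Matrix ι ι F).mulVec x.1‖ = 1} fun x => f (rankOne x))
    (φ := Set.indicator (unitPairs F ι) 1) (hf'.indicator hD)
    (measurable_one.indicator measurableSet_unitPairs)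
  have hsph : ∀ v : ι → F, v ≠ 0 → MeasurableSet {a : Fˣ | ‖(a : F) • v‖ = 1} := fun v _ =>
    (isClosed_eq ((Units.continuous_val.smul continuous_const).norm)
      continuous_const).measurableSet
  have e1 : ∀ x : (ι → F) × (ι → F), x.1 ≠ 0 →
      ∫⁻ a, Set.indicator (unitPairs F ι) 1 (pairAct a x) ∂da = da (unitSphere F) := by
    intro x hx
    rw [← measure_norm_smul_eq_one da hx, ← lintegral_indicator_one (hsph _ hx)]
    rfl
  have e2 : ∀ x : (ι → F) × (ι → F), x.1 ≠ 0 →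
      ∫⁻ a, Set.indicator {x | ‖(g : Matrix ι ι F).mulVec x.1‖ = 1} (fun x => f (rankOne x))
        (pairAct a x) ∂da = da (unitSphere F) * f (rankOne x) := by
    intro x hx
    have hgx : (g : Matrix ι ι F).mulVec x.1 ≠ 0 := by
      intro h0
      apply hx
      have := (mulVecEquiv g).injective (a₁ := x.1) (a₂ := 0) (by rw [map_zero]; exact h0)
      exact this
    rw [← measure_norm_smul_eq_one da hgx, mul_comm, ← setLIntegral_const,
      ← lintegral_indicator (hsph _ hgx)]
    congr 1
    ext a
    simp only [Set.indicator_apply, Set.mem_ofPred_eq, rankOne_pairAct]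
    simp only [pairAct, Matrix.mulVec_smul]
  have e3 : ∫⁻ w, Set.indicator {x | ‖(g : Matrix ι ι F).mulVec x.1‖ = 1}
      (fun x => f (rankOne x)) w * ∫⁻ a, Set.indicator (unitPairs F ι) 1 (pairAct a w) ∂da
        ∂(vecHaar F ι).prod (vecHaar F ι) =
      (∫⁻ x in {x | ‖(g : Matrix ι ι F).mulVec x.1‖ = 1}, f (rankOne x)
        ∂(vecHaar F ι).prod (vecHaar F ι)) * da (unitSphere F) := by
    rw [← lintegral_indicator hD, ← lintegral_mul_const _ (hf'.indicator hD)]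
    congr 1
    ext w
    by_cases hw : w ∈ {x : (ι → F) × (ι → F) | ‖(g : Matrix ι ι F).mulVec x.1‖ = 1}
    · rw [e1]
      intro h0
      simp [h0] at hw
    · simp [Set.indicator_of_notMem hw]
  have e4 : ∫⁻ w, Set.indicator (unitPairs F ι) 1 w *
      ∫⁻ a, Set.indicator {x | ‖(g : Matrix ι ι F).mulVec x.1‖ = 1} (fun x => f (rankOne x))
        (pairAct a w) ∂da ∂(vecHaar F ι).prod (vecHaar F ι) =
      (∫⁻ x in unitPairs F ι, f (rankOne x) ∂(vecHaar F ι).prod (vecHaar F ι)) *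
        da (unitSphere F) := by
    rw [← lintegral_indicator measurableSet_unitPairs,
      ← lintegral_mul_const _ (hf'.indicator measurableSet_unitPairs)]
    congr 1
    ext w
    by_cases hw : w ∈ unitPairs F ι
    · rw [e2 w (by intro h0; simp [unitPairs, h0] at hw)]
      simp [hw, mul_comm]
    · simp [Set.indicator_of_notMem hw]
  rw [e3, e4] at key
  exact (ENNReal.mul_left_inj (measure_unitSphere_ne_zero da)
    (measure_unitSphere_ne_top da)).1 key

lemma vecMulVec_mulVec_vecMul (g h : Matrix ι ι F) (p q : ι → F) :
    Matrix.vecMulVec (g.mulVec p) (h.vecMul q) = g * Matrix.vecMulVec p q * h := by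
  rw [Matrix.vecMulVec_eq Unit, Matrix.vecMulVec_eq Unit, Matrix.replicateCol_mulVec,
    Matrix.replicateRow_vecMul]
  simp only [Matrix.mul_assoc]

/-- Equivariance of the orbital measure of the matrices of rank one. -/
lemma map_rankOneMeasure (g h : GL ι F) :
    (rankOneMeasure F ι).map (fun z => ((g⁻¹ : GL ι F) : Matrix ι ι F) * z * (h : Matrix ι ι F)) =
      (distribHaarChar F (Matrix.GeneralLinearGroup.det g) *
        (distribHaarChar F (Matrix.GeneralLinearGroup.det h))⁻¹ : ℝ≥0) • rankOneMeasure F ι := by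
  have h1 := smul_eq_iff_eq_inv_smul (distribHaarChar_ne_zero _) (map_mulVec_vecHaar g⁻¹)
  have h2 := smul_eq_iff_eq_inv_smul (distribHaarChar_ne_zero _) (map_vecMul_vecHaar h)
  rw [map_inv, map_inv, inv_inv] at h1
  have hm : Measurable fun z : Matrix ι ι F =>
      ((g⁻¹ : GL ι F) : Matrix ι ι F) * z * (h : Matrix ι ι F) :=
    Continuous.measurable (by fun_prop)
  have h3 : ((vecHaar F ι).prod (vecHaar F ι)).map
      (Prod.map (fun x => ((g⁻¹ : GL ι F) : Matrix ι ι F).mulVec x)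
        (fun x => (h : Matrix ι ι F).vecMul x)) =
      (distribHaarChar F (Matrix.GeneralLinearGroup.det g) *
        (distribHaarChar F (Matrix.GeneralLinearGroup.det h))⁻¹ : ℝ≥0) •
          (vecHaar F ι).prod (vecHaar F ι) := by
    rw [← Measure.map_prod_map _ _ (measurable_mulVec _) (measurable_vecMul _), h1, h2]
    simp only [ENNReal.smul_def, Measure.prod_smul_left, Measure.prod_smul_right, smul_smul]
    rw [← ENNReal.coe_mul, mul_comm]
  refine Measure.ext_of_lintegral _ fun f hf => ?_
  refine (lintegral_map hf hm).trans ((lintegral_rankOneMeasure (hf.comp hm)).trans ?_)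
  -- The substitution `(p, q) ↦ (g⁻¹ p, q h)` turns the condition `‖p‖ = 1` into `‖g p‖ = 1`, so the
  -- target integral is first moved to the latter sphere.
  rw [lintegral_smul_measure, ← setLIntegral_sphere_eq g hf]
  have hD : MeasurableSet {x : (ι → F) × (ι → F) | ‖(g : Matrix ι ι F).mulVec x.1‖ = 1} :=
    (isClosed_eq (by fun_prop) (by fun_prop)).measurableSet
  have hf' : Measurable fun x : (ι → F) × (ι → F) => f (rankOne x) :=
    hf.comp continuous_rankOne.measurable
  rw [← lintegral_indicator hD, ← lintegral_indicator measurableSet_unitPairs,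
    ← lintegral_smul_measure, ← h3,
    lintegral_map (hf'.indicator hD) ((measurable_mulVec _).prodMap (measurable_vecMul _))]
  congr 1
  ext x
  simp only [Set.indicator_apply, Set.mem_ofPred_eq, unitPairs, Prod.map, rankOne,
    vecMulVec_mulVec_vecMul, Matrix.mulVec_mulVec]
  simp

/-- Matrices with bounded entries. -/
def boxMatrices (r : ℝ) : Set (Matrix ι ι F) := {z | ∀ i j, ‖z i j‖ ≤ r}

lemma norm_le_of_rankOne_mem {x : (ι → F) × (ι → F)} (hx : x ∈ unitPairs F ι) {r : ℝ}
    (hr : 0 ≤ r) : rankOne x ∈ (boxMatrices r : Set (Matrix ι ι F)) ↔ ‖x.2‖ ≤ r := by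
  have hx1 : ‖x.1‖ = 1 := hx
  constructor
  · intro h
    have hne : x.1 ≠ 0 := by rintro h0; simp [h0] at hx1
    obtain ⟨j, hj⟩ := Function.ne_iff.1 hne
    have : Nonempty ι := ⟨j⟩
    obtain ⟨i, hi⟩ := Finite.exists_max fun i => ‖x.1 i‖
    have h1 : ‖x.1 i‖ = 1 := by
      rw [← hx1]
      exact le_antisymm (norm_le_pi_norm _ i) ((pi_norm_le_iff_of_nonneg (norm_nonneg _)).2 hi)
    refine (pi_norm_le_iff_of_nonneg hr).2 fun k => ?_
    have := h i k
    rwa [rankOne, Matrix.vecMulVec_apply, norm_mul, h1, one_mul] at this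
  · intro h i j
    rw [rankOne, Matrix.vecMulVec_apply, norm_mul]
    calc ‖x.1 i‖ * ‖x.2 j‖ ≤ 1 * r :=
          mul_le_mul ((norm_le_pi_norm _ i).trans hx1.le) ((norm_le_pi_norm _ j).trans h)
            (norm_nonneg _) zero_le_one
      _ = r := one_mul r

lemma isClosed_boxMatrices (r : ℝ) : IsClosed (boxMatrices r : Set (Matrix ι ι F)) := by
  simp only [boxMatrices, Set.ofPred_forall]
  exact isClosed_iInter fun i => isClosed_iInter fun j =>
    isClosed_le ((continuous_id.matrix_elem i j).norm) continuous_const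

lemma isCompact_boxMatrices (r : ℝ) : IsCompact (boxMatrices r : Set (Matrix ι ι F)) := by
  have : (boxMatrices r : Set (Matrix ι ι F)) = (Set.univ.pi fun _ : ι => Set.univ.pi fun _ : ι =>
      Metric.closedBall (0 : F) r : Set (ι → ι → F)) := by
    ext z
    simp only [boxMatrices, Set.mem_ofPred_eq]
    constructor
    · intro h i _ j _
      exact mem_closedBall_zero_iff.2 (h i j)
    · intro h i j
      exact mem_closedBall_zero_iff.1 (h i trivial j trivial)
  rw [this]
  exact isCompact_univ_pi fun _ => isCompact_univ_pi fun _ => isCompact_closedBall _ _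

lemma exists_subset_boxMatrices {K : Set (Matrix ι ι F)} (hK : IsCompact K) :
    ∃ r : ℝ, 0 < r ∧ K ⊆ boxMatrices r := by
  have h : ∀ i j, ∃ r, ∀ z ∈ K, ‖z i j‖ ≤ r := fun i j =>
    hK.exists_bound_of_continuousOn (continuous_id.matrix_elem i j).continuousOn
  choose r hr using h
  refine ⟨1 + ∑ i, ∑ j, |r i j|, by positivity, fun z hz i j => (hr i j z hz).trans ?_⟩
  calc r i j ≤ |r i j| := le_abs_self _
    _ ≤ ∑ j, |r i j| := Finset.single_le_sum (f := fun j => |r i j|)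
        (fun _ _ => abs_nonneg _) (Finset.mem_univ j)
    _ ≤ ∑ i, ∑ j, |r i j| := Finset.single_le_sum (f := fun i => ∑ j, |r i j|)
        (fun _ _ => Finset.sum_nonneg fun _ _ => abs_nonneg _) (Finset.mem_univ i)
    _ ≤ _ := by linarith

/-- On the section `‖p‖ = 1` the size of `p ᵗq` is that of `q`, so preimages of bounded sets are
bounded. -/
instance : IsFiniteMeasureOnCompacts (rankOneMeasure F ι) where
  lt_top_of_isCompact := fun K hK => by
    obtain ⟨r, hr, hKr⟩ := exists_subset_boxMatrices hK
    rw [rankOneMeasure, Measure.map_apply continuous_rankOne.measurable hK.measurableSet,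
      Measure.restrict_apply (continuous_rankOne.measurable hK.measurableSet)]
    refine lt_of_le_of_lt (measure_mono
      (t := Metric.sphere (0 : ι → F) 1 ×ˢ Metric.closedBall 0 r) ?_) ?_
    · rintro x ⟨hx, hx1⟩
      exact ⟨mem_sphere_zero_iff_norm.2 hx1,
        mem_closedBall_zero_iff.2 ((norm_le_of_rankOne_mem hx1 hr.le).1 (hKr hx))⟩
    · exact ((isCompact_sphere _ _).prod (isCompact_closedBall _ _)).measure_lt_top

end OrbitalMeasure
end

/-! ### Uniform local constancy, the matrix Fourier transform and the corank one measure -/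

noncomputable section

namespace OrbitalMeasure

set_option linter.unusedSectionVars false

/-- Locally constant functions with compact support are uniformly locally constant. -/
lemma exists_uniform_dist_of_isLocallyConstant {V : Type*} [PseudoMetricSpace V] {f : V → ℂ}
    (hf : IsLocallyConstant f) (hc : HasCompactSupport f) :
    ∃ δ > 0, ∀ x y, dist x y < δ → f x = f y := by
  obtain ⟨δ, hδ, h⟩ := lebesgue_number_lemma_of_metric (c := fun z : ℂ => f ⁻¹' {z}) hc
    (fun z => hf.isOpen_fiber z) (fun x _ => Set.mem_iUnion.2 ⟨f x, rfl⟩)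
  have key : ∀ x ∈ tsupport f, ∀ y, dist x y < δ → f x = f y := by
    intro x hx y hxy
    obtain ⟨z, hz⟩ := h x hx
    have h1 : f x = z := hz (Metric.mem_ball_self hδ)
    have h2 : f y = z := hz (by rw [Metric.mem_ball, dist_comm]; exact hxy)
    rw [h1, h2]
  refine ⟨δ, hδ, fun x y hxy => ?_⟩
  by_cases hx : x ∈ tsupport f
  · exact key x hx y hxy
  by_cases hy : y ∈ tsupport f
  · exact (key y hy x (by rwa [dist_comm])).symm
  · rw [image_eq_zero_of_notMem_tsupport hx, image_eq_zero_of_notMem_tsupport hy]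

variable {F : Type*} [NontriviallyNormedField F] [IsUltrametricDist F] [ProperSpace F]
  [MeasurableSpace F] [BorelSpace F]
variable {n : ℕ}

lemma exists_unit_norm_lt (F : Type*) [NontriviallyNormedField F] {r : ℝ} (hr : 0 < r) :
    ∃ c : Fˣ, ‖(c : F)‖ < r := by
  obtain ⟨x, hx, hxr⟩ := NormedField.exists_norm_lt F hr
  exact ⟨Units.mk0 x (norm_pos_iff.1 hx), hxr⟩

lemma exists_boxMatrices_invariance {f : Matrix (Fin n) (Fin n) F → ℂ} (hf : IsLocallyConstant f)
    (hc : HasCompactSupport f) :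
    ∃ c : Fˣ, ‖(c : F)‖ < 1 ∧ ∀ e, ∀ e' ∈ boxMatrices ‖(c : F)‖, f (e + e') = f e := by
  obtain ⟨δ, hδ, h⟩ := exists_uniform_dist_of_isLocallyConstant
    (V := Fin n → Fin n → F) (f := f) hf hc
  obtain ⟨c, hc⟩ := exists_unit_norm_lt F (lt_min hδ one_pos)
  refine ⟨c, hc.trans_le (min_le_right _ _), fun e e' he' => h _ _ ?_⟩
  have : dist (α := Fin n → Fin n → F) (e + e') e ≤ ‖(c : F)‖ := by
    refine (dist_pi_le_iff (norm_nonneg _)).2 fun i =>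
      (dist_pi_le_iff (norm_nonneg _)).2 fun j => ?_
    rw [dist_eq_norm]
    simpa using he' i j
  exact this.trans_lt (hc.trans_le (min_le_left _ _))

/-! ### The Fourier transform on matrices -/

variable (χ : UnramifiedCharacter F)

/-- The Fourier transform with respect to the trace pairing. -/
def matFourier (f : Matrix (Fin n) (Fin n) F → ℂ) (w : Matrix (Fin n) (Fin n) F) : ℂ :=
  ∫ e, chi χ (e * w).trace * f e ∂matHaar F (Fin n)

variable {f : Matrix (Fin n) (Fin n) F → ℂ}

lemma continuous_matFourier (hf : Continuous f) (hc : HasCompactSupport f) :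
    Continuous (matFourier χ f) := by
  refine continuous_of_dominated (bound := fun e => ‖f e‖) ?_ ?_ ?_ ?_
  · intro w
    exact (((continuous_chi χ).comp (by fun_prop)).mul hf).aestronglyMeasurable
  · intro w
    exact .of_forall fun e => by rw [norm_mul, norm_chi, one_mul]
  · exact (hf.integrable_of_hasCompactSupport hc).norm
  · refine .of_forall fun e => ?_
    exact ((continuous_chi χ).comp (by fun_prop)).mul continuous_const

/-- If the entry `w i j` is too large, translation by `c E_{ji}` leaves `f` unchanged and multiplies
the integral by `χ(c w i j) ≠ 1`. -/
lemma matFourier_eq_zero {c : Fˣ} (h : ∀ e, ∀ e' ∈ boxMatrices ‖(c : F)‖, f (e + e') = f e)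
    {w : Matrix (Fin n) (Fin n) F} (hw : w ∉ boxMatrices ‖((c⁻¹ : Fˣ) : F)‖) :
    matFourier χ f w = 0 := by
  have hc : 0 < ‖(c : F)‖ := norm_pos_iff.2 c.ne_zero
  simp only [boxMatrices, Set.mem_ofPred_eq, not_forall, not_le, Units.val_inv_eq_inv_val,
    norm_inv] at hw
  obtain ⟨i, j, hij⟩ := hw
  set e' : Matrix (Fin n) (Fin n) F := Matrix.single j i (c : F) with he'
  have hmem : e' ∈ boxMatrices ‖(c : F)‖ := by
    intro k l
    rw [he', Matrix.single_apply]
    split_ifs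
    · exact le_rfl
    · rw [norm_zero]; exact norm_nonneg _
  have htr : (e' * w).trace = c * w i j := by
    rw [he', Matrix.trace_single_mul]
    simp
  have hne : chi χ (e' * w).trace ≠ 1 := by
    rw [Ne, chi_eq_one_iff, htr, norm_mul, not_le]
    rwa [inv_lt_iff_one_lt_mul₀' hc] at hij
  have e : matFourier χ f w = chi χ (e' * w).trace * matFourier χ f w := by
    unfold matFourier
    conv_lhs => rw [← integral_add_right_eq_self _ e']
    rw [← integral_const_mul]
    congr 1
    ext x
    rw [h x e' hmem, Matrix.add_mul, Matrix.trace_add, chi_add]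
    ring
  have : (1 - chi χ (e' * w).trace) * matFourier χ f w = 0 := by linear_combination e
  exact (mul_eq_zero.1 this).resolve_left (sub_ne_zero.2 hne.symm)

lemma hasCompactSupport_matFourier (hf : IsLocallyConstant f) (hc : HasCompactSupport f) :
    HasCompactSupport (matFourier χ f) := by
  obtain ⟨c, -, h⟩ := exists_boxMatrices_invariance hf hc
  exact .intro (isCompact_boxMatrices _) fun w hw => matFourier_eq_zero χ h hw

/-! ### The orbital measure of the matrices of corank one -/

/-- The inverse of the first coordinate of norm one, as a linear form. -/
def pivotForm (p : Fin n → F) : Fin n → F := fun j =>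
  if ‖p j‖ = 1 ∧ ∀ k < j, ‖p k‖ ≠ 1 then (p j)⁻¹ else 0

lemma measurable_pivotForm : Measurable (pivotForm : (Fin n → F) → Fin n → F) := by
  refine measurable_pi_lambda _ fun j => ?_
  have h1 : ∀ k, MeasurableSet {p : Fin n → F | ‖p k‖ = 1} := fun k =>
    (isClosed_eq (by fun_prop) continuous_const).measurableSet
  have h2 : MeasurableSet {p : Fin n → F | ‖p j‖ = 1 ∧ ∀ k < j, ‖p k‖ ≠ 1} := by
    have : {p : Fin n → F | ∀ k < j, ‖p k‖ ≠ 1} = ⋂ k, ⋂ (_ : k < j), {p | ‖p k‖ = 1}ᶜ := by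
      ext p; simp
    have h3 : MeasurableSet {p : Fin n → F | ∀ k < j, ‖p k‖ ≠ 1} := by
      rw [this]
      exact MeasurableSet.iInter fun k => MeasurableSet.iInter fun _ => (h1 k).compl
    exact (h1 j).inter h3
  exact Measurable.ite h2 (measurable_pi_apply j).inv measurable_const

lemma norm_pivotForm_le (p : Fin n → F) (j : Fin n) : ‖pivotForm p j‖ ≤ 1 := by
  unfold pivotForm
  split_ifs with h
  · rw [norm_inv, h.1, inv_one]
  · simp

/-- Only the first unit coordinate contributes. With `norm_pivotForm_le`, this gives a form `λ` of
norm at most one with `λ(p) = 1`; taking the first such coordinate makes the choice measurable in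
`p`. -/
lemma pivotForm_dotProduct {p : Fin n → F} (hp : ‖p‖ = 1) : pivotForm p ⬝ᵥ p = 1 := by
  have hne : p ≠ 0 := by rintro rfl; simp at hp
  obtain ⟨j, hj⟩ := Function.ne_iff.1 hne
  have : Nonempty (Fin n) := ⟨j⟩
  obtain ⟨i, hi⟩ := Finite.exists_max fun i => ‖p i‖
  have h1 : ‖p i‖ = 1 := by
    rw [← hp]
    exact le_antisymm (norm_le_pi_norm _ i) ((pi_norm_le_iff_of_nonneg (norm_nonneg _)).2 hi)
  obtain ⟨k, hk, hmin⟩ := WellFounded.has_min (wellFounded_lt (α := Fin n)) {k | ‖p k‖ = 1} ⟨i, h1⟩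
  have hk1 : ‖p k‖ = 1 := hk
  rw [dotProduct, Finset.sum_eq_single k]
  · have : ‖p k‖ = 1 ∧ ∀ l < k, ‖p l‖ ≠ 1 := ⟨hk, fun l hl h => hmin l h hl⟩
    rw [pivotForm, if_pos this, inv_mul_cancel₀]
    rintro h0
    simp [h0] at hk1
  · intro l _ hl
    rw [pivotForm, if_neg, zero_mul]
    rintro ⟨h2, h3⟩
    rcases lt_or_gt_of_ne hl with h | h
    · exact hmin l h2 h
    · exact h3 k h hk
  · simp

/-- The pairs `(p, e)` with `‖p‖ = 1` and `‖e p‖ ≤ 1`. -/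
def thickKernelPairs (F : Type*) [NontriviallyNormedField F] (n : ℕ) :
    Set ((Fin n → F) × Matrix (Fin n) (Fin n) F) :=
  {x | ‖x.1‖ = 1 ∧ ‖x.2.mulVec x.1‖ ≤ 1}

lemma measurableSet_thickKernelPairs : MeasurableSet (thickKernelPairs F n) := by
  have h1 : IsClosed {x : (Fin n → F) × Matrix (Fin n) (Fin n) F | ‖x.1‖ = 1} :=
    isClosed_eq (by fun_prop) (by fun_prop)
  have h2 : IsClosed {x : (Fin n → F) × Matrix (Fin n) (Fin n) F | ‖x.2.mulVec x.1‖ ≤ 1} :=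
    isClosed_le (by fun_prop) (by fun_prop)
  exact (h1.inter h2).measurableSet

/-- The matrix `e - (e p) ᵗλ`, which kills `p`. -/
def killVector (x : (Fin n → F) × Matrix (Fin n) (Fin n) F) : Matrix (Fin n) (Fin n) F :=
  x.2 - Matrix.vecMulVec (x.2.mulVec x.1) (pivotForm x.1)

lemma measurable_killVector : Measurable (killVector : _ → Matrix (Fin n) (Fin n) F) := by
  have h : Continuous fun y : (Matrix (Fin n) (Fin n) F × (Fin n → F)) × (Fin n → F) =>
      y.1.1 - Matrix.vecMulVec (y.1.1.mulVec y.1.2) y.2 := by fun_prop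
  exact h.measurable.comp
    ((measurable_snd.prodMk measurable_fst).prodMk (measurable_pivotForm.comp measurable_fst))

/-- The orbital measure of the matrices of corank one. -/
def corankOneMeasure (F : Type*) [NontriviallyNormedField F] [ProperSpace F]
    [MeasurableSpace F] [BorelSpace F] (n : ℕ) : Measure (Matrix (Fin n) (Fin n) F) :=
  (((vecHaar F (Fin n)).prod (matHaar F (Fin n))).restrict (thickKernelPairs F n)).map killVector

/-- The matrix `e` is recovered from `killVector (p, e)` by adding `(e p) ᵗλ`, whose entries have
norm at most one on `thickKernelPairs`. Bounded images thus have bounded preimages. -/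
instance : IsFiniteMeasureOnCompacts (corankOneMeasure F n) where
  lt_top_of_isCompact := fun K hK => by
    obtain ⟨r, hr, hKr⟩ := exists_subset_boxMatrices hK
    rw [corankOneMeasure, Measure.map_apply measurable_killVector hK.measurableSet,
      Measure.restrict_apply (measurable_killVector hK.measurableSet)]
    refine lt_of_le_of_lt (measure_mono
      (t := Metric.sphere (0 : Fin n → F) 1 ×ˢ boxMatrices (max r 1)) ?_) ?_
    · rintro ⟨p, e⟩ ⟨hx, hx1, hx2⟩
      refine ⟨mem_sphere_zero_iff_norm.2 hx1, fun i j => ?_⟩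
      have h1 : e i j = killVector (p, e) i j + e.mulVec p i * pivotForm p j := by
        simp [killVector, Matrix.vecMulVec_apply]
      change ‖e i j‖ ≤ _
      rw [h1]
      refine (IsUltrametricDist.norm_add_le_max _ _).trans (max_le_max (hKr hx i j) ?_)
      rw [norm_mul]
      exact mul_le_one₀ ((norm_le_pi_norm _ i).trans hx2) (norm_nonneg _) (norm_pivotForm_le p j)
    · exact ((isCompact_sphere _ _).prod (isCompact_boxMatrices _)).measure_lt_top

/-! ### The Fourier transform of the orbital measure of the matrices of rank one -/

lemma trace_mul_rankOne (e : Matrix (Fin n) (Fin n) F) (x : (Fin n → F) × (Fin n → F)) :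
    (e * rankOne x).trace = x.2 ⬝ᵥ e.mulVec x.1 := by
  rw [rankOne, Matrix.mul_vecMulVec, Matrix.trace_vecMulVec, dotProduct_comm]

/-- The inner integral over the large ball is an integral over a small neighbourhood of the
annihilator of `p`. -/
lemma integral_matFourier_ball (hf : Continuous f) (hc : HasCompactSupport f) (c : Fˣ)
    (p : Fin n → F) :
    ∫ q in Metric.closedBall 0 ‖((c⁻¹ : Fˣ) : F)‖, matFourier χ f (rankOne (p, q))
      ∂vecHaar F (Fin n) =
    ∫ e, ((distribHaarChar F c⁻¹ : ℝ) ^ n : ℝ) *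
      (if ‖e.mulVec p‖ ≤ ‖(c : F)‖ then f e else 0) ∂matHaar F (Fin n) := by
  have hc0 : 0 < ‖(c : F)‖ := norm_pos_iff.2 c.ne_zero
  unfold matFourier
  have hfin : IsFiniteMeasure ((vecHaar F (Fin n)).restrict
      (Metric.closedBall 0 ‖((c⁻¹ : Fˣ) : F)‖)) :=
    ⟨by rw [Measure.restrict_apply_univ]; exact (isCompact_closedBall _ _).measure_lt_top⟩
  rw [integral_integral_swap]
  · congr 1
    ext e
    simp only [trace_mul_rankOne]
    rw [integral_mul_const, setIntegral_chi_ball, Fintype.card_fin]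
    have : ‖((c⁻¹ : Fˣ) : F)‖ * ‖e.mulVec p‖ ≤ 1 ↔ ‖e.mulVec p‖ ≤ ‖(c : F)‖ := by
      rw [Units.val_inv_eq_inv_val, norm_inv, inv_mul_le_iff₀ hc0, mul_one]
    simp only [this]
    split_ifs <;> simp
  · have hcont : Continuous fun x : (Fin n → F) × Matrix (Fin n) (Fin n) F =>
        chi χ (x.2 * rankOne (p, x.1)).trace * f x.2 := by
      refine ((continuous_chi χ).comp ?_).mul (hf.comp continuous_snd)
      simp only [trace_mul_rankOne]
      fun_prop
    have hb : Integrable (fun x : (Fin n → F) × Matrix (Fin n) (Fin n) F => (1 : ℂ) * f x.2)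
        (((vecHaar F (Fin n)).restrict (Metric.closedBall 0 ‖((c⁻¹ : Fˣ) : F)‖)).prod
          (matHaar F (Fin n))) :=
      (integrable_const (1 : ℂ)).mul_prod (hf.integrable_of_hasCompactSupport hc)
    refine hb.mono hcont.aestronglyMeasurable (.of_forall fun x => ?_)
    simp [Function.uncurry, norm_chi]

lemma det_one_sub_smul_vecMulVec {p l : Fin n → F} (h : l ⬝ᵥ p = 1) (c : F) :
    (1 - (1 - c) • Matrix.vecMulVec p l : Matrix (Fin n) (Fin n) F).det = c := by
  have e : (1 - (1 - c) • Matrix.vecMulVec p l : Matrix (Fin n) (Fin n) F) =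
      1 + Matrix.replicateCol Unit (-(1 - c) • p) * Matrix.replicateRow Unit l := by
    rw [← Matrix.vecMulVec_eq, Matrix.smul_vecMulVec, neg_smul, sub_eq_add_neg]
  rw [e, Matrix.det_one_add_replicateCol_mul_replicateRow, dotProduct_smul, h]
  simp

/-- Contraction towards the annihilator of `p`. -/
lemma integral_thick_annihilator (c : Fˣ) (h : ∀ e, ∀ e' ∈ boxMatrices ‖(c : F)‖, f (e + e') = f e)
    {p : Fin n → F} (hp : ‖p‖ = 1) :
    ∫ e, ((distribHaarChar F c⁻¹ : ℝ) ^ n : ℝ) *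
      (if ‖e.mulVec p‖ ≤ ‖(c : F)‖ then f e else 0) ∂matHaar F (Fin n) =
    ∫ e, (if ‖e.mulVec p‖ ≤ 1 then f (killVector (p, e)) else 0) ∂matHaar F (Fin n) := by
  have hc0 : 0 < ‖(c : F)‖ := norm_pos_iff.2 c.ne_zero
  have hl := pivotForm_dotProduct hp
  set l := pivotForm p with hldef
  -- `S` multiplies `p` by `c` and is the identity on the kernel of `λ`. Substituting `e S` for `e`
  -- turns `‖e p‖ ≤ ‖c‖` into `‖e p‖ ≤ 1`, and the Jacobian, the `n`-th power of the module of `c`,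
  -- cancels the constant in front.
  set S : Matrix (Fin n) (Fin n) F := 1 - (1 - (c : F)) • Matrix.vecMulVec p l with hS
  have hdet : S.det = c := det_one_sub_smul_vecMulVec hl c
  have hdet0 : S.det ≠ 0 := by rw [hdet]; exact c.ne_zero
  set s : GL (Fin n) F := Matrix.GeneralLinearGroup.mkOfDetNeZero S hdet0
  have hsdet : Matrix.GeneralLinearGroup.det s = c := Units.ext hdet
  have hmap := map_mul_right_matHaar s
  rw [hsdet, Fintype.card_fin] at hmap
  have hmul : ∀ e : Matrix (Fin n) (Fin n) F, e * S =
      killVector (p, e) + (c : F) • Matrix.vecMulVec (e.mulVec p) l := by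
    intro e
    rw [hS, Matrix.mul_sub, Matrix.mul_one, Matrix.mul_smul, Matrix.mul_vecMulVec, killVector,
      sub_smul, one_smul]
    abel
  have hvec : ∀ e : Matrix (Fin n) (Fin n) F, (e * S).mulVec p = (c : F) • e.mulVec p := by
    intro e
    have hk : (Matrix.vecMulVec (e.mulVec p) l).mulVec p = e.mulVec p := by
      rw [Matrix.vecMulVec_mulVec, hl]
      simp
    rw [hmul, killVector, Matrix.add_mulVec, Matrix.sub_mulVec, Matrix.smul_mulVec]
    simp only [← hldef, hk, sub_self, zero_add]
  have hemb : MeasurableEmbedding fun e : Matrix (Fin n) (Fin n) F => e * (s : Matrix _ _ F) := by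
    refine Topology.IsClosedEmbedding.measurableEmbedding (Homeomorph.isClosedEmbedding
      { toFun := fun e : Matrix (Fin n) (Fin n) F => e * (s : Matrix (Fin n) (Fin n) F)
        invFun := fun e : Matrix (Fin n) (Fin n) F =>
          e * ((s⁻¹ : GL (Fin n) F) : Matrix (Fin n) (Fin n) F)
        left_inv := fun e => by simp [Matrix.mul_assoc]
        right_inv := fun e => by simp [Matrix.mul_assoc]
        continuous_toFun := by fun_prop
        continuous_invFun := by fun_prop })
  rw [integral_const_mul]
  conv_lhs => rw [← hmap]
  rw [integral_smul_nnreal_measure, hemb.integral_map, NNReal.smul_def, Complex.real_smul,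
    ← mul_assoc]
  have hone : (((distribHaarChar F c⁻¹ : ℝ) ^ n : ℝ) : ℂ) *
      (((distribHaarChar F c ^ n : ℝ≥0) : ℝ) : ℂ) = 1 := by
    rw [← Complex.ofReal_mul, NNReal.coe_pow, ← mul_pow, ← NNReal.coe_mul, ← map_mul]
    simp
  rw [hone, one_mul]
  congr 1
  ext e
  have hsS : (s : Matrix (Fin n) (Fin n) F) = S := rfl
  have hiff : ‖(e * S).mulVec p‖ ≤ ‖(c : F)‖ ↔ ‖e.mulVec p‖ ≤ 1 := by
    rw [hvec, norm_smul, mul_le_iff_le_one_right hc0]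
  simp only [hsS, hiff]
  split_ifs with he
  -- `e S` differs from `killVector (p, e)` by `c (e p) ᵗλ`, which lies in the box of radius `‖c‖`
  -- under which `f` is invariant.
  · rw [hmul]
    refine h _ _ fun i j => ?_
    rw [Matrix.smul_apply, Matrix.vecMulVec_apply, norm_smul, norm_mul]
    exact mul_le_of_le_one_right hc0.le (mul_le_one₀ ((norm_le_pi_norm _ i).trans he)
      (norm_nonneg _) (norm_pivotForm_le p j))
  · rfl

/-- The Fourier transform of the orbital measure of the matrices of rank one is the orbital
measure of the matrices of corank one. -/
theorem integral_corankOneMeasure (hf : IsLocallyConstant f) (hc : HasCompactSupport f) :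
    ∫ z, f z ∂corankOneMeasure F n = ∫ w, matFourier χ f w ∂rankOneMeasure F (Fin n) := by
  obtain ⟨c, -, h⟩ := exists_boxMatrices_invariance hf hc
  have hfc : Continuous f := hf.continuous
  have hFc := continuous_matFourier χ hfc hc
  have hFint : Integrable (matFourier χ f) (rankOneMeasure F (Fin n)) :=
    hFc.integrable_of_hasCompactSupport (hasCompactSupport_matFourier χ hf hc)
  have hfint : Integrable f (corankOneMeasure F n) := hfc.integrable_of_hasCompactSupport hc
  have hS : MeasurableSet (Metric.sphere (0 : Fin n → F) 1) :=
    Metric.isClosed_sphere.measurableSet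
  set B := Metric.closedBall (0 : Fin n → F) ‖((c⁻¹ : Fˣ) : F)‖ with hB
  have hBm : MeasurableSet B := Metric.isClosed_closedBall.measurableSet
  have hFs := hFc.aestronglyMeasurable (μ := rankOneMeasure F (Fin n))
  have hsub : Metric.sphere (0 : Fin n → F) 1 ×ˢ B ⊆ unitPairs F (Fin n) := fun x hx =>
    mem_sphere_zero_iff_norm.1 hx.1
  rw [rankOneMeasure] at hFint hFs ⊢
  rw [integrable_map_measure hFs continuous_rankOne.measurable.aemeasurable] at hFint
  -- The Fourier transform of `f` vanishes outside the box of radius `‖c⁻¹‖`, so `q` may be confined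
  -- to the ball `B` on which `integral_matFourier_ball` applies.
  rw [integral_map continuous_rankOne.measurable.aemeasurable hFs,
    setIntegral_eq_of_subset_of_forall_sdiff_eq_zero measurableSet_unitPairs hsub]
  rotate_left
  · rintro x ⟨hx1, hx2⟩
    refine matFourier_eq_zero χ h fun hx => hx2 ⟨mem_sphere_zero_iff_norm.2 hx1, ?_⟩
    exact mem_closedBall_zero_iff.2 ((norm_le_of_rankOne_mem hx1 (norm_nonneg _)).1 hx)
  have hint := hFint.mono_measure (Measure.restrict_mono hsub le_rfl)
  rw [← Measure.prod_restrict] at hint ⊢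
  rw [integral_prod (fun x => matFourier χ f (rankOne x)) hint]
  rw [corankOneMeasure] at hfint ⊢
  rw [integrable_map_measure hfint.1 measurable_killVector.aemeasurable] at hfint
  rw [integral_map measurable_killVector.aemeasurable hfc.aestronglyMeasurable,
    ← integral_indicator measurableSet_thickKernelPairs, integral_prod, ← integral_indicator hS]
  · congr 1
    ext p
    by_cases hp : p ∈ Metric.sphere (0 : Fin n → F) 1
    · have hp1 : ‖p‖ = 1 := mem_sphere_zero_iff_norm.1 hp
      rw [Set.indicator_of_mem hp, integral_matFourier_ball χ hfc hc,
        integral_thick_annihilator c h hp1]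
      congr 1
      ext e
      by_cases he : ‖e.mulVec p‖ ≤ 1
      · rw [if_pos he, Set.indicator_of_mem (show (p, e) ∈ thickKernelPairs F n from ⟨hp1, he⟩)]
      · rw [if_neg he, Set.indicator_of_notMem fun h' => he h'.2]
    · have hp1 : ‖p‖ ≠ 1 := fun h' => hp (mem_sphere_zero_iff_norm.2 h')
      rw [Set.indicator_of_notMem hp]
      refine (integral_congr_ae (g := fun _ => 0) (.of_forall fun e => ?_)).trans
        (integral_zero _ _)
      exact Set.indicator_of_notMem (fun h' => hp1 h'.1) _
  · exact (integrable_indicator_iff measurableSet_thickKernelPairs).2 hfint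

/-! ### Concentration on a rank -/

/-- For fixed `e`, the scalars `s` with `det (s + e) = 0` are the finitely many roots of a
characteristic polynomial. By Fubini some translate of the singular set by a scalar matrix is null,
and Haar measure is translation invariant. -/
lemma measure_det_eq_zero : matHaar F (Fin n) {e | e.det = 0} = 0 := by
  have hcont : Continuous fun x : F × Matrix (Fin n) (Fin n) F =>
      Matrix.scalar (Fin n) x.1 + x.2 := by
    refine Continuous.add ?_ continuous_snd
    exact (continuous_pi fun _ => continuous_fst).matrix_diagonal
  have hm : MeasurableSet {x : F × Matrix (Fin n) (Fin n) F |
      (Matrix.scalar (Fin n) x.1 + x.2).det = 0} :=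
    (isClosed_eq hcont.matrix_det continuous_const).measurableSet
  have h0 : ((fieldHaar F).prod (matHaar F (Fin n)))
      {x : F × Matrix (Fin n) (Fin n) F | (Matrix.scalar (Fin n) x.1 + x.2).det = 0} = 0 := by
    rw [Measure.prod_apply_symm hm]
    refine (lintegral_congr fun e => ?_).trans lintegral_zero
    refine Set.Finite.measure_zero (((-e).charpoly.finite_setOfPred_isRoot
      (-e).charpoly_monic.ne_zero).subset fun s hs => ?_) _
    change Polynomial.eval s (-e).charpoly = 0
    rw [Matrix.eval_charpoly, sub_neg_eq_add]
    exact hs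
  rw [Measure.measure_prod_null hm] at h0
  obtain ⟨s, hs⟩ := h0.exists
  have h1 := measure_preimage_add (matHaar F (Fin n)) (Matrix.scalar (Fin n) s) {e | e.det = 0}
  rw [← h1]
  exact hs

/-- This is the projection along `p` onto the kernel of `l`; its own kernel is the line of `p`. -/
lemma rank_one_sub_vecMulVec {p l : Fin n → F} (h : l ⬝ᵥ p = 1) :
    (1 - Matrix.vecMulVec p l).rank = n - 1 := by
  have hker : LinearMap.ker (1 - Matrix.vecMulVec p l).mulVecLin = F ∙ p := by
    ext v
    rw [LinearMap.mem_ker, Matrix.mulVecLin_apply, Matrix.sub_mulVec, Matrix.one_mulVec,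
      Matrix.vecMulVec_mulVec, op_smul_eq_smul, sub_eq_zero, Submodule.mem_span_singleton]
    constructor
    · exact fun hv => ⟨_, hv.symm⟩
    · rintro ⟨a, rfl⟩
      rw [dotProduct_smul, h, smul_eq_mul, mul_one]
  have hp : p ≠ 0 := by
    rintro rfl
    simp at h
  have h1 := LinearMap.finrank_range_add_finrank_ker (1 - Matrix.vecMulVec p l).mulVecLin
  rw [hker, finrank_span_singleton hp, Module.finrank_fin_fun] at h1
  rw [Matrix.rank]
  omega

lemma isOpen_le_matrix_rank (k : ℕ) : IsOpen {z : Matrix (Fin n) (Fin n) F | k ≤ z.rank} := by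
  have hlin : Continuous fun z : Matrix (Fin n) (Fin n) F =>
      LinearMap.toContinuousLinearMap (Matrix.toLin' z) :=
    LinearMap.continuous_of_finiteDimensional
      ((LinearMap.toContinuousLinearMap : ((Fin n → F) →ₗ[F] (Fin n → F)) ≃ₗ[F] _).toLinearMap ∘ₗ
        (Matrix.toLin' : Matrix (Fin n) (Fin n) F ≃ₗ[F] _).toLinearMap)
  have := (isOpen_setOfPred_nat_le_rank (𝕜 := F) (E := Fin n → F) (F := Fin n → F) k).preimage hlin
  convert this using 1
  ext z
  simp only [Set.mem_ofPred_eq, Set.mem_preimage, LinearMap.rank, ← Module.finrank_eq_rank,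
    Nat.cast_le]
  rfl

lemma measurableSet_rank_ne (k : ℕ) :
    MeasurableSet {z : Matrix (Fin n) (Fin n) F | z.rank ≠ k} := by
  have : {z : Matrix (Fin n) (Fin n) F | z.rank ≠ k} =
      {z | k + 1 ≤ z.rank} ∪ {z | k ≤ z.rank}ᶜ := by
    ext z
    simp only [Set.mem_ofPred_eq, Set.mem_union, Set.mem_compl_iff]
    omega
  rw [this]
  exact (isOpen_le_matrix_rank _).measurableSet.union (isOpen_le_matrix_rank _).measurableSet.compl

/-- `killVector (p, e)` is `e` times a projection of rank `n - 1`, and `e` is invertible almost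
everywhere. -/
lemma corankOneMeasure_rank_ne : corankOneMeasure F n {z | z.rank ≠ n - 1} = 0 := by
  have hdet : MeasurableSet {x : (Fin n → F) × Matrix (Fin n) (Fin n) F | x.2.det = 0} :=
    (isClosed_eq (by fun_prop) continuous_const).measurableSet
  have h0 : ((vecHaar F (Fin n)).prod (matHaar F (Fin n)))
      {x : (Fin n → F) × Matrix (Fin n) (Fin n) F | x.2.det = 0} = 0 := by
    rw [Measure.measure_prod_null hdet]
    exact .of_forall fun p => measure_det_eq_zero
  have hm := measurableSet_rank_ne (F := F) (n := n) (n - 1)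
  rw [corankOneMeasure, Measure.map_apply measurable_killVector hm,
    Measure.restrict_apply (measurable_killVector hm)]
  refine measure_mono_null ?_ h0
  rintro ⟨p, e⟩ ⟨hx, hp, -⟩
  by_contra hd
  refine hx ?_
  have h1 : killVector (p, e) = e * (1 - Matrix.vecMulVec p (pivotForm p)) := by
    rw [Matrix.mul_sub, Matrix.mul_one, Matrix.mul_vecMulVec, killVector]
  rw [h1, Matrix.rank_mul_eq_right_of_isUnit_det _ _ (isUnit_iff_ne_zero.2 hd),
    rank_one_sub_vecMulVec (pivotForm_dotProduct hp)]

lemma rank_rankOne {x : (Fin n → F) × (Fin n → F)} (h1 : x.1 ≠ 0) (h2 : x.2 ≠ 0) :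
    (rankOne x).rank = 1 := by
  refine le_antisymm (Matrix.rank_vecMulVec_le _ _) ?_
  rw [Nat.one_le_iff_ne_zero, Matrix.rank, Ne, Submodule.finrank_eq_zero, LinearMap.range_eq_bot]
  intro h
  obtain ⟨j, hj⟩ := Function.ne_iff.1 h2
  have h3 := LinearMap.congr_fun h (Pi.single j 1)
  rw [Matrix.mulVecLin_apply, rankOne, Matrix.vecMulVec_mulVec, op_smul_eq_smul,
    dotProduct_single_one, LinearMap.zero_apply, smul_eq_zero] at h3
  exact h3.elim hj h1

/-- On the section `p ≠ 0`, so the rank drops only where `q = 0`, which is a null set because `n ≠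
0`. -/
lemma rankOneMeasure_rank_ne (hn : n ≠ 0) :
    rankOneMeasure F (Fin n) {z | z.rank ≠ 1} = 0 := by
  have hm := measurableSet_rank_ne (F := F) (n := n) 1
  have h0 : vecHaar F (Fin n) {0} = 0 := by
    have : ({0} : Set (Fin n → F)) = Set.univ.pi fun _ => {0} := by
      ext x; simp [funext_iff]
    rw [this, vecHaar, Measure.pi_pi]
    simp [hn]
  rw [rankOneMeasure, Measure.map_apply continuous_rankOne.measurable hm,
    Measure.restrict_apply (continuous_rankOne.measurable hm)]
  refine measure_mono_null (t := Set.univ ×ˢ {0}) ?_ ?_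
  · rintro ⟨p, q⟩ ⟨hx, hp⟩
    refine ⟨trivial, ?_⟩
    by_contra hq
    refine hx (rank_rankOne ?_ hq)
    rintro h
    have h' : p = 0 := h
    simp [unitPairs, h'] at hp
  · rw [Measure.prod_prod, h0, mul_zero]

lemma isOpen_unitPairs : IsOpen (unitPairs F (Fin n)) := by
  have : unitPairs F (Fin n) = Prod.fst ⁻¹' Metric.sphere (0 : Fin n → F) 1 := by
    ext x; simp [unitPairs]
  rw [this]
  exact (IsUltrametricDist.isOpen_sphere _ one_ne_zero).preimage continuous_fst

lemma norm_single_one (i : Fin n) : ‖(Pi.single i 1 : Fin n → F)‖ = 1 := by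
  rw [Pi.norm_single, norm_one]

lemma rankOneMeasure_ne_zero (hn : n ≠ 0) : rankOneMeasure F (Fin n) ≠ 0 := by
  intro h
  have h1 := congrArg (fun μ => μ Set.univ) h
  simp only [rankOneMeasure, Measure.map_apply continuous_rankOne.measurable MeasurableSet.univ,
    Set.preimage_univ, Measure.restrict_apply_univ, Measure.coe_zero, Pi.zero_apply] at h1
  refine (isOpen_unitPairs.measure_pos _ ⟨(Pi.single ⟨0, Nat.pos_of_ne_zero hn⟩ 1, 0), ?_⟩).ne' h1
  exact norm_single_one _

lemma corankOneMeasure_ne_zero (hn : n ≠ 0) : corankOneMeasure F n ≠ 0 := by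
  intro h
  have h1 := congrArg (fun μ => μ Set.univ) h
  simp only [corankOneMeasure, Measure.map_apply measurable_killVector MeasurableSet.univ,
    Set.preimage_univ, Measure.restrict_apply_univ, Measure.coe_zero, Pi.zero_apply] at h1
  have ho1 : IsOpen {x : (Fin n → F) × Matrix (Fin n) (Fin n) F | ‖x.1‖ = 1} := by
    have : {x : (Fin n → F) × Matrix (Fin n) (Fin n) F | ‖x.1‖ = 1} =
        Prod.fst ⁻¹' Metric.sphere (0 : Fin n → F) 1 := by
      ext x; simp
    rw [this]
    exact (IsUltrametricDist.isOpen_sphere _ one_ne_zero).preimage continuous_fst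
  have ho2 : IsOpen {x : (Fin n → F) × Matrix (Fin n) (Fin n) F | ‖x.2.mulVec x.1‖ < 1} :=
    isOpen_lt (by fun_prop) continuous_const
  refine ((ho1.inter ho2).measure_pos _
    ⟨(Pi.single ⟨0, Nat.pos_of_ne_zero hn⟩ 1, 0), norm_single_one _, ?_⟩).ne'
    (measure_mono_null ?_ h1)
  · change ‖(0 : Matrix (Fin n) (Fin n) F).mulVec _‖ < 1
    rw [Matrix.zero_mulVec, norm_zero]
    exact one_pos
  · exact fun x hx => ⟨hx.1, hx.2.le⟩

end OrbitalMeasure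
end

noncomputable section

namespace OrbitalMeasure

set_option linter.unusedSectionVars false

/-! ### Measures are determined by the integrals of Schwartz-Bruhat functions -/

section

variable {V : Type*} [TopologicalSpace V]

lemma isLocallyConstant_indicator {C : Set V} (hC : IsClopen C) {f : V → ℂ}
    (hf : IsLocallyConstant f) : IsLocallyConstant (C.indicator f) := by
  rw [IsLocallyConstant.iff_eventually_eq] at hf ⊢
  intro x
  by_cases hx : x ∈ C
  · filter_upwards [hf x, hC.isOpen.mem_nhds hx] with y hy hyC
    rw [Set.indicator_of_mem hx, Set.indicator_of_mem hyC, hy]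
  · filter_upwards [hC.compl.isOpen.mem_nhds hx] with y hyC
    rw [Set.indicator_of_notMem hx, Set.indicator_of_notMem hyC]

lemma hasCompactSupport_indicator [T2Space V] {C : Set V} (hC : IsCompact C) (f : V → ℂ) :
    HasCompactSupport (C.indicator f) :=
  .intro hC fun _ hx => Set.indicator_of_notMem hx _

lemma exists_compactOpen_subset [T2Space V] [LocallyCompactSpace V] [TotallyDisconnectedSpace V]
    {x : V} {U : Set V} (hU : U ∈ nhds x) : ∃ C, IsClopen C ∧ IsCompact C ∧ x ∈ C ∧ C ⊆ U := by
  obtain ⟨K, hK, hKU, hKc⟩ := local_compact_nhds hU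
  obtain ⟨C, hC, hxC, hCK⟩ := loc_compact_Haus_tot_disc_of_zero_dim.mem_nhds_iff.1 hK
  exact ⟨C, hC, hKc.of_isClosed_subset hC.isClosed hCK, hxC, hCK.trans hKU⟩

/-- Compact open sets form a basis stable under intersection, have finite measure, and countably
many of them cover the space. Their indicators are test functions, so the uniqueness theorem for
π-systems applies. -/
lemma measure_ext_of_integral_eq [T2Space V] [LocallyCompactSpace V] [TotallyDisconnectedSpace V]
    [SecondCountableTopology V] [MeasurableSpace V] [BorelSpace V] (μ ν : Measure V)
    [IsFiniteMeasureOnCompacts μ] [IsFiniteMeasureOnCompacts ν]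
    (h : ∀ f : V → ℂ, IsLocallyConstant f → HasCompactSupport f → ∫ x, f x ∂μ = ∫ x, f x ∂ν) :
    μ = ν := by
  have hb : TopologicalSpace.IsTopologicalBasis {C : Set V | IsClopen C ∧ IsCompact C} := by
    refine TopologicalSpace.isTopologicalBasis_of_isOpen_of_nhds (fun C hC => hC.1.isOpen) ?_
    intro x U hx hU
    obtain ⟨C, h1, h2, h3, h4⟩ := exists_compactOpen_subset (hU.mem_nhds hx)
    exact ⟨C, ⟨h1, h2⟩, h3, h4⟩
  have heq : ∀ C : Set V, IsClopen C → IsCompact C → μ C = ν C := by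
    intro C hC hCc
    have h1 := h (C.indicator fun _ => 1)
      (isLocallyConstant_indicator hC (IsLocallyConstant.const 1))
      (hasCompactSupport_indicator hCc _)
    rw [integral_indicator_const _ hC.isOpen.measurableSet,
      integral_indicator_const _ hC.isOpen.measurableSet,
      Complex.real_smul, Complex.real_smul, mul_one, mul_one, Complex.ofReal_inj, Measure.real,
      Measure.real, ENNReal.toReal_eq_toReal_iff' hCc.measure_lt_top.ne hCc.measure_lt_top.ne]
      at h1
    exact h1
  choose C h1 h2 h3 h4 using fun x : V => exists_compactOpen_subset (Filter.univ_mem : _ ∈ nhds x)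
  obtain ⟨s, hs, hsu⟩ := TopologicalSpace.countable_cover_nhds
    fun x => (h1 x).isOpen.mem_nhds (h3 x)
  refine Measure.ext_of_generateFrom_of_cover_subset
    (S := {C : Set V | IsClopen C ∧ IsCompact C}) (T := C '' s) ?_ ?_ ?_ (hs.image C) ?_ ?_ ?_
  · rw [‹BorelSpace V›.measurable_eq]
    exact hb.borel_eq_generateFrom
  · intro A hA B hB _
    exact ⟨hA.1.inter hB.1, hA.2.inter_right hB.1.isClosed⟩
  · rintro _ ⟨x, -, rfl⟩
    exact ⟨h1 x, h2 x⟩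
  · rw [Set.sUnion_image]
    exact hsu
  · rintro _ ⟨x, -, rfl⟩
    exact (h2 x).measure_lt_top.ne
  · exact fun A hA => heq A hA.1 hA.2

end

/-! ### The two-sided action and equivariance of the corank one measure -/

variable {F : Type*} [NontriviallyNormedField F] [IsUltrametricDist F] [ProperSpace F]
  [MeasurableSpace F] [BorelSpace F]
variable {n : ℕ} (χ : UnramifiedCharacter F)

instance : TotallyDisconnectedSpace (Matrix (Fin n) (Fin n) F) :=
  inferInstanceAs (TotallyDisconnectedSpace (Fin n → Fin n → F))

/-- The two-sided action `z ↦ g⁻¹ z h` on matrices. -/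
def twoSided (g h : GL (Fin n) F) : Matrix (Fin n) (Fin n) F ≃ₜ Matrix (Fin n) (Fin n) F where
  toFun z := ((g⁻¹ : GL (Fin n) F) : Matrix (Fin n) (Fin n) F) * z * (h : Matrix (Fin n) (Fin n) F)
  invFun z := (g : Matrix (Fin n) (Fin n) F) * z * ((h⁻¹ : GL (Fin n) F) : Matrix (Fin n) (Fin n) F)
  left_inv z := by
    simp only [Matrix.mul_assoc, Units.mul_inv, Matrix.mul_one]
    rw [← Matrix.mul_assoc, Units.mul_inv, Matrix.one_mul]
  right_inv z := by
    simp only [Matrix.mul_assoc, Units.inv_mul, Matrix.mul_one]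
    rw [← Matrix.mul_assoc, Units.inv_mul, Matrix.one_mul]
  continuous_toFun := by fun_prop
  continuous_invFun := by fun_prop

lemma twoSided_apply (g h : GL (Fin n) F) (z : Matrix (Fin n) (Fin n) F) : twoSided g h z =
    ((g⁻¹ : GL (Fin n) F) : Matrix (Fin n) (Fin n) F) * z * (h : Matrix (Fin n) (Fin n) F) := rfl

lemma map_twoSided_rankOneMeasure (g h : GL (Fin n) F) :
    (rankOneMeasure F (Fin n)).map (twoSided g h) =
      (distribHaarChar F (Matrix.GeneralLinearGroup.det g) *
        (distribHaarChar F (Matrix.GeneralLinearGroup.det h))⁻¹ : ℝ≥0) •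
          rankOneMeasure F (Fin n) :=
  map_rankOneMeasure g h

lemma map_twoSided_matHaar (g h : GL (Fin n) F) :
    (matHaar F (Fin n)).map (twoSided g h) =
      (distribHaarChar F (Matrix.GeneralLinearGroup.det g) ^ n *
        (distribHaarChar F (Matrix.GeneralLinearGroup.det h) ^ n)⁻¹ : ℝ≥0) •
          matHaar F (Fin n) := by
  have h1 := smul_eq_iff_eq_inv_smul (pow_ne_zero _ (distribHaarChar_ne_zero _))
    (map_mul_left_matHaar g⁻¹)
  have h2 := smul_eq_iff_eq_inv_smul (pow_ne_zero _ (distribHaarChar_ne_zero _))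
    (map_mul_right_matHaar h)
  have hl : Measurable fun z : Matrix (Fin n) (Fin n) F =>
    ((g⁻¹ : GL (Fin n) F) : Matrix (Fin n) (Fin n) F) * z := Continuous.measurable (by fun_prop)
  have hr : Measurable fun z : Matrix (Fin n) (Fin n) F => z * (h : Matrix (Fin n) (Fin n) F) :=
    Continuous.measurable (by fun_prop)
  have e : (twoSided g h : Matrix (Fin n) (Fin n) F → _) =
      (fun z => z * (h : Matrix (Fin n) (Fin n) F)) ∘
      fun z => ((g⁻¹ : GL (Fin n) F) : Matrix (Fin n) (Fin n) F) * z := rfl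
  rw [e, ← Measure.map_map hr hl, h1, Measure.map_smul, h2, smul_smul, Fintype.card_fin, map_inv,
    map_inv, inv_pow, inv_inv]

/-- Under the trace pairing the action of `(g, h)` is dual to that of `(h, g)`; this is why `g` and
`h` change places under the Fourier transform. -/
lemma trace_twoSided_mul (g h : GL (Fin n) F) (e w : Matrix (Fin n) (Fin n) F) :
    (twoSided g h e * twoSided h g w).trace = (e * w).trace := by
  have e1 : twoSided g h e * twoSided h g w =
      ((g⁻¹ : GL (Fin n) F) : Matrix (Fin n) (Fin n) F) *
        (e * ((h : Matrix (Fin n) (Fin n) F) *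
          ((h⁻¹ : GL (Fin n) F) : Matrix (Fin n) (Fin n) F)) * w *
          (g : Matrix (Fin n) (Fin n) F)) := by
    simp only [twoSided_apply, Matrix.mul_assoc]
  rw [e1, Matrix.trace_mul_comm, Matrix.mul_assoc, Units.mul_inv, Units.mul_inv,
    Matrix.mul_one, Matrix.mul_one]

/-- The Fourier transform intertwines the two-sided actions. -/
lemma matFourier_comp_twoSided (g h : GL (Fin n) F) (f : Matrix (Fin n) (Fin n) F → ℂ)
    (w : Matrix (Fin n) (Fin n) F) :
    matFourier χ (f ∘ twoSided g h) w =
      ((distribHaarChar F (Matrix.GeneralLinearGroup.det g) ^ n *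
        (distribHaarChar F (Matrix.GeneralLinearGroup.det h) ^ n)⁻¹ : ℝ≥0) : ℝ) *
        matFourier χ f (twoSided h g w) := by
  unfold matFourier
  have h1 : ∀ e, chi χ (e * w).trace * (f ∘ twoSided g h) e =
      (fun e' => chi χ (e' * twoSided h g w).trace * f e') (twoSided g h e) := by
    intro e
    simp only [trace_twoSided_mul, Function.comp_apply]
  simp only [h1]
  rw [← (twoSided g h).isClosedEmbedding.measurableEmbedding.integral_map
    (g := fun e' => chi χ (e' * twoSided h g w).trace * f e'), map_twoSided_matHaar,
    integral_smul_nnreal_measure, NNReal.smul_def, Complex.real_smul]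

/-- Equivariance of the orbital measure of the matrices of corank one. -/
lemma map_twoSided_corankOneMeasure (χ : UnramifiedCharacter F) (hn : n ≠ 0) (g h : GL (Fin n) F) :
    (corankOneMeasure F n).map (twoSided g h) =
      (distribHaarChar F (Matrix.GeneralLinearGroup.det g) ^ (n - 1) *
        (distribHaarChar F (Matrix.GeneralLinearGroup.det h) ^ (n - 1))⁻¹ : ℝ≥0) •
          corankOneMeasure F n := by
  have hfin : IsFiniteMeasureOnCompacts ((corankOneMeasure F n).map (twoSided g h)) :=
    ⟨fun K hK => by
      rw [(twoSided g h).measurableEmbedding.map_apply]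
      exact ((twoSided g h).isCompact_preimage.2 hK).measure_lt_top⟩
  refine measure_ext_of_integral_eq _ _ fun f hf hc => ?_
  have hf' : IsLocallyConstant (f ∘ twoSided g h) :=
    hf.comp_continuous (twoSided g h).continuous
  have hc' : HasCompactSupport (f ∘ twoSided g h) := hc.comp_homeomorph _
  have h1 := integral_corankOneMeasure χ hf' hc'
  simp only [matFourier_comp_twoSided] at h1
  rw [(twoSided g h).measurableEmbedding.integral_map, integral_smul_nnreal_measure,
    integral_corankOneMeasure χ hf hc]
  refine h1.trans ?_
  rw [integral_const_mul, ← (twoSided h g).measurableEmbedding.integral_map,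
    map_twoSided_rankOneMeasure, integral_smul_nnreal_measure, NNReal.smul_def, NNReal.smul_def,
    Complex.real_smul, Complex.real_smul, ← mul_assoc, ← Complex.ofReal_mul, ← NNReal.coe_mul]
  -- The Jacobian contributes the exponents `n` and `-n` for `g` and `h`; the rank one measure,
  -- acted on by `(h, g)`, contributes `-1` and `1`.
  congr 3
  obtain ⟨m, rfl⟩ := Nat.exists_eq_succ_of_ne_zero hn
  have hg := distribHaarChar_ne_zero (Matrix.GeneralLinearGroup.det g)
  have hh := distribHaarChar_ne_zero (Matrix.GeneralLinearGroup.det h)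
  rw [Nat.succ_sub_one, pow_succ, pow_succ]
  field_simp

end OrbitalMeasure
end

noncomputable section

namespace OrbitalMeasure

set_option linter.unusedSectionVars false

/-! ### Criteria for membership in the wave front set -/

variable {F : Type*} [NontriviallyNormedField F]
variable {V : Type*} [NormedAddCommGroup V] [NormedSpace F V]
variable (Λ : Subgroup Fˣ) (χ : UnramifiedCharacter F)

/-- Rapid decay near `ξ` of one cutoff excludes `(x, ξ)` from the wave front set. -/
lemma notMem_waveFrontSet {u : BruhatDistribution V} {φ : SchwartzBruhat V} {x : V}
    {ξ : StrongDual F V} (hφ : (φ : V → ℂ) x ≠ 0) {N : Set (StrongDual F V)} (hN : N ∈ nhds ξ)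
    {R : ℝ} (h : ∀ t : F, R ≤ ‖t‖ → ∀ η ∈ N, fourierCutoff χ u φ (t • η) = 0) :
    (x, ξ) ∉ waveFrontSet Λ χ u := by
  rintro ⟨hξ, hwf⟩
  obtain ⟨N', hN', hN'o, hξN'⟩ := mem_nhds_iff.1 (Filter.inter_mem (Filter.inter_mem hN
    (Metric.ball_mem_nhds ξ one_pos)) (isOpen_ne.mem_nhds hξ))
  -- The cone spanned by `N'` is stable under all of `Fˣ`, hence under `Λ`. `N'` was shrunk to be
  -- open, bounded and free of zero.
  refine (hwf φ hφ).2 {v | ∃ t : Fˣ, (t : F) • v ∈ N'} ?_ ⟨?_, ?_⟩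
    ⟨1, by rwa [Units.val_one, one_smul]⟩ ?_
  · have : {v : StrongDual F V | ∃ t : Fˣ, (t : F) • v ∈ N'} =
        ⋃ t : Fˣ, (fun v => (t : F) • v) ⁻¹' N' := by
      ext v; simp
    rw [this]
    exact isOpen_iUnion fun t => hN'o.preimage (continuous_const_smul _)
  · rintro ⟨t, ht⟩
    exact (hN' ht).2 (ContinuousLinearMap.ext fun v => by simp)
  · rintro a - v ⟨t, ht⟩
    refine ⟨t * a⁻¹, ?_⟩
    rw [smul_smul, Units.val_mul, mul_assoc, ← Units.val_mul, inv_mul_cancel, Units.val_one,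
      mul_one]
    exact ht
  · refine (Metric.isBounded_closedBall (x := (0 : StrongDual F V))
      (r := |R| * (‖ξ‖ + 1))).subset ?_
    have hopen : IsOpen {v : StrongDual F V | ∃ t : Fˣ, (t : F) • v ∈ N'} := by
      have : {v : StrongDual F V | ∃ t : Fˣ, (t : F) • v ∈ N'} =
          ⋃ t : Fˣ, (fun v => (t : F) • v) ⁻¹' N' := by
        ext v; simp
      rw [this]
      exact isOpen_iUnion fun t => hN'o.preimage (continuous_const_smul _)
    -- The support is a closure; since the cone is open, only points where the transform is nonzero
    -- need a bound. Such a point is `t⁻¹ η` with `η ∈ N'`, and the decay hypothesis forces `‖t⁻¹‖ <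
    -- R`.
    refine hopen.inter_closure.trans (closure_minimal ?_ Metric.isClosed_closedBall)
    rintro v ⟨⟨t, ht⟩, hv⟩
    have hv' : v = ((t⁻¹ : Fˣ) : F) • (t : F) • v := by
      rw [smul_smul, ← Units.val_mul, inv_mul_cancel, Units.val_one, one_smul]
    have hlt : ‖((t⁻¹ : Fˣ) : F)‖ < R := by
      by_contra hR
      refine hv ?_
      rw [hv']
      exact h _ (not_lt.1 hR) _ (hN' ht).1.1
    have hb : ‖(t : F) • v‖ ≤ ‖ξ‖ + 1 := by
      have h1 := mem_ball_iff_norm.1 (hN' ht).1.2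
      have h2 := norm_le_norm_add_norm_sub' ((t : F) • v) ξ
      linarith
    rw [mem_closedBall_zero_iff, hv', norm_smul]
    exact mul_le_mul (hlt.le.trans (le_abs_self R)) hb (norm_nonneg _) (abs_nonneg _)

/-- The conditions `φ(x) ≠ 0` and `ξ ∈ C` are open, so every cutoff and every cone for the limit
point also serves for nearby points of the wave front set. -/
lemma mem_waveFrontSet_of_mem_closure {u : BruhatDistribution V} {x : V} {ξ : StrongDual F V}
    (hξ : ξ ≠ 0) (h : (x, ξ) ∈ closure (waveFrontSet Λ χ u)) : (x, ξ) ∈ waveFrontSet Λ χ u := by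
  refine ⟨hξ, fun φ hφ => ⟨hξ, fun C hC hCs hξC => ?_⟩⟩
  have h1 : {y : V | (φ : V → ℂ) y ≠ 0} ∈ nhds x :=
    φ.2.1.continuous.continuousAt.eventually_ne hφ
  obtain ⟨p, ⟨hp1, hp2⟩, hp⟩ := mem_closure_iff_nhds.1 h _
    (prod_mem_nhds h1 (hC.mem_nhds hξC))
  exact (hp.2 φ hp1).2 C hC hCs hp2

/-- The indicator function of a compact open set as a test function. -/
def indicatorTest {C : Set V} (hC : IsClopen C) (hc : IsCompact C) : SchwartzBruhat V :=
  ⟨C.indicator fun _ => 1, isLocallyConstant_indicator hC (IsLocallyConstant.const 1),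
    hasCompactSupport_indicator hc _⟩

lemma indicatorTest_apply {C : Set V} (hC : IsClopen C) (hc : IsCompact C) (x : V) :
    (indicatorTest hC hc : V → ℂ) x = C.indicator (fun _ => 1) x := rfl

section Measures

variable [MeasurableSpace V] [BorelSpace V] {μ : Measure V} (hμ : IsFiniteMeasureOnCompacts μ)

lemma fourierCutoff_ofMeasure (φ : SchwartzBruhat V) (ξ : StrongDual F V) :
    fourierCutoff χ (BruhatDistribution.ofMeasure μ hμ) φ ξ =
      ∫ z, (φ : V → ℂ) z * chi χ (-(ξ z)) ∂μ := rfl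

lemma fourierCutoff_indicatorTest {C : Set V} (hC : IsClopen C) (hc : IsCompact C)
    (ξ : StrongDual F V) :
    fourierCutoff χ (BruhatDistribution.ofMeasure μ hμ) (indicatorTest hC hc) ξ =
      ∫ z in C, chi χ (-(ξ z)) ∂μ := by
  rw [fourierCutoff_ofMeasure, ← integral_indicator hC.isOpen.measurableSet]
  congr 1
  ext z
  by_cases hz : z ∈ C
  · rw [indicatorTest_apply, Set.indicator_of_mem hz, Set.indicator_of_mem hz, one_mul]
  · rw [indicatorTest_apply, Set.indicator_of_notMem hz, Set.indicator_of_notMem hz, zero_mul]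

lemma notMem_waveFrontSet_of_measure_eq_zero [LocallyCompactSpace V] [TotallyDisconnectedSpace V]
    {U : Set V} (hU : IsOpen U) (h : μ U = 0) {x : V} (hx : x ∈ U) (ξ : StrongDual F V) :
    (x, ξ) ∉ waveFrontSet Λ χ (BruhatDistribution.ofMeasure μ hμ) := by
  obtain ⟨C, h1, h2, h3, h4⟩ := exists_compactOpen_subset (hU.mem_nhds hx)
  refine notMem_waveFrontSet Λ χ (φ := indicatorTest h1 h2) (N := Set.univ) (R := 0) ?_
    Filter.univ_mem fun t _ η _ => ?_
  · rw [indicatorTest_apply, Set.indicator_of_mem h3]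
    exact one_ne_zero
  · rw [fourierCutoff_indicatorTest]
    exact setIntegral_measure_zero _ (measure_mono_null h4 h)

variable [IsUltrametricDist F] [ProperSpace F] [MeasurableSpace F] [BorelSpace F]

lemma setIntegral_chi_mul_eq_zero (c : Fˣ) {v : F} (h : 1 < ‖(c : F)‖ * ‖v‖) :
    ∫ s in Metric.closedBall 0 ‖(c : F)‖, chi χ (s * v) ∂fieldHaar F = 0 := by
  have hc : 0 < ‖(c : F)‖ := norm_pos_iff.2 c.ne_zero
  refine setIntegral_character_of_nontrivial _
    (IsUltrametricDist.closedBall_openAddSubgroup F hc).toAddSubgroup (fun s => chi χ (s * v))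
    Metric.isClosed_closedBall.measurableSet (fun a b => by rw [add_mul, chi_add])
    (a₀ := (c : F)) (mem_closedBall_zero_iff.2 le_rfl) ?_
  rw [Ne, chi_eq_one_iff, norm_mul]
  exact not_le.2 h

/-- If `μ` is invariant under the flow `z ↦ z + s T z`, then the wave front set of `μ` lies in the
annihilator of the vector field `T`. -/
lemma notMem_waveFrontSet_of_invariant [SecondCountableTopology V] [LocallyCompactSpace V]
    [TotallyDisconnectedSpace V]
    (T : V →L[F] V) {ε : ℝ} (hε : 0 < ε)
    (hinv : ∀ s : F, ‖s‖ < ε → μ.map (fun z => z + s • T z) = μ)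
    {x : V} {ξ : StrongDual F V} (h : ξ (T x) ≠ 0) :
    (x, ξ) ∉ waveFrontSet Λ χ (BruhatDistribution.ofMeasure μ hμ) := by
  have hc0 : 0 < ‖ξ (T x)‖ := norm_pos_iff.2 h
  have hcont : Continuous fun p : StrongDual F V × V => ‖p.1 (T p.2)‖ := by
    exact (isBoundedBilinearMap_apply.continuous.comp
      (continuous_fst.prodMk (T.continuous.comp continuous_snd))).norm
  have hnear : {p : StrongDual F V × V | ‖ξ (T x)‖ / 2 < ‖p.1 (T p.2)‖} ∈ nhds (ξ, x) :=
    (isOpen_lt continuous_const hcont).mem_nhds (half_lt_self hc0)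
  obtain ⟨N, hN, U, hU, hNU⟩ := mem_nhds_prod_iff.1 hnear
  obtain ⟨C, hC1, hC2, hxC, hCU⟩ := exists_compactOpen_subset hU
  set φ := indicatorTest hC1 hC2 with hφ
  obtain ⟨δ, hδ, hunif⟩ := exists_uniform_dist_of_isLocallyConstant φ.2.1 φ.2.2
  obtain ⟨R₀, hR₀⟩ := hC2.isBounded.exists_norm_le
  -- Three requirements on the flow time: `ε` for the invariance of `μ`; the term with `δ`, so that
  -- points of norm at most `2 |R₀|` move by less than `δ`; and `1 / 2`, so that points farther away
  -- cannot be moved into `C`. Together they make `φ` invariant under the flow.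
  have hsmall : 0 < min ε (min (1 / 2) (δ / (2 * |R₀| + 1)) / (‖T‖ + 1)) := by positivity
  obtain ⟨c, hc⟩ := exists_unit_norm_lt F hsmall
  have hcε : ‖(c : F)‖ < ε := hc.trans_le (min_le_left _ _)
  have hcT : ‖(c : F)‖ * (‖T‖ + 1) < min (1 / 2) (δ / (2 * |R₀| + 1)) := by
    rw [← lt_div_iff₀ (by positivity)]
    exact hc.trans_le (min_le_right _ _)
  have hsT : ∀ s : F, ‖s‖ ≤ ‖(c : F)‖ → ∀ z, ‖s • T z‖ ≤ ‖(c : F)‖ * (‖T‖ + 1) * ‖z‖ := by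
    intro s hs z
    rw [norm_smul, mul_assoc]
    refine mul_le_mul hs ((T.le_opNorm z).trans ?_) (norm_nonneg _) (norm_nonneg _)
    exact mul_le_mul_of_nonneg_right (by linarith) (norm_nonneg _)
  have hφinv : ∀ s : F, ‖s‖ ≤ ‖(c : F)‖ → ∀ z, (φ : V → ℂ) (z + s • T z) = (φ : V → ℂ) z := by
    intro s hs z
    by_cases hz : ‖z‖ ≤ 2 * |R₀|
    · refine hunif _ _ ?_
      rw [dist_eq_norm, add_sub_cancel_left]
      calc ‖s • T z‖ ≤ ‖(c : F)‖ * (‖T‖ + 1) * ‖z‖ := hsT s hs z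
        _ ≤ ‖(c : F)‖ * (‖T‖ + 1) * (2 * |R₀| + 1) :=
            mul_le_mul_of_nonneg_left (by linarith) (by positivity)
        _ < δ := by
            rw [← lt_div_iff₀ (by positivity)]
            exact hcT.trans_le (min_le_right _ _)
    · have h1 : z ∉ C := fun hzC => hz (by
        have := hR₀ z hzC
        have := le_abs_self R₀
        have := abs_nonneg R₀
        linarith)
      have h2 : z + s • T z ∉ C := fun hzC => hz (by
        have h3 := hR₀ _ hzC
        have h4 := le_abs_self R₀
        have h5 := hsT s hs z
        have h6 : ‖(c : F)‖ * (‖T‖ + 1) * ‖z‖ ≤ 1 / 2 * ‖z‖ :=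
          mul_le_mul_of_nonneg_right (hcT.le.trans (min_le_left _ _)) (norm_nonneg _)
        have h7 : ‖z‖ ≤ ‖z + s • T z‖ + ‖s • T z‖ := by
          have := norm_sub_le (z + s • T z) (s • T z)
          rwa [add_sub_cancel_right] at this
        linarith)
      rw [hφ, indicatorTest_apply, indicatorTest_apply, Set.indicator_of_notMem h1,
        Set.indicator_of_notMem h2]
  have hmeas : ∀ s : F, Measurable fun z => z + s • T z := fun s =>
    Continuous.measurable (by fun_prop)
  -- On `C × N` the value `η (T z)` has norm above `‖ξ (T x)‖ / 2`, so this threshold gives `‖c‖ ‖t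
  -- η (T z)‖ > 1`.
  refine notMem_waveFrontSet Λ χ (φ := φ) (N := N) (R := 2 / (‖(c : F)‖ * ‖ξ (T x)‖) + 1) ?_ hN
    fun t ht η hη => ?_
  · rw [hφ, indicatorTest_apply, Set.indicator_of_mem hxC]
    exact one_ne_zero
  have hcpos : 0 < ‖(c : F)‖ := norm_pos_iff.2 c.ne_zero
  rw [fourierCutoff_ofMeasure]
  set I := ∫ z, (φ : V → ℂ) z * chi χ (-((t • η) z)) ∂μ with hI
  have hφcont : Continuous (φ : V → ℂ) := φ.2.1.continuous
  -- The flow is linear in `s`, so it multiplies the oscillating factor by a character of `s`. The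
  -- left side does not depend on `s`, and averaging the right side over the ball annihilates it: a
  -- substitute for integration by parts.
  have hstep : ∀ s ∈ Metric.closedBall (0 : F) ‖(c : F)‖,
      I = ∫ z, (φ : V → ℂ) z * chi χ (-((t • η) z)) * chi χ (s * -(t * η (T z))) ∂μ := by
    intro s hs
    have hs' := mem_closedBall_zero_iff.1 hs
    conv_lhs => rw [hI, ← hinv s (hs'.trans_lt hcε)]
    rw [integral_map (hmeas s).aemeasurable]
    · congr 1
      ext z
      rw [hφinv s hs', mul_assoc, ← chi_add]
      congr 2
      simp
      ring
    · exact (hφcont.mul ((continuous_chi χ).comp (t • η).continuous.neg)).aestronglyMeasurable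
  have hvol : (fieldHaar F).real (Metric.closedBall 0 ‖(c : F)‖) ≠ 0 := by
    rw [Measure.real, ENNReal.toReal_ne_zero]
    exact ⟨(Measure.measure_pos_of_mem_nhds _ (Metric.closedBall_mem_nhds _ hcpos)).ne',
      (isCompact_closedBall _ _).measure_lt_top.ne⟩
  have hfin : IsFiniteMeasure ((fieldHaar F).restrict (Metric.closedBall 0 ‖(c : F)‖)) :=
    ⟨by rw [Measure.restrict_apply_univ]; exact (isCompact_closedBall _ _).measure_lt_top⟩
  have htotal : ∫ s in Metric.closedBall 0 ‖(c : F)‖, I ∂fieldHaar F = 0 := by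
    rw [setIntegral_congr_fun Metric.isClosed_closedBall.measurableSet hstep,
      integral_integral_swap]
    · refine (integral_congr_ae (g := fun _ => 0) (.of_forall fun z => ?_)).trans
        (integral_zero _ _)
      simp only
      rw [integral_const_mul]
      by_cases hz : z ∈ C
      · rw [setIntegral_chi_mul_eq_zero, mul_zero]
        have h1 : ‖ξ (T x)‖ / 2 < ‖η (T z)‖ := hNU (Set.mk_mem_prod hη (hCU hz))
        rw [norm_neg, norm_mul]
        have h2 : 2 / (‖(c : F)‖ * ‖ξ (T x)‖) < ‖t‖ := by linarith
        rw [div_lt_iff₀ (by positivity)] at h2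
        have ht0 : 0 < ‖t‖ := lt_of_lt_of_le (by positivity) ht
        have h3 : ‖(c : F)‖ * (‖t‖ * (‖ξ (T x)‖ / 2)) < ‖(c : F)‖ * (‖t‖ * ‖η (T z)‖) := by gcongr
        nlinarith
      · rw [hφ, indicatorTest_apply, Set.indicator_of_notMem hz]
        simp
    · have hb : Integrable (fun p : F × V => (1 : ℂ) * (φ : V → ℂ) p.2)
          (((fieldHaar F).restrict (Metric.closedBall 0 ‖(c : F)‖)).prod μ) :=
        (integrable_const (1 : ℂ)).mul_prod (hφcont.integrable_of_hasCompactSupport φ.2.2)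
      refine hb.mono (Continuous.aestronglyMeasurable ?_) (.of_forall fun p => ?_)
      · refine ((hφcont.comp continuous_snd).mul ((continuous_chi χ).comp ?_)).mul
          ((continuous_chi χ).comp ?_)
        · exact ((t • η).continuous.comp continuous_snd).neg
        · exact continuous_fst.mul
            (continuous_const.mul (η.continuous.comp (T.continuous.comp continuous_snd))).neg
      · simp [Function.uncurry, norm_chi]
  rw [setIntegral_const, Complex.real_smul, mul_eq_zero] at htotal
  exact htotal.resolve_left (Complex.ofReal_ne_zero.2 hvol)

/-- If the Fourier transforms of all the restrictions of `μ` to small neighbourhoods `x + s L` do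
not vanish far out in the direction of `ξ`, then `(x, ξ)` is in the wave front set of `μ`. -/
lemma mem_waveFrontSet_of_integral_ne_zero [SecondCountableTopology V] [LocallyCompactSpace V]
    {ϖ : Fˣ} (hϖΛ : ϖ ∈ Λ) (hϖ : ‖(ϖ : F)‖ < 1)
    {A : Type*} [TopologicalSpace A] [SecondCountableTopology A] [MeasurableSpace A] [BorelSpace A]
    (ρ : Measure A) [IsFiniteMeasure ρ] (k : A → StrongDual F V)
    (hk : Continuous fun p : A × V => k p.1 p.2) {R : ℝ} (hR : ∀ᵐ a ∂ρ, ‖k a‖ ≤ R)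
    {L : Set V} (hLm : IsClosed L) (hLb : Bornology.IsBounded L) {κ : ℂ} (hκ : κ ≠ 0)
    (hkL : ∀ z, ∫ a, chi χ (k a z) ∂ρ = L.indicator (fun _ => κ) z)
    {x : V} {ξ : StrongDual F V} (hξ : ξ ≠ 0)
    (h : ∀ s : Fˣ, ‖(s : F)‖ < 1 → ∃ R' : ℝ, ∀ t : Fˣ, R' ≤ ‖(t : F)‖ →
      ∫ z in {z | ((s⁻¹ : Fˣ) : F) • (z - x) ∈ L}, chi χ (-((t : F) • ξ) z) ∂μ ≠ 0) :
    (x, ξ) ∈ waveFrontSet Λ χ (BruhatDistribution.ofMeasure μ hμ) := by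
  refine ⟨hξ, fun φ hφ => ⟨hξ, fun C hC hCs hξC hbdd => ?_⟩⟩
  have hφcont : Continuous (φ : V → ℂ) := φ.2.1.continuous
  -- a small neighbourhood of `x`
  obtain ⟨r, hr, hball⟩ := Metric.mem_nhds_iff.1
    ((IsLocallyConstant.iff_eventually_eq _).1 φ.2.1 x)
  obtain ⟨B, hB⟩ := hLb.exists_norm_le
  obtain ⟨s, hs'⟩ := exists_unit_norm_lt F (show 0 < min (r / (|B| + 1)) 1 by positivity)
  have hs := hs'.trans_le (min_le_left _ _)
  have hs0 : 0 < ‖(s : F)‖ := norm_pos_iff.2 s.ne_zero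
  set D : Set V := {z | ((s⁻¹ : Fˣ) : F) • (z - x) ∈ L} with hD
  have hDc : IsClosed D := hLm.preimage (by fun_prop)
  have hφD : ∀ z ∈ D, (φ : V → ℂ) z = (φ : V → ℂ) x := by
    intro z hz
    refine hball (mem_ball_iff_norm.2 ?_)
    have h1 := hB _ hz
    rw [norm_smul, Units.val_inv_eq_inv_val, norm_inv, inv_mul_le_iff₀ hs0] at h1
    rw [lt_div_iff₀ (by positivity)] at hs
    have h2 := le_abs_self B
    nlinarith
  -- the direction
  obtain ⟨R', hR'⟩ := h s (hs'.trans_le (min_le_right _ _))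
  obtain ⟨δ, hδ, hδC⟩ := Metric.mem_nhds_iff.1 (hC.mem_nhds hξC)
  obtain ⟨M, hM⟩ := hbdd.exists_norm_le
  set Q := ‖((s⁻¹ : Fˣ) : F)‖ * |R| with hQ
  have hξ0 : 0 < ‖ξ‖ := norm_pos_iff.2 hξ
  -- The three terms of the bound make `t = ϖ^(-m)` large enough for the nonvanishing hypothesis,
  -- for `t ξ - s⁻¹ k a` to stay in the cone `C`, and for this covector to lie beyond the bound `M`.
  obtain ⟨m, hm⟩ := exists_pow_lt_of_lt_one
    (show 0 < 1 / (|R'| + (Q + 1) / δ + (|M| + Q + 1) / ‖ξ‖ + 1) by positivity) hϖ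
  set t : Fˣ := (ϖ ^ m)⁻¹ with ht
  have htΛ : t ∈ Λ := Λ.inv_mem (Λ.pow_mem hϖΛ m)
  have hϖ0 : 0 < ‖(ϖ : F)‖ := norm_pos_iff.2 ϖ.ne_zero
  have htn : |R'| + (Q + 1) / δ + (|M| + Q + 1) / ‖ξ‖ + 1 < ‖(t : F)‖ := by
    rw [ht, Units.val_inv_eq_inv_val, norm_inv, Units.val_pow_eq_pow_val, norm_pow]
    rw [lt_div_iff₀ (by positivity)] at hm
    rw [lt_inv_comm₀ (by positivity) (by positivity)]
    rw [← one_div, lt_div_iff₀ (by positivity)]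
    exact hm
  have p1 : 0 ≤ (Q + 1) / δ := by positivity
  have p2 : 0 ≤ (|M| + Q + 1) / ‖ξ‖ := by positivity
  have p3 := abs_nonneg R'
  have ht0 : 0 < ‖(t : F)‖ := norm_pos_iff.2 t.ne_zero
  have ht1 : R' ≤ ‖(t : F)‖ := by linarith [le_abs_self R']
  have ht2 : Q < ‖(t : F)‖ * δ := by
    have : (Q + 1) / δ < ‖(t : F)‖ := by linarith
    rw [div_lt_iff₀ hδ] at this
    linarith
  have ht3 : |M| + Q < ‖(t : F)‖ * ‖ξ‖ := by
    have : (|M| + Q + 1) / ‖ξ‖ < ‖(t : F)‖ := by linarith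
    rw [div_lt_iff₀ hξ0] at this
    linarith
  -- vanishing
  have hzero : ∀ a, ‖k a‖ ≤ R → fourierCutoff χ (BruhatDistribution.ofMeasure μ hμ) φ
      ((t : F) • ξ - ((s⁻¹ : Fˣ) : F) • k a) = 0 := by
    intro a ha
    by_contra hne
    have hka : ‖((s⁻¹ : Fˣ) : F) • k a‖ ≤ Q := by
      rw [norm_smul]
      exact mul_le_mul_of_nonneg_left (ha.trans (le_abs_self R)) (norm_nonneg _)
    have hmem : (t : F) • ξ - ((s⁻¹ : Fˣ) : F) • k a ∈ C := by
      have e : (t : F) • ξ - ((s⁻¹ : Fˣ) : F) • k a =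
          (t : F) • (ξ - ((t⁻¹ : Fˣ) : F) • ((s⁻¹ : Fˣ) : F) • k a) := by
        rw [smul_sub, smul_smul (t : F), ← Units.val_mul, mul_inv_cancel, Units.val_one, one_smul]
      rw [e]
      refine hCs.2 t htΛ _ (hδC (mem_ball_iff_norm.2 ?_))
      rw [sub_sub_cancel_left, norm_neg, norm_smul, Units.val_inv_eq_inv_val, norm_inv,
        inv_mul_lt_iff₀ ht0]
      exact hka.trans_lt ht2
    have h1 := hM _ ⟨hmem, subset_closure hne⟩
    have h2 := norm_sub_norm_le ((t : F) • ξ) (((s⁻¹ : Fˣ) : F) • k a)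
    rw [norm_smul] at h2
    have h3 := le_abs_self M
    linarith
  -- averaging
  refine hR' t ht1 ?_
  have hφint : Integrable (φ : V → ℂ) μ := hφcont.integrable_of_hasCompactSupport φ.2.2
  -- Each inner integral is, up to a phase depending only on `a`, the cutoff transform at `t ξ - s⁻¹
  -- k a`, which vanishes. Integrating over `a` first instead turns the characters into `κ` times
  -- the indicator of `D`, where `φ` is constant.
  have havg : ∫ a, ∫ z, (φ : V → ℂ) z * chi χ (-((t : F) • ξ) z) *
      chi χ (k a (((s⁻¹ : Fˣ) : F) • (z - x))) ∂μ ∂ρ = 0 := by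
    refine (integral_congr_ae (g := fun _ => 0) ?_).trans (integral_zero _ _)
    filter_upwards [hR] with a ha
    have h1 := hzero a ha
    rw [fourierCutoff_ofMeasure] at h1
    have h2 : ∀ z, (φ : V → ℂ) z * chi χ (-((t : F) • ξ) z) *
        chi χ (k a (((s⁻¹ : Fˣ) : F) • (z - x))) = (φ : V → ℂ) z *
        chi χ (-(((t : F) • ξ - ((s⁻¹ : Fˣ) : F) • k a) z)) *
          chi χ (-(k a (((s⁻¹ : Fˣ) : F) • x))) := by
      intro z
      rw [mul_assoc, mul_assoc, ← chi_add, ← chi_add]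
      congr 2
      simp [mul_sub]
      ring
    simp only [h2]
    rw [integral_mul_const, h1, zero_mul]
  rw [integral_integral_swap] at havg
  · have hcomp : ∀ z, ∫ a, (φ : V → ℂ) z * chi χ (-((t : F) • ξ) z) *
        chi χ (k a (((s⁻¹ : Fˣ) : F) • (z - x))) ∂ρ =
        D.indicator (fun z => ((φ : V → ℂ) x * κ) * chi χ (-((t : F) • ξ) z)) z := by
      intro z
      rw [integral_const_mul, hkL]
      by_cases hz : z ∈ D
      · rw [Set.indicator_of_mem hz, Set.indicator_of_mem (show _ ∈ L from hz), hφD z hz]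
        ring
      · rw [Set.indicator_of_notMem hz, Set.indicator_of_notMem (show _ ∉ L from hz), mul_zero]
    simp only [hcomp] at havg
    rw [integral_indicator hDc.measurableSet, integral_const_mul, mul_eq_zero] at havg
    exact havg.resolve_left (mul_ne_zero hφ hκ)
  · have hb : Integrable (fun p : A × V => (1 : ℂ) * (φ : V → ℂ) p.2) (ρ.prod μ) :=
      (integrable_const (1 : ℂ)).mul_prod hφint
    refine hb.mono (Continuous.aestronglyMeasurable ?_) (.of_forall fun p => ?_)
    · refine ((hφcont.comp continuous_snd).mul ((continuous_chi χ).comp ?_)).mul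
        ((continuous_chi χ).comp ?_)
      · exact (-((t : F) • ξ)).continuous.comp continuous_snd
      · have h1 : Continuous fun p : A × V => ((s⁻¹ : Fˣ) : F) • (p.2 - x) := by fun_prop
        exact hk.comp (continuous_fst.prodMk h1)
    · simp [Function.uncurry, norm_chi]

end Measures

end OrbitalMeasure
end

noncomputable section

namespace OrbitalMeasure

set_option linter.unusedSectionVars false

/-! ### Oscillatory integrals against the orbital measures -/

variable {F : Type*} [NontriviallyNormedField F] [IsUltrametricDist F] [ProperSpace F]
  [MeasurableSpace F] [BorelSpace F] {n : ℕ} (χ : UnramifiedCharacter F)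

/-- Matrices with bounded entries, as an additive subgroup. -/
def boxSubgroup (F : Type*) [NontriviallyNormedField F] [IsUltrametricDist F] (n : ℕ) (r : ℝ)
    (hr : 0 ≤ r) : AddSubgroup (Matrix (Fin n) (Fin n) F) where
  carrier := boxMatrices r
  add_mem' ha hb i j := (IsUltrametricDist.norm_add_le_max _ _).trans (max_le (ha i j) (hb i j))
  zero_mem' i j := by simpa using hr
  neg_mem' ha i j := by simpa using ha i j

lemma isOpen_boxMatrices {r : ℝ} (hr : 0 < r) :
    IsOpen (boxMatrices r : Set (Matrix (Fin n) (Fin n) F)) := by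
  have : (boxMatrices r : Set (Matrix (Fin n) (Fin n) F)) =
      ⋂ i, ⋂ j, (fun z : Matrix (Fin n) (Fin n) F => z i j) ⁻¹' Metric.closedBall 0 r := by
    ext z; simp [boxMatrices]
  rw [this]
  exact isOpen_iInter_of_finite fun i => isOpen_iInter_of_finite fun j =>
    (IsUltrametricDist.isOpen_closedBall _ hr.ne').preimage (by fun_prop)

lemma isClopen_boxMatrices {r : ℝ} (hr : 0 < r) :
    IsClopen (boxMatrices r : Set (Matrix (Fin n) (Fin n) F)) :=
  ⟨isClosed_boxMatrices r, isOpen_boxMatrices hr⟩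

lemma smul_mem_boxMatrices {c : Fˣ} {r : ℝ} {z : Matrix (Fin n) (Fin n) F} :
    (c : F) • z ∈ (boxMatrices r : Set (Matrix (Fin n) (Fin n) F)) ↔
      z ∈ (boxMatrices (‖((c⁻¹ : Fˣ) : F)‖ * r) : Set (Matrix (Fin n) (Fin n) F)) := by
  have hc : 0 < ‖(c : F)‖ := norm_pos_iff.2 c.ne_zero
  refine forall_congr' fun i => forall_congr' fun j => ?_
  rw [Matrix.smul_apply, smul_eq_mul, norm_mul, Units.val_inv_eq_inv_val, norm_inv,
    le_inv_mul_iff₀ hc]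

lemma norm_trace_mul_le {e u : Matrix (Fin n) (Fin n) F} {r s : ℝ} (hr : 0 ≤ r) (hs : 0 ≤ s)
    (he : e ∈ (boxMatrices r : Set (Matrix (Fin n) (Fin n) F)))
    (hu : u ∈ (boxMatrices s : Set (Matrix (Fin n) (Fin n) F))) : ‖(e * u).trace‖ ≤ r * s := by
  rw [Matrix.trace]
  refine IsUltrametricDist.norm_sum_le_of_forall_le_of_nonneg (mul_nonneg hr hs) fun i _ => ?_
  rw [Matrix.diag_apply, Matrix.mul_apply]
  refine IsUltrametricDist.norm_sum_le_of_forall_le_of_nonneg (mul_nonneg hr hs) fun j _ => ?_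
  rw [norm_mul]
  exact mul_le_mul (he i j) (hu j i) (norm_nonneg _) hr

/-- The lattice of integer matrices is its own dual for the trace pairing, because the kernel of `χ`
is exactly the ring of integers. -/
lemma setIntegral_chi_trace_box (u : Matrix (Fin n) (Fin n) F) :
    ∫ e in boxMatrices 1, chi χ (e * u).trace ∂matHaar F (Fin n) =
      (boxMatrices 1 : Set (Matrix (Fin n) (Fin n) F)).indicator (fun _ => 1) u := by
  have hm : MeasurableSet (boxSubgroup F n 1 zero_le_one : Set (Matrix (Fin n) (Fin n) F)) :=
    (isClosed_boxMatrices 1).measurableSet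
  change ∫ e in (boxSubgroup F n 1 zero_le_one : Set (Matrix (Fin n) (Fin n) F)),
    chi χ (e * u).trace ∂matHaar F (Fin n) = _
  by_cases hu : u ∈ (boxMatrices 1 : Set (Matrix (Fin n) (Fin n) F))
  · rw [Set.indicator_of_mem hu, setIntegral_character_of_trivial _ _ _ hm]
    · have : (matHaar F (Fin n)) (boxSubgroup F n 1 zero_le_one : Set (Matrix (Fin n) (Fin n) F))
        = 1 := matHaar_integerMatrices
      rw [Measure.real, this]
      simp
    · intro e he
      rw [chi_eq_one_iff]
      simpa using norm_trace_mul_le zero_le_one zero_le_one he hu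
  · rw [Set.indicator_of_notMem hu]
    simp only [boxMatrices, Set.mem_ofPred_eq, not_forall, not_le] at hu
    obtain ⟨i, j, hij⟩ := hu
    refine setIntegral_character_of_nontrivial (matHaar F (Fin n)) (boxSubgroup F n 1 zero_le_one)
      (fun e => chi χ (e * u).trace) hm
      (fun a b => by rw [Matrix.add_mul, Matrix.trace_add, chi_add])
      (a₀ := Matrix.single j i 1) (fun k l => ?_) ?_
    · rw [Matrix.single_apply]
      split_ifs <;> simp
    · rw [Ne, chi_eq_one_iff, not_le]
      simpa [Matrix.trace_single_mul] using hij

/-- Boxes in the coordinates given by `g`, `h`. -/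
lemma isClopen_twoSided_box (g h : GL (Fin n) F) (x : Matrix (Fin n) (Fin n) F) :
    IsClopen {z | twoSided g h (z - x) ∈ (boxMatrices 1 : Set (Matrix (Fin n) (Fin n) F))} :=
  (isClopen_boxMatrices one_pos).preimage
    ((twoSided g h).continuous.comp (continuous_sub_right x))

lemma isCompact_twoSided_box (g h : GL (Fin n) F) (x : Matrix (Fin n) (Fin n) F) :
    IsCompact {z | twoSided g h (z - x) ∈ (boxMatrices 1 : Set (Matrix (Fin n) (Fin n) F))} :=
  ((Homeomorph.subRight x).trans (twoSided g h)).isCompact_preimage.2 (isCompact_boxMatrices 1)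

/-- Fourier duality between the two orbital measures for indicators of boxes. -/
lemma setIntegral_corankOneMeasure (g h : GL (Fin n) F) (x y : Matrix (Fin n) (Fin n) F) :
    ∃ c : ℂ, c ≠ 0 ∧ ∫ z in {z | twoSided g h (z - x) ∈ boxMatrices 1},
        chi χ (-(z * y).trace) ∂corankOneMeasure F n =
      c * ∫ w in {w | twoSided h g (w - y) ∈ boxMatrices 1},
        chi χ (x * (w - y)).trace ∂rankOneMeasure F (Fin n) := by
  set D := {z | twoSided g h (z - x) ∈ (boxMatrices 1 : Set (Matrix (Fin n) (Fin n) F))} with hD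
  set D' := {w | twoSided h g (w - y) ∈ (boxMatrices 1 : Set (Matrix (Fin n) (Fin n) F))} with hD'
  have hDo : IsClopen D := isClopen_twoSided_box g h x
  have hDo' : IsClopen D' := isClopen_twoSided_box h g y
  set c : ℝ≥0 := distribHaarChar F (Matrix.GeneralLinearGroup.det g) ^ n *
        (distribHaarChar F (Matrix.GeneralLinearGroup.det h) ^ n)⁻¹ with hc
  have hc0 : c ≠ 0 := mul_ne_zero (pow_ne_zero _ (distribHaarChar_ne_zero _))
    (inv_ne_zero (pow_ne_zero _ (distribHaarChar_ne_zero _)))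
  have hlc : IsLocallyConstant fun z : Matrix (Fin n) (Fin n) F => chi χ (-(z * y).trace) := by
    have hct : Continuous fun z : Matrix (Fin n) (Fin n) F => -(z * y).trace := by fun_prop
    exact (χ.isLocallyConstant.comp_continuous hct).comp (fun z : Circle => (z : ℂ))
  refine ⟨((c : ℝ) : ℂ), by exact_mod_cast hc0, ?_⟩
  rw [← integral_indicator hDo.isOpen.measurableSet,
    integral_corankOneMeasure χ (isLocallyConstant_indicator hDo hlc)
      (hasCompactSupport_indicator (isCompact_twoSided_box g h x) _),
    ← integral_indicator hDo'.isOpen.measurableSet, ← integral_const_mul]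
  congr 1
  ext w
  -- After translation by `x` and the change of coordinates by `(g, h)`, what remains is a character
  -- on the unit box. Its integral is the indicator of the self-dual box, read in the dual
  -- coordinates `(h, g)`.
  set H : Matrix (Fin n) (Fin n) F → ℂ := fun e =>
    (boxMatrices 1 : Set (Matrix (Fin n) (Fin n) F)).indicator
      (fun e => chi χ (e * twoSided h g (w - y)).trace) e with hH
  have h1 : ∀ e, chi χ (e * w).trace * D.indicator (fun z => chi χ (-(z * y).trace)) e =
      chi χ (x * (w - y)).trace * (H ∘ twoSided g h) (e - x) := by
    intro e
    by_cases he : e ∈ D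
    · rw [Set.indicator_of_mem he, Function.comp_apply, hH]
      simp only
      rw [Set.indicator_of_mem (show _ ∈ boxMatrices 1 from he), trace_twoSided_mul, ← chi_add,
        ← chi_add, ← Matrix.trace_neg, ← Matrix.trace_add, ← Matrix.trace_add, ← Matrix.add_mul,
        add_sub_cancel, Matrix.mul_sub, sub_eq_add_neg]
    · rw [Set.indicator_of_notMem he, Function.comp_apply, hH]
      simp only
      rw [Set.indicator_of_notMem (show _ ∉ boxMatrices 1 from he), mul_zero, mul_zero]
  rw [matFourier]
  simp only [h1]
  rw [integral_const_mul, integral_sub_right_eq_self (H ∘ twoSided g h) x]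
  have h2 : ∫ e, (H ∘ twoSided g h) e ∂matHaar F (Fin n) = c * ∫ e, H e ∂matHaar F (Fin n) := by
    have h3 := (twoSided g h).measurableEmbedding.integral_map (μ := matHaar F (Fin n)) H
    rw [map_twoSided_matHaar, integral_smul_nnreal_measure, NNReal.smul_def,
      Complex.real_smul] at h3
    exact h3.symm
  rw [h2, hH, integral_indicator (isClosed_boxMatrices 1).measurableSet, setIntegral_chi_trace_box]
  by_cases hw : w ∈ D'
  · rw [Set.indicator_of_mem hw, Set.indicator_of_mem (show _ ∈ boxMatrices 1 from hw)]
    ring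
  · rw [Set.indicator_of_notMem hw, Set.indicator_of_notMem (show _ ∉ boxMatrices 1 from hw)]
    ring

lemma integral_rankOneMeasure {f : Matrix (Fin n) (Fin n) F → ℂ} (hf : StronglyMeasurable f) :
    ∫ z, f z ∂rankOneMeasure F (Fin n) = ∫ x in unitPairs F (Fin n), f (rankOne x)
      ∂(vecHaar F (Fin n)).prod (vecHaar F (Fin n)) := by
  rw [rankOneMeasure, integral_map continuous_rankOne.measurable.aemeasurable
    hf.aestronglyMeasurable]

/-- The entry `p i₀ * q i₀` is within `ε < 1` of one, so it has norm one and `‖q i₀‖ ≥ 1`. This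
bounds the other `p i` by `ε`, and `‖p‖ = 1` then forces `‖p i₀‖ = 1`. The fibre over `p` is thus a
ball in `q`, over which characters integrate explicitly. -/
lemma rankOne_sub_single_mem_box (i₀ : Fin n) {ε : ℝ} (hε0 : 0 ≤ ε) (hε : ε < 1)
    {p q : Fin n → F} (hp : ‖p‖ = 1) :
    rankOne (p, q) - Matrix.single i₀ i₀ 1 ∈ (boxMatrices ε : Set (Matrix (Fin n) (Fin n) F)) ↔
      (‖p i₀‖ = 1 ∧ ∀ i ≠ i₀, ‖p i‖ ≤ ε) ∧ ‖q - Pi.single i₀ (p i₀)⁻¹‖ ≤ ε := by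
  have hle : ∀ i, ‖p i‖ ≤ 1 := fun i => hp ▸ norm_le_pi_norm p i
  have hent : ∀ i j : Fin n,
      (rankOne (p, q) - Matrix.single i₀ i₀ (1 : F) : Matrix (Fin n) (Fin n) F) i j =
      p i * q j - if i₀ = i ∧ i₀ = j then 1 else 0 := by
    intro i j
    rw [Matrix.sub_apply, Matrix.single_apply, rankOne, Matrix.vecMulVec_apply]
  constructor
  · intro h
    have h00 := h i₀ i₀
    rw [hent, if_pos ⟨rfl, rfl⟩] at h00
    have hpq : ‖p i₀ * q i₀‖ = 1 := by
      have h3 := IsUltrametricDist.norm_add_eq_max_of_norm_ne_norm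
        (x := p i₀ * q i₀ - 1) (y := 1) (by rw [norm_one]; exact (h00.trans_lt hε).ne)
      rw [sub_add_cancel, norm_one, max_eq_right (h00.trans hε.le)] at h3
      exact h3
    have hq1 : 1 ≤ ‖q i₀‖ := by
      rw [norm_mul] at hpq
      have := mul_le_mul_of_nonneg_right (hle i₀) (norm_nonneg (q i₀))
      linarith
    have hpi : ∀ i ≠ i₀, ‖p i‖ ≤ ε := by
      intro i hi
      have h1 := h i i₀
      rw [hent, if_neg (fun h => hi h.1.symm), sub_zero, norm_mul] at h1
      exact (le_mul_of_one_le_right (norm_nonneg _) hq1).trans h1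
    have hp0 : ‖p i₀‖ = 1 := by
      refine le_antisymm (hle i₀) (not_lt.1 fun hlt => ?_)
      have : ‖p‖ < 1 := (pi_norm_lt_iff one_pos).2 fun i => by
        by_cases hi : i = i₀
        · rwa [hi]
        · exact (hpi i hi).trans_lt hε
      exact this.ne hp
    refine ⟨⟨hp0, hpi⟩, (pi_norm_le_iff_of_nonneg hε0).2 fun j => ?_⟩
    have hp0' : p i₀ ≠ 0 := norm_pos_iff.1 (by rw [hp0]; exact one_pos)
    have e : ‖(q - Pi.single i₀ (p i₀)⁻¹ : Fin n → F) j‖ =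
        ‖p i₀ * q j - if i₀ = i₀ ∧ i₀ = j then 1 else 0‖ := by
      have : p i₀ * q j - (if i₀ = i₀ ∧ i₀ = j then 1 else 0) =
          p i₀ * (q - Pi.single i₀ (p i₀)⁻¹ : Fin n → F) j := by
        by_cases hj : j = i₀
        · subst hj; simp [mul_sub, hp0']
        · simp [hj, Ne.symm hj]
      rw [this, norm_mul, hp0, one_mul]
    rw [e, ← hent]
    exact h _ _
  · rintro ⟨⟨hp0, hpi⟩, hq⟩ i j
    have hp0' : p i₀ ≠ 0 := norm_pos_iff.1 (by rw [hp0]; exact one_pos)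
    have hqj : ∀ j, ‖(q - Pi.single i₀ (p i₀)⁻¹ : Fin n → F) j‖ ≤ ε := fun j =>
      (norm_le_pi_norm _ j).trans hq
    have hq1 : ‖q j‖ ≤ 1 := by
      have h1 : ‖(Pi.single i₀ (p i₀)⁻¹ : Fin n → F) j‖ ≤ 1 := by
        by_cases hj : j = i₀
        · subst hj; simp [hp0]
        · simp [hj]
      have h2 := hqj j
      rw [Pi.sub_apply] at h2
      set b : F := (Pi.single i₀ (p i₀)⁻¹ : Fin n → F) j
      have h3 := IsUltrametricDist.norm_add_le_max (q j - b) b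
      rw [sub_add_cancel] at h3
      exact h3.trans (max_le (h2.trans hε.le) h1)
    rw [hent]
    by_cases hi : i = i₀
    · subst hi
      have : p i * q j - (if i = i ∧ i = j then 1 else 0) =
          p i * (q - Pi.single i (p i)⁻¹ : Fin n → F) j := by
        by_cases hj : j = i
        · subst hj; simp [mul_sub, hp0']
        · simp [hj, Ne.symm hj]
      rw [this, norm_mul, hp0, one_mul]
      exact hqj j
    · rw [if_neg (fun h => hi h.1.symm), sub_zero, norm_mul]
      exact (mul_le_of_le_one_right (norm_nonneg _) hq1).trans (hpi i hi)

/-- Near a rank one idempotent the oscillatory integral of a phase vanishing there is positive. -/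
lemma setIntegral_rankOneMeasure_single_ne_zero (i₀ : Fin n) {ε : Fˣ} (hε : ‖(ε : F)‖ < 1)
    {X : Matrix (Fin n) (Fin n) F} (h1 : Matrix.single i₀ i₀ 1 * X = 0)
    (h2 : X * Matrix.single i₀ i₀ 1 = 0) :
    ∫ z in {z | z - Matrix.single i₀ i₀ (1 : F) ∈ boxMatrices ‖(ε : F)‖},
      chi χ (X * z).trace ∂rankOneMeasure F (Fin n) ≠ 0 := by
  have hε0 : 0 < ‖(ε : F)‖ := norm_pos_iff.2 ε.ne_zero
  set M : Set (Matrix (Fin n) (Fin n) F) :=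
    {z | z - Matrix.single i₀ i₀ (1 : F) ∈ boxMatrices ‖(ε : F)‖} with hM
  have hMo : IsClopen M := (isClopen_boxMatrices hε0).preimage (continuous_sub_right _)
  have hMc : IsCompact M := (Homeomorph.subRight _).isCompact_preimage.2 (isCompact_boxMatrices _)
  have hlc : IsLocallyConstant fun z : Matrix (Fin n) (Fin n) F => chi χ (X * z).trace := by
    have hct : Continuous fun z : Matrix (Fin n) (Fin n) F => (X * z).trace := by fun_prop
    exact (χ.isLocallyConstant.comp_continuous hct).comp (fun z : Circle => (z : ℂ))
  -- The balls in `q` are centred at multiples of the `i₀`-th basis vector; this vanishing makes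
  -- recentring them at zero harmless for the phase.
  have hX1 : ∀ p : Fin n → F, (X.mulVec p) i₀ = 0 := by
    intro p
    have h3 : (Matrix.single i₀ i₀ (1 : F) * X).mulVec p i₀ = 0 := by rw [h1]; simp
    rw [← Matrix.mulVec_mulVec, Matrix.single_mulVec] at h3
    simpa using h3
  have hX2 : X.mulVec (Pi.single i₀ 1) = 0 := by
    ext k
    have h3 : (X * Matrix.single i₀ i₀ (1 : F)) k i₀ = 0 := by rw [h2, Matrix.zero_apply]
    simpa using h3
  set G := M.indicator fun z => chi χ (X * z).trace with hG
  have hGlc : IsLocallyConstant G := isLocallyConstant_indicator hMo hlc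
  have hGc : HasCompactSupport G := hasCompactSupport_indicator hMc _
  have hGi : Integrable G (rankOneMeasure F (Fin n)) :=
    hGlc.continuous.integrable_of_hasCompactSupport hGc
  have hGi' : Integrable ((unitPairs F (Fin n)).indicator fun x => G (rankOne x))
      ((vecHaar F (Fin n)).prod (vecHaar F (Fin n))) := by
    rw [rankOneMeasure, integrable_map_measure hGlc.continuous.aestronglyMeasurable
      continuous_rankOne.measurable.aemeasurable] at hGi
    exact (integrable_indicator_iff measurableSet_unitPairs).2 hGi
  rw [← integral_indicator hMo.isOpen.measurableSet, ← hG,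
    integral_rankOneMeasure hGlc.continuous.stronglyMeasurable,
    ← integral_indicator measurableSet_unitPairs, integral_prod _ hGi']
  -- `Q` collects the `p` for which the character is trivial on the ball in `q`. As `X` kills the
  -- `i₀`-th basis vector, `Q` is a neighbourhood of that vector, however large `X` is; hence it has
  -- positive measure.
  set Q : Set (Fin n → F) := {p | (‖p i₀‖ = 1 ∧ ∀ i ≠ i₀, ‖p i‖ ≤ ‖(ε : F)‖) ∧
    ‖(ε : F)‖ * ‖X.mulVec p‖ ≤ 1} with hQ
  have hQn : ∀ p : Fin n → F, ‖p i₀‖ = 1 → (∀ i ≠ i₀, ‖p i‖ ≤ ‖(ε : F)‖) → ‖p‖ = 1 := by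
    intro p hp hpi
    refine le_antisymm ((pi_norm_le_iff_of_nonneg zero_le_one).2 fun i => ?_)
      (hp ▸ norm_le_pi_norm p i₀)
    by_cases hi : i = i₀
    · rw [hi, hp]
    · exact (hpi i hi).trans hε.le
  have hinner : ∀ p : Fin n → F, ∫ q, (unitPairs F (Fin n)).indicator
      (fun x => G (rankOne x)) (p, q) ∂vecHaar F (Fin n) =
      Q.indicator (fun _ => (((distribHaarChar F ε : ℝ) ^ n : ℝ) : ℂ)) p := by
    intro p
    by_cases hp : ‖p i₀‖ = 1 ∧ ∀ i ≠ i₀, ‖p i‖ ≤ ‖(ε : F)‖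
    · have hpn := hQn p hp.1 hp.2
      have e1 : ∀ q, (unitPairs F (Fin n)).indicator (fun x => G (rankOne x)) (p, q) =
          (Metric.closedBall (0 : Fin n → F) ‖(ε : F)‖).indicator
            (fun q => chi χ (q ⬝ᵥ X.mulVec p)) (q - Pi.single i₀ (p i₀)⁻¹) := by
        intro q
        have hiff := rankOne_sub_single_mem_box i₀ hε0.le hε (q := q) hpn
        rw [Set.indicator_of_mem (show (p, q) ∈ unitPairs F (Fin n) from hpn), hG]
        by_cases hq : ‖q - Pi.single i₀ (p i₀)⁻¹‖ ≤ ‖(ε : F)‖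
        · rw [Set.indicator_of_mem (show rankOne (p, q) ∈ M from hiff.2 ⟨hp, hq⟩),
            Set.indicator_of_mem (mem_closedBall_zero_iff.2 hq), trace_mul_rankOne,
            sub_dotProduct, single_dotProduct, hX1, mul_zero, sub_zero]
        · rw [Set.indicator_of_notMem (fun h : rankOne (p, q) ∈ M => hq (hiff.1 h).2),
            Set.indicator_of_notMem (fun h => hq (mem_closedBall_zero_iff.1 h))]
      simp only [e1]
      rw [integral_sub_right_eq_self (fun q => (Metric.closedBall (0 : Fin n → F)
        ‖(ε : F)‖).indicator (fun q => chi χ (q ⬝ᵥ X.mulVec p)) q),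
        integral_indicator Metric.isClosed_closedBall.measurableSet, setIntegral_chi_ball,
        Fintype.card_fin]
      by_cases hpQ : ‖(ε : F)‖ * ‖X.mulVec p‖ ≤ 1
      · rw [if_pos hpQ, Set.indicator_of_mem (show p ∈ Q from ⟨hp, hpQ⟩), mul_one]
      · rw [if_neg hpQ, Set.indicator_of_notMem (fun h : p ∈ Q => hpQ h.2), mul_zero]
    · rw [Set.indicator_of_notMem (fun h : p ∈ Q => hp h.1)]
      refine (integral_congr_ae (g := fun _ => 0) (.of_forall fun q => ?_)).trans
        (integral_zero _ _)
      simp only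
      by_cases hpn : ‖p‖ = 1
      · have hiff := rankOne_sub_single_mem_box i₀ hε0.le hε (q := q) hpn
        rw [Set.indicator_of_mem (show (p, q) ∈ unitPairs F (Fin n) from hpn), hG,
          Set.indicator_of_notMem (fun h : rankOne (p, q) ∈ M => hp (hiff.1 h).1)]
      · exact Set.indicator_of_notMem (fun h : (p, q) ∈ unitPairs F (Fin n) => hpn h) _
  simp only [hinner]
  have hXc : Continuous fun p : Fin n → F => ‖(ε : F)‖ * ‖X.mulVec p‖ := by fun_prop
  have hQm : MeasurableSet Q := by
    have hc : IsClosed {p : Fin n → F | ∀ i ≠ i₀, ‖p i‖ ≤ ‖(ε : F)‖} := by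
      simp only [Set.ofPred_forall]
      exact isClosed_iInter fun i => isClosed_iInter fun _ =>
        isClosed_le (by fun_prop) continuous_const
    exact (((isClosed_eq (by fun_prop) continuous_const).inter hc).inter
      (isClosed_le hXc continuous_const)).measurableSet
  rw [integral_indicator hQm, setIntegral_const, Complex.real_smul]
  have hnhds : Q ∈ nhds (Pi.single i₀ 1 : Fin n → F) := by
    have n1 : {p : Fin n → F | ‖(ε : F)‖ * ‖X.mulVec p‖ < 1} ∈ nhds (Pi.single i₀ 1) :=
      (isOpen_lt hXc continuous_const).mem_nhds (by simp [hX2])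
    filter_upwards [n1, Metric.ball_mem_nhds _ hε0] with p hp hpε
    have h3 : ∀ i, ‖p i - (Pi.single i₀ 1 : Fin n → F) i‖ < ‖(ε : F)‖ := fun i =>
      (norm_le_pi_norm (p - Pi.single i₀ 1) i).trans_lt (mem_ball_iff_norm.1 hpε)
    refine ⟨⟨?_, fun i hi => ?_⟩, hp.le⟩
    · have h4 := h3 i₀
      rw [Pi.single_eq_same] at h4
      have h5 := IsUltrametricDist.norm_add_eq_max_of_norm_ne_norm (x := p i₀ - 1) (y := 1)
        (by rw [norm_one]; exact (h4.trans hε).ne)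
      rwa [sub_add_cancel, norm_one, max_eq_right (h4.trans hε).le] at h5
    · have h4 := h3 i
      rw [Pi.single_eq_of_ne hi, sub_zero] at h4
      exact h4.le
  have hfin : vecHaar F (Fin n) Q ≠ ∞ := by
    refine ((measure_mono fun p hp => ?_).trans_lt
      (isCompact_closedBall (0 : Fin n → F) 1).measure_lt_top).ne
    exact mem_closedBall_zero_iff.2 (hQn p hp.1.1 hp.1.2).le
  refine mul_ne_zero ?_ ?_
  · rw [Complex.ofReal_ne_zero, Measure.real, ENNReal.toReal_ne_zero]
    exact ⟨(Measure.measure_pos_of_mem_nhds _ hnhds).ne', hfin⟩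
  · rw [Complex.ofReal_ne_zero]
    exact pow_ne_zero _ (by exact_mod_cast distribHaarChar_ne_zero ε)

/-- The two-sided action moves `x` to an idempotent matrix unit. It scales the measure by a nonzero
constant, and the dual action on `X` preserves both the phase and the vanishing products. -/
lemma setIntegral_rankOneMeasure_ne_zero {i₀ : Fin n} {g h : GL (Fin n) F}
    {x X : Matrix (Fin n) (Fin n) F} (hx : twoSided g h x = Matrix.single i₀ i₀ 1)
    (h1 : x * X = 0) (h2 : X * x = 0) {ε : Fˣ} (hε : ‖(ε : F)‖ < 1) :
    ∫ z in {z | twoSided g h z - Matrix.single i₀ i₀ (1 : F) ∈ boxMatrices ‖(ε : F)‖},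
      chi χ (X * z).trace ∂rankOneMeasure F (Fin n) ≠ 0 := by
  have key := setIntegral_rankOneMeasure_single_ne_zero χ i₀ hε (X := twoSided h g X)
    (by
      rw [← hx, twoSided_apply, twoSided_apply]
      simp only [Matrix.mul_assoc]
      rw [← Matrix.mul_assoc (h : Matrix (Fin n) (Fin n) F), Units.mul_inv, Matrix.one_mul,
        ← Matrix.mul_assoc x, h1, Matrix.zero_mul, Matrix.mul_zero])
    (by
      rw [← hx, twoSided_apply, twoSided_apply]
      simp only [Matrix.mul_assoc]
      rw [← Matrix.mul_assoc (g : Matrix (Fin n) (Fin n) F), Units.mul_inv, Matrix.one_mul,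
        ← Matrix.mul_assoc X, h2, Matrix.zero_mul, Matrix.mul_zero])
  set M : Set (Matrix (Fin n) (Fin n) F) :=
    {z | z - Matrix.single i₀ i₀ (1 : F) ∈ boxMatrices ‖(ε : F)‖} with hM
  have h3 := (twoSided g h).measurableEmbedding.setIntegral_map (μ := rankOneMeasure F (Fin n))
    (fun z => chi χ (twoSided h g X * z).trace) M
  rw [map_twoSided_rankOneMeasure, Measure.restrict_smul, integral_smul_nnreal_measure,
    NNReal.smul_def, Complex.real_smul] at h3
  have h4 : ∀ z, chi χ (twoSided h g X * twoSided g h z).trace = chi χ (X * z).trace := fun z => by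
    rw [trace_twoSided_mul]
  simp only [h4] at h3
  intro h0
  refine mul_ne_zero ?_ key (h3.trans h0)
  exact_mod_cast mul_ne_zero (distribHaarChar_ne_zero _) (inv_ne_zero (distribHaarChar_ne_zero _))

lemma _root_.Matrix.eq_zero_of_rank_eq_zero {y : Matrix (Fin n) (Fin n) F} (h0 : y.rank = 0) :
    y = 0 := by
  have h1 := LinearMap.range_eq_bot.1 (Submodule.finrank_eq_zero.1 h0)
  refine Matrix.ext_of_mulVec_single fun j => ?_
  have h2 := LinearMap.congr_fun h1 (Pi.single j 1)
  rwa [Matrix.mulVecLin_apply, LinearMap.zero_apply, ← Matrix.zero_mulVec (Pi.single j 1)] at h2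

/-- The two-sided action is transitive on matrices of rank one. -/
lemma exists_twoSided_eq_single {y : Matrix (Fin n) (Fin n) F} (hy : y ≠ 0) (hr : y.rank ≤ 1) :
    ∃ (i₀ : Fin n) (g h : GL (Fin n) F), twoSided g h y = Matrix.single i₀ i₀ 1 := by
  obtain ⟨V, U, e, hV, hU, hVU⟩ := Matrix.exists_rank_normal_form y
  have hr1 : y.rank = 1 := by
    exact le_antisymm hr (Nat.one_le_iff_ne_zero.2 fun h0 => hy (Matrix.eq_zero_of_rank_eq_zero h0))
  have hsub : Subsingleton (Fin y.rank) := by rw [hr1]; infer_instance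
  refine ⟨e.symm (Sum.inl ⟨0, by omega⟩), hV.unit⁻¹, hU.unit, ?_⟩
  rw [twoSided_apply, inv_inv]
  refine hVU.trans ?_
  ext i j
  rw [Matrix.submatrix_apply, Matrix.single_apply]
  simp only [Equiv.symm_apply_eq]
  rcases hi : e i with a | a <;> rcases hj : e j with b | b
  · rw [Matrix.fromBlocks_apply₁₁, Subsingleton.elim a b, Matrix.one_apply_eq, if_pos]
    exact ⟨congrArg _ (Subsingleton.elim _ _), congrArg _ (Subsingleton.elim _ _)⟩
  all_goals simp

end OrbitalMeasure
end

noncomputable section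

namespace OrbitalMeasure

set_option linter.unusedSectionVars false

/-! ### Wave front sets of the orbital measures -/

variable {F : Type*} [NontriviallyNormedField F] [IsUltrametricDist F] [ProperSpace F]
  [MeasurableSpace F] [BorelSpace F] {n : ℕ} (χ : UnramifiedCharacter F)

section Covectors

variable {V : Type*} [NormedAddCommGroup V] [NormedSpace F V] (Φ : V ≃L[F] Matrix (Fin n) (Fin n) F)

/-- The covector `z ↦ tr(Φ(z) y)`. -/
def traceForm : Matrix (Fin n) (Fin n) F →ₗ[F] StrongDual F V where
  toFun y :=
    { toFun := fun z => (Φ z * y).trace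
      map_add' := fun z z' => by rw [map_add, Matrix.add_mul, Matrix.trace_add]
      map_smul' := fun c z => by rw [map_smul, Matrix.smul_mul, Matrix.trace_smul, RingHom.id_apply]
      cont := by
        have := Φ.continuous
        fun_prop }
  map_add' y y' := by
    ext z
    change (Φ z * (y + y')).trace = (Φ z * y).trace + (Φ z * y').trace
    rw [Matrix.mul_add, Matrix.trace_add]
  map_smul' c y := by
    ext z
    change (Φ z * (c • y)).trace = c • (Φ z * y).trace
    rw [Matrix.mul_smul, Matrix.trace_smul]

lemma traceForm_apply (y : Matrix (Fin n) (Fin n) F) (z : V) :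
    traceForm Φ y z = (Φ z * y).trace := rfl

/-- The matrix of a covector with respect to the trace pairing. -/
def covMatrix (ξ : StrongDual F V) : Matrix (Fin n) (Fin n) F :=
  Matrix.of fun j i => ξ (Φ.symm (Matrix.single i j 1))

lemma continuous_covMatrix : Continuous (covMatrix Φ) :=
  continuous_matrix fun j i =>
    (ContinuousLinearMap.apply F F (Φ.symm (Matrix.single i j 1))).continuous

lemma covMatrix_traceForm (y : Matrix (Fin n) (Fin n) F) : covMatrix Φ (traceForm Φ y) = y := by
  ext j i
  rw [covMatrix, Matrix.of_apply, traceForm_apply, ContinuousLinearEquiv.apply_symm_apply,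
    Matrix.trace_single_mul, one_smul]

lemma traceForm_covMatrix (ξ : StrongDual F V) : traceForm Φ (covMatrix Φ ξ) = ξ := by
  ext z
  rw [traceForm_apply]
  conv_rhs => rw [← Φ.symm_apply_apply z, Matrix.matrix_eq_sum_single (Φ z)]
  simp only [map_sum]
  simp only [Matrix.trace, Matrix.diag_apply, Matrix.mul_apply, covMatrix, Matrix.of_apply]
  refine Finset.sum_congr rfl fun i _ => Finset.sum_congr rfl fun j _ => ?_
  rw [show Matrix.single i j (Φ z i j) = (Φ z i j) • Matrix.single i j (1 : F) by
    rw [Matrix.smul_single, smul_eq_mul, mul_one], map_smul, map_smul, smul_eq_mul]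

lemma continuous_traceForm : Continuous (traceForm Φ) :=
  LinearMap.continuous_of_finiteDimensional _

lemma traceForm_ne_zero {y : Matrix (Fin n) (Fin n) F} (hy : y ≠ 0) : traceForm Φ y ≠ 0 :=
  fun h => hy (by rw [← covMatrix_traceForm Φ y, h]; ext i j; simp [covMatrix])

end Covectors

variable {V : Type*} [NormedAddCommGroup V] [NormedSpace F V] [MeasurableSpace V] [BorelSpace V]
  (Φ : V ≃L[F] Matrix (Fin n) (Fin n) F) (Λ : Subgroup Fˣ) {M : Measure (Matrix (Fin n) (Fin n) F)}

lemma setIntegral_map_symm (A : Set V) (f : V → ℂ) :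
    ∫ z in A, f z ∂M.map Φ.symm = ∫ z in Φ.symm ⁻¹' A, f (Φ.symm z) ∂M :=
  Φ.symm.toHomeomorph.measurableEmbedding.setIntegral_map f A

lemma exists_trace_mul_ne_zero {m : Matrix (Fin n) (Fin n) F} (hm : m ≠ 0) :
    ∃ a : Matrix (Fin n) (Fin n) F, (a * m).trace ≠ 0 := by
  by_contra! h
  refine hm (Matrix.ext fun i j => ?_)
  have := h (Matrix.single j i 1)
  rwa [Matrix.trace_single_mul, one_smul] at this

/-- The unit sphere of `F` is open and the determinant is continuous, so the flows used below need
no trace condition on `a`. -/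
lemma exists_norm_det_one_add_smul (a : Matrix (Fin n) (Fin n) F) :
    ∃ ε > 0, ∀ s : F, ‖s‖ < ε → ‖(1 + s • a).det‖ = 1 := by
  have h1 : Continuous fun s : F => (1 + s • a).det := by fun_prop
  have h2 := h1.continuousAt.preimage_mem_nhds (x := (0 : F))
    ((IsUltrametricDist.isOpen_sphere (0 : F) one_ne_zero).mem_nhds (x := (1 + (0 : F) • a).det)
      (by simp))
  obtain ⟨ε, hε, h⟩ := Metric.mem_nhds_iff.1 h2
  exact ⟨ε, hε, fun s hs => mem_sphere_zero_iff_norm.1 (h (mem_ball_zero_iff.2 hs))⟩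

/-- Invariance under pairs of matrices of norm one determinant confines the wave front set to
pairs with vanishing products. -/
lemma mul_eq_zero_of_mem_waveFrontSet
    (hM : ∀ g h : GL (Fin n) F, ‖(Matrix.GeneralLinearGroup.det g : F)‖ = 1 →
      ‖(Matrix.GeneralLinearGroup.det h : F)‖ = 1 → M.map (twoSided g h) = M)
    (hμ : IsFiniteMeasureOnCompacts (M.map Φ.symm)) {x : V} {y : Matrix (Fin n) (Fin n) F}
    (hxy : (x, traceForm Φ y) ∈ waveFrontSet Λ χ (BruhatDistribution.ofMeasure (M.map Φ.symm) hμ)) :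
    Φ x * y = 0 ∧ y * Φ x = 0 := by
  have i1 : SecondCountableTopology V := Φ.toHomeomorph.secondCountableTopology
  have i2 : LocallyCompactSpace V := Φ.toHomeomorph.isClosedEmbedding.locallyCompactSpace
  have i3 : TotallyDisconnectedSpace V := Φ.symm.toHomeomorph.totallyDisconnectedSpace
  have hcoe : ∀ f : V → V, Continuous f → ∀ g h : GL (Fin n) F,
      ‖(Matrix.GeneralLinearGroup.det g : F)‖ = 1 →
      ‖(Matrix.GeneralLinearGroup.det h : F)‖ = 1 →
      (∀ z, f (Φ.symm z) = Φ.symm (twoSided g h z)) → (M.map Φ.symm).map f = M.map Φ.symm := by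
    intro f hf g h hg hh hfz
    rw [Measure.map_map hf.measurable Φ.symm.continuous.measurable]
    have : f ∘ Φ.symm = Φ.symm ∘ twoSided g h := funext hfz
    rw [this, ← Measure.map_map Φ.symm.continuous.measurable (twoSided g h).continuous.measurable,
      hM g h hg hh]
  constructor <;> by_contra hne
  · obtain ⟨a, ha⟩ := exists_trace_mul_ne_zero hne
    -- The flow of `T` is left multiplication by `1 + s a`, whose determinant has norm one for small
    -- `s`. The annihilator condition reads `tr(a x y) = 0`, and `a` was chosen to violate it.
    let T : V →L[F] V :=
      { toFun := fun z => Φ.symm (a * Φ z)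
        map_add' := fun z z' => by rw [map_add, Matrix.mul_add, map_add]
        map_smul' := fun c z => by rw [map_smul, Matrix.mul_smul, map_smul, RingHom.id_apply]
        cont := by
          have h1 := Φ.continuous
          exact Φ.symm.continuous.comp (by fun_prop) }
    obtain ⟨ε, hε, hdet⟩ := exists_norm_det_one_add_smul a
    refine notMem_waveFrontSet_of_invariant Λ χ hμ T hε (fun s hs => ?_) ?_ hxy
    · have hd := hdet s hs
      set g := Matrix.GeneralLinearGroup.mkOfDetNeZero (1 + s • a)
        (norm_pos_iff.1 (by rw [hd]; exact one_pos)) with hg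
      refine hcoe _ (by fun_prop) g⁻¹ 1 ?_ (by simp) fun z => ?_
      · rw [map_inv, Units.val_inv_eq_inv_val, norm_inv]
        change ‖(1 + s • a).det‖⁻¹ = 1
        rw [hd, inv_one]
      · rw [twoSided_apply, inv_inv]
        change Φ.symm z + s • Φ.symm (a * Φ (Φ.symm z)) = Φ.symm ((1 + s • a) * z * 1)
        rw [Φ.apply_symm_apply, ← map_smul, ← map_add, Matrix.mul_one, Matrix.add_mul,
          Matrix.one_mul, Matrix.smul_mul]
    · rw [traceForm_apply]
      change (Φ (Φ.symm (a * Φ x)) * y).trace ≠ 0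
      rwa [Φ.apply_symm_apply, Matrix.mul_assoc]
  · obtain ⟨a, ha⟩ := exists_trace_mul_ne_zero hne
    -- Right multiplication tests `tr(x a y) = tr(a y x)`.
    let T : V →L[F] V :=
      { toFun := fun z => Φ.symm (Φ z * a)
        map_add' := fun z z' => by rw [map_add, Matrix.add_mul, map_add]
        map_smul' := fun c z => by rw [map_smul, Matrix.smul_mul, map_smul, RingHom.id_apply]
        cont := by
          have h1 := Φ.continuous
          exact Φ.symm.continuous.comp (by fun_prop) }
    obtain ⟨ε, hε, hdet⟩ := exists_norm_det_one_add_smul a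
    refine notMem_waveFrontSet_of_invariant Λ χ hμ T hε (fun s hs => ?_) ?_ hxy
    · have hd := hdet s hs
      set g := Matrix.GeneralLinearGroup.mkOfDetNeZero (1 + s • a)
        (norm_pos_iff.1 (by rw [hd]; exact one_pos)) with hg
      refine hcoe _ (by fun_prop) 1 g (by simp) hd fun z => ?_
      rw [twoSided_apply, inv_one]
      change Φ.symm z + s • Φ.symm (Φ (Φ.symm z) * a) = Φ.symm (1 * z * (1 + s • a))
      rw [Φ.apply_symm_apply, ← map_smul, ← map_add, Matrix.one_mul, Matrix.mul_add,
        Matrix.mul_one, Matrix.mul_smul]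
    · rw [traceForm_apply]
      change (Φ (Φ.symm (Φ x * a)) * y).trace ≠ 0
      rwa [Φ.apply_symm_apply, Matrix.mul_assoc, Matrix.trace_mul_comm, Matrix.mul_assoc]

/-- The matrices of rank greater than `k` form an open null set, and no wave front lies over such a
set. -/
lemma rank_le_of_mem_waveFrontSet {k : ℕ} (hM : M {z | z.rank ≠ k} = 0)
    (hμ : IsFiniteMeasureOnCompacts (M.map Φ.symm)) {x : V} {ξ : StrongDual F V}
    (hxy : (x, ξ) ∈ waveFrontSet Λ χ (BruhatDistribution.ofMeasure (M.map Φ.symm) hμ)) :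
    (Φ x).rank ≤ k := by
  have i2 : LocallyCompactSpace V := Φ.toHomeomorph.isClosedEmbedding.locallyCompactSpace
  have i3 : TotallyDisconnectedSpace V := Φ.symm.toHomeomorph.totallyDisconnectedSpace
  by_contra hlt
  have ho : IsOpen (Φ ⁻¹' {z | k + 1 ≤ z.rank}) :=
    (isOpen_le_matrix_rank (k + 1)).preimage Φ.continuous
  refine notMem_waveFrontSet_of_measure_eq_zero Λ χ hμ ho ?_ (x := x) (Nat.lt_of_not_le hlt) ξ hxy
  rw [Measure.map_apply Φ.symm.continuous.measurable ho.measurableSet]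
  refine measure_mono_null (fun z hz => ?_) hM
  have : k + 1 ≤ (Φ (Φ.symm z)).rank := hz
  rw [Φ.apply_symm_apply] at this
  exact (Nat.lt_of_succ_le this).ne'

/-- The compact open neighbourhood of `x` given by the unit box. -/
lemma isClopen_preimage_box (x : V) :
    IsClopen {z : V | Φ z - Φ x ∈ (boxMatrices 1 : Set (Matrix (Fin n) (Fin n) F))} :=
  (isClopen_boxMatrices one_pos).preimage (Φ.continuous.sub continuous_const)

lemma isCompact_preimage_box (x : V) :
    IsCompact {z : V | Φ z - Φ x ∈ (boxMatrices 1 : Set (Matrix (Fin n) (Fin n) F))} :=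
  (Φ.toHomeomorph.trans (Homeomorph.subRight (Φ x))).isCompact_preimage.2 (isCompact_boxMatrices 1)

/-- Vanishing of the local Fourier transforms at all far multiples of matrices near `y` excludes
`(x, y)` from the wave front set. -/
lemma notMem_waveFrontSet_of_setIntegral_eq_zero (hμ : IsFiniteMeasureOnCompacts (M.map Φ.symm))
    {x : V} {y : Matrix (Fin n) (Fin n) F} {N : Set (Matrix (Fin n) (Fin n) F)} (hN : N ∈ nhds y)
    {R : ℝ} (h : ∀ t : F, R ≤ ‖t‖ → ∀ y' ∈ N,
      ∫ z in {z | z - Φ x ∈ boxMatrices 1}, chi χ (-(z * (t • y')).trace) ∂M = 0) :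
    (x, traceForm Φ y) ∉ waveFrontSet Λ χ (BruhatDistribution.ofMeasure (M.map Φ.symm) hμ) := by
  refine notMem_waveFrontSet Λ χ
    (φ := indicatorTest (isClopen_preimage_box Φ x) (isCompact_preimage_box Φ x))
    (N := covMatrix Φ ⁻¹' N) (R := R) ?_ ?_ fun t ht η hη => ?_
  · rw [indicatorTest_apply, Set.indicator_of_mem]
    · exact one_ne_zero
    · change Φ x - Φ x ∈ boxMatrices 1
      rw [sub_self]
      exact (boxSubgroup F n 1 zero_le_one).zero_mem
  · exact (continuous_covMatrix Φ).continuousAt.preimage_mem_nhds (by rwa [covMatrix_traceForm])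
  · rw [fourierCutoff_indicatorTest, setIntegral_map_symm, ← h t ht _ hη]
    have e1 : (Φ.symm ⁻¹' {z : V | Φ z - Φ x ∈ boxMatrices 1}) =
        {z | z - Φ x ∈ boxMatrices 1} := by
      ext z
      simp
    rw [e1]
    congr 1
    ext z
    rw [← traceForm_covMatrix Φ η, covMatrix_traceForm, smul_apply,
      traceForm_apply, Φ.apply_symm_apply, Matrix.mul_smul, Matrix.trace_smul]

/-- For each unit vector `p` the box condition is `‖q‖ ≤ 1`, and `q ↦ χ(q · y p)` is a nontrivial
character on that ball. -/
lemma setIntegral_rankOneMeasure_box_eq_zero {y : Matrix (Fin n) (Fin n) F}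
    (h : ∀ p : Fin n → F, ‖p‖ = 1 → 1 < ‖y.mulVec p‖) :
    ∫ z in boxMatrices 1, chi χ (z * y).trace ∂rankOneMeasure F (Fin n) = 0 := by
  have hMo : IsClopen (boxMatrices 1 : Set (Matrix (Fin n) (Fin n) F)) :=
    isClopen_boxMatrices one_pos
  have hlc : IsLocallyConstant fun z : Matrix (Fin n) (Fin n) F => chi χ (z * y).trace := by
    have hct : Continuous fun z : Matrix (Fin n) (Fin n) F => (z * y).trace := by fun_prop
    exact (χ.isLocallyConstant.comp_continuous hct).comp (fun z : Circle => (z : ℂ))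
  set G := (boxMatrices 1 : Set (Matrix (Fin n) (Fin n) F)).indicator
    fun z => chi χ (z * y).trace with hG
  have hGlc : IsLocallyConstant G := isLocallyConstant_indicator hMo hlc
  have hGi : Integrable G (rankOneMeasure F (Fin n)) :=
    hGlc.continuous.integrable_of_hasCompactSupport
      (hasCompactSupport_indicator (isCompact_boxMatrices 1) _)
  have hGi' : Integrable ((unitPairs F (Fin n)).indicator fun x => G (rankOne x))
      ((vecHaar F (Fin n)).prod (vecHaar F (Fin n))) := by
    rw [rankOneMeasure, integrable_map_measure hGlc.continuous.aestronglyMeasurable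
      continuous_rankOne.measurable.aemeasurable] at hGi
    exact (integrable_indicator_iff measurableSet_unitPairs).2 hGi
  rw [← integral_indicator hMo.isOpen.measurableSet, ← hG,
    integral_rankOneMeasure hGlc.continuous.stronglyMeasurable,
    ← integral_indicator measurableSet_unitPairs, integral_prod _ hGi']
  refine (integral_congr_ae (g := fun _ => 0) (.of_forall fun p => ?_)).trans (integral_zero _ _)
  simp only
  by_cases hp : ‖p‖ = 1
  · have e1 : ∀ q, (unitPairs F (Fin n)).indicator (fun x => G (rankOne x)) (p, q) =
        (Metric.closedBall (0 : Fin n → F) ‖((1 : Fˣ) : F)‖).indicator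
          (fun q => chi χ (q ⬝ᵥ y.mulVec p)) q := by
      intro q
      have hpq : (p, q) ∈ unitPairs F (Fin n) := hp
      have hiff := norm_le_of_rankOne_mem hpq zero_le_one
      rw [Set.indicator_of_mem hpq, hG, Units.val_one, norm_one]
      by_cases hq : ‖q‖ ≤ 1
      · rw [Set.indicator_of_mem (hiff.2 hq), Set.indicator_of_mem (mem_closedBall_zero_iff.2 hq),
          Matrix.trace_mul_comm, trace_mul_rankOne]
      · rw [Set.indicator_of_notMem (fun h => hq (hiff.1 h)),
          Set.indicator_of_notMem (fun h => hq (mem_closedBall_zero_iff.1 h))]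
    simp only [e1]
    rw [integral_indicator Metric.isClosed_closedBall.measurableSet, setIntegral_chi_ball, if_neg,
      mul_zero]
    rw [Units.val_one, norm_one, one_mul]
    exact not_le.2 (h p hp)
  · refine (integral_congr_ae (g := fun _ => 0) (.of_forall fun q => ?_)).trans (integral_zero _ _)
    exact Set.indicator_of_notMem (fun h : (p, q) ∈ unitPairs F (Fin n) => hp h) _

/-- An invertible `y` has no zero on the compact unit sphere. Compactness makes `‖t⁻¹‖ < ‖y' p‖`
uniform in `p` for `y'` near `y` and `t` large, so that `‖t y' p‖ > 1` and the local transform at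
zero vanishes. -/
lemma det_eq_zero_of_mem_waveFrontSet_rankOne
    (hμ : IsFiniteMeasureOnCompacts ((rankOneMeasure F (Fin n)).map Φ.symm)) {x : V}
    (hx : Φ x = 0) {y : Matrix (Fin n) (Fin n) F}
    (hxy : (x, traceForm Φ y) ∈ waveFrontSet Λ χ (BruhatDistribution.ofMeasure _ hμ)) :
    y.det = 0 := by
  by_contra hdet
  have hS : IsCompact (Metric.sphere (0 : Fin n → F) 1) := isCompact_sphere _ _
  have hne : ∀ p ∈ Metric.sphere (0 : Fin n → F) 1, y.mulVec p ≠ 0 := by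
    intro p hp h0
    refine hdet (Matrix.exists_mulVec_eq_zero_iff.1 ⟨p, fun h => ?_, h0⟩)
    rw [h] at hp
    simp at hp
  have hcont : Continuous fun z : (Matrix (Fin n) (Fin n) F × F) × (Fin n → F) =>
      ‖z.1.1.mulVec z.2‖ := by fun_prop
  have hev : ∀ᶠ w in nhds (y, (0 : F)), ∀ p ∈ Metric.sphere (0 : Fin n → F) 1,
      ‖w.2‖ < ‖w.1.mulVec p‖ := by
    refine hS.eventually_forall_of_forall_eventually
      (P := fun (w : Matrix (Fin n) (Fin n) F × F) (p : Fin n → F) => ‖w.2‖ < ‖w.1.mulVec p‖)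
      fun p hp => ?_
    refine (isOpen_lt (by fun_prop : Continuous fun z : (Matrix (Fin n) (Fin n) F × F) ×
      (Fin n → F) => ‖z.1.2‖) hcont).mem_nhds ?_
    change ‖(0 : F)‖ < ‖y.mulVec p‖
    rw [norm_zero]
    exact norm_pos_iff.2 (hne p hp)
  obtain ⟨N, hN, U, hU, hNU⟩ := mem_nhds_prod_iff.1 hev
  obtain ⟨δ, hδ, hδU⟩ := Metric.mem_nhds_iff.1 hU
  refine notMem_waveFrontSet_of_setIntegral_eq_zero χ Φ Λ hμ hN (R := δ⁻¹ + 1)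
    (fun t ht y' hy' => ?_) hxy
  have ht0 : 0 < ‖t‖ := lt_of_lt_of_le (by positivity) ht
  have htδ : t⁻¹ ∈ U := by
    refine hδU (mem_ball_zero_iff.2 ?_)
    rw [norm_inv, inv_lt_comm₀ ht0 hδ]
    linarith
  have h1 : ∀ p : Fin n → F, ‖p‖ = 1 → 1 < ‖(-(t • y')).mulVec p‖ := by
    intro p hp
    have h2 := hNU (Set.mk_mem_prod hy' htδ) p (mem_sphere_zero_iff_norm.2 hp)
    simp only [norm_inv] at h2
    rw [Matrix.neg_mulVec, norm_neg, Matrix.smul_mulVec, norm_smul]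
    rwa [inv_lt_iff_one_lt_mul₀' ht0] at h2
  have h3 := setIntegral_rankOneMeasure_box_eq_zero χ h1
  rw [hx]
  simp only [sub_zero, Matrix.mul_neg, Matrix.trace_neg] at h3 ⊢
  exact h3

/-- By duality the local transform at `t y'` is an integral of the rank one measure over `t y'` plus
the unit box. If `y` had rank at least two, then by openness of that condition and compactness of
the box so would every `y' + t⁻¹ b` for large `t`, leaving no mass in the domain. -/
lemma rank_le_one_of_mem_waveFrontSet_corankOne (hn : n ≠ 0)
    (hμ : IsFiniteMeasureOnCompacts ((corankOneMeasure F n).map Φ.symm)) {x : V}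
    {y : Matrix (Fin n) (Fin n) F}
    (hxy : (x, traceForm Φ y) ∈ waveFrontSet Λ χ (BruhatDistribution.ofMeasure _ hμ)) :
    y.rank ≤ 1 := by
  by_contra hlt
  have hev : ∀ᶠ w in nhds (y, (0 : F)), ∀ b ∈ (boxMatrices 1 : Set (Matrix (Fin n) (Fin n) F)),
      2 ≤ (w.1 + w.2 • b).rank := by
    refine (isCompact_boxMatrices 1).eventually_forall_of_forall_eventually
      (P := fun (w : Matrix (Fin n) (Fin n) F × F) (b : Matrix (Fin n) (Fin n) F) =>
        2 ≤ (w.1 + w.2 • b).rank) fun b hb => ?_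
    refine ((isOpen_le_matrix_rank 2).preimage (by fun_prop : Continuous fun z :
      (Matrix (Fin n) (Fin n) F × F) × Matrix (Fin n) (Fin n) F =>
        z.1.1 + z.1.2 • z.2)).mem_nhds ?_
    rw [Set.mem_preimage, zero_smul, add_zero]
    exact Nat.lt_of_not_le hlt
  obtain ⟨N, hN, U, hU, hNU⟩ := mem_nhds_prod_iff.1 hev
  obtain ⟨δ, hδ, hδU⟩ := Metric.mem_nhds_iff.1 hU
  refine notMem_waveFrontSet_of_setIntegral_eq_zero χ Φ Λ hμ hN (R := δ⁻¹ + 1)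
    (fun t ht y' hy' => ?_) hxy
  have ht0 : 0 < ‖t‖ := lt_of_lt_of_le (by positivity) ht
  have ht1 : t ≠ 0 := norm_pos_iff.1 ht0
  have htδ : t⁻¹ ∈ U := by
    refine hδU (mem_ball_zero_iff.2 ?_)
    rw [norm_inv, inv_lt_comm₀ ht0 hδ]
    linarith
  obtain ⟨c, -, hc⟩ := setIntegral_corankOneMeasure χ 1 1 (Φ x) (t • y')
  have e1 : ∀ z : Matrix (Fin n) (Fin n) F, twoSided 1 1 z = z := fun z => by
    rw [twoSided_apply, inv_one, Units.val_one, Matrix.one_mul, Matrix.mul_one]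
  simp only [e1] at hc
  rw [hc, setIntegral_measure_zero, mul_zero]
  refine measure_mono_null (fun w hw => ?_) (rankOneMeasure_rank_ne (F := F) hn)
  have h2 : 2 ≤ (y' + t⁻¹ • (w - t • y')).rank := hNU (Set.mk_mem_prod hy' htδ) _ hw
  rw [smul_sub, smul_smul, inv_mul_cancel₀ ht1, one_smul, add_sub_cancel] at h2
  have h3 : t⁻¹ • w = (t⁻¹ • (1 : Matrix (Fin n) (Fin n) F)) * w := by
    rw [Matrix.smul_mul, Matrix.one_mul]
  rw [h3] at h2
  have h4 := h2.trans (Matrix.rank_mul_le_right _ _)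
  change w.rank ≠ 1
  omega

end OrbitalMeasure
end

/-! ### Lower bounds and the exact wave front sets on matrices -/

noncomputable section

namespace OrbitalMeasure

set_option linter.unusedSectionVars false

variable {F : Type*} [NontriviallyNormedField F] [IsUltrametricDist F] [ProperSpace F]
  [MeasurableSpace F] [BorelSpace F] {n : ℕ} (χ : UnramifiedCharacter F)

/-- Scalar matrices as elements of the general linear group. -/
def scalarGL (F : Type*) [NontriviallyNormedField F] (n : ℕ) (s : Fˣ) : GL (Fin n) F :=
  Units.map (algebraMap F (Matrix (Fin n) (Fin n) F)).toMonoidHom s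

lemma coe_scalarGL (s : Fˣ) : (scalarGL F n s : Matrix (Fin n) (Fin n) F) = (s : F) • 1 :=
  Algebra.algebraMap_eq_smul_one _

lemma scalarGL_inv (s : Fˣ) : (scalarGL F n s)⁻¹ = scalarGL F n s⁻¹ :=
  (map_inv (Units.map (algebraMap F (Matrix (Fin n) (Fin n) F)).toMonoidHom) s).symm

lemma twoSided_scalarGL_left (s : Fˣ) (g h : GL (Fin n) F) (z : Matrix (Fin n) (Fin n) F) :
    twoSided (scalarGL F n s * g) h z = ((s⁻¹ : Fˣ) : F) • twoSided g h z := by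
  rw [twoSided_apply, twoSided_apply, mul_inv_rev, scalarGL_inv, Units.val_mul, coe_scalarGL,
    Matrix.mul_smul, Matrix.mul_one, Matrix.smul_mul, Matrix.smul_mul]

lemma twoSided_scalarGL_right (s : Fˣ) (g h : GL (Fin n) F) (z : Matrix (Fin n) (Fin n) F) :
    twoSided g (scalarGL F n s * h) z = (s : F) • twoSided g h z := by
  rw [twoSided_apply, twoSided_apply, Units.val_mul, coe_scalarGL, Matrix.smul_mul,
    Matrix.one_mul, Matrix.mul_smul]

lemma twoSided_sub (g h : GL (Fin n) F) (z w : Matrix (Fin n) (Fin n) F) :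
    twoSided g h (z - w) = twoSided g h z - twoSided g h w := by
  rw [twoSided_apply, twoSided_apply, twoSided_apply, Matrix.mul_sub, Matrix.sub_mul]

lemma twoSided_smul (g h : GL (Fin n) F) (c : F) (z : Matrix (Fin n) (Fin n) F) :
    twoSided g h (c • z) = c • twoSided g h z := by
  rw [twoSided_apply, twoSided_apply, Matrix.mul_smul, Matrix.smul_mul]

variable {V : Type*} [NormedAddCommGroup V] [NormedSpace F V] [MeasurableSpace V] [BorelSpace V]
  (Φ : V ≃L[F] Matrix (Fin n) (Fin n) F) (Λ : Subgroup Fˣ) {M : Measure (Matrix (Fin n) (Fin n) F)}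
  {ϖ : Fˣ}

/-- Non-vanishing of the Fourier transforms of the restrictions of the measure to the boxes around
`x` in the coordinates given by `g`, `h`. -/
lemma mem_waveFrontSet_of_setIntegral_box_ne_zero (hϖΛ : ϖ ∈ Λ) (hϖ : ‖(ϖ : F)‖ < 1)
    (hμ : IsFiniteMeasureOnCompacts (M.map Φ.symm)) (g h : GL (Fin n) F) {x : V}
    {y : Matrix (Fin n) (Fin n) F} (hy : y ≠ 0)
    (hne : ∀ s : Fˣ, ‖(s : F)‖ < 1 → ∃ R : ℝ, ∀ t : Fˣ, R ≤ ‖(t : F)‖ →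
      ∫ z in {z | ((s⁻¹ : Fˣ) : F) • twoSided g h (z - Φ x) ∈ boxMatrices 1},
        chi χ (-(z * ((t : F) • y)).trace) ∂M ≠ 0) :
    (x, traceForm Φ y) ∈ waveFrontSet Λ χ (BruhatDistribution.ofMeasure (M.map Φ.symm) hμ) := by
  have i1 : SecondCountableTopology V := Φ.toHomeomorph.secondCountableTopology
  have i2 : LocallyCompactSpace V := Φ.toHomeomorph.isClosedEmbedding.locallyCompactSpace
  set B : Set (Matrix (Fin n) (Fin n) F) := boxMatrices 1 with hB
  have hBc : IsCompact B := isCompact_boxMatrices 1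
  set ρ := (matHaar F (Fin n)).restrict B with hρ
  have hρf : IsFiniteMeasure ρ := ⟨by
    rw [hρ, Measure.restrict_apply_univ]; exact hBc.measure_lt_top⟩
  -- The covectors `k a` are the functionals `z ↦ tr(a · twoSided g h (Φ z))`. Averaged over integer
  -- matrices `a`, their characters give exactly the indicator of the box in the coordinates `(g,
  -- h)`, whence `κ = 1`.
  set k : Matrix (Fin n) (Fin n) F → StrongDual F V :=
    fun a => traceForm Φ (twoSided h⁻¹ g⁻¹ a) with hk
  have hkc : Continuous k := (continuous_traceForm Φ).comp (twoSided h⁻¹ g⁻¹).continuous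
  have hkz : ∀ a z, k a z = (a * twoSided g h (Φ z)).trace := by
    intro a z
    have e : twoSided h g (twoSided h⁻¹ g⁻¹ a) = a := by
      simp only [twoSided_apply, inv_inv, Matrix.mul_assoc, Units.inv_mul, Matrix.mul_one]
      rw [← Matrix.mul_assoc, Units.inv_mul, Matrix.one_mul]
    rw [hk]
    simp only
    rw [traceForm_apply, ← trace_twoSided_mul g h, e, Matrix.trace_mul_comm]
  obtain ⟨R, hR⟩ := (hBc.image hkc).isBounded.exists_norm_le
  set L : Set V := {z | twoSided g h (Φ z) ∈ B} with hL
  have hLc : IsCompact L := (Φ.toHomeomorph.trans (twoSided g h)).isCompact_preimage.2 hBc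
  refine mem_waveFrontSet_of_integral_ne_zero Λ χ hμ hϖΛ hϖ ρ k ?_ (R := R) ?_ hLc.isClosed
    hLc.isBounded (κ := 1) one_ne_zero (fun z => ?_) (traceForm_ne_zero Φ hy) fun s hs => ?_
  · simp only [hkz]
    have h1 := Φ.continuous
    have h2 : Continuous fun p : Matrix (Fin n) (Fin n) F × V => twoSided g h (Φ p.2) :=
      (twoSided g h).continuous.comp (h1.comp continuous_snd)
    fun_prop
  · exact (ae_restrict_iff' hBc.measurableSet).2 (.of_forall fun a ha =>
      hR _ (Set.mem_image_of_mem _ ha))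
  · simp only [hkz]
    rw [hρ, hB, setIntegral_chi_trace_box]
    rfl
  · obtain ⟨R', hR'⟩ := hne s hs
    refine ⟨R', fun t ht => ?_⟩
    rw [setIntegral_map_symm]
    convert hR' t ht using 2
    · congr 1
      ext z
      change twoSided g h (Φ (((s⁻¹ : Fˣ) : F) • (Φ.symm z - x))) ∈ B ↔ _
      rw [map_smul, map_sub, Φ.apply_symm_apply, twoSided_smul]
      rfl
    · ext z
      rw [← map_smul, traceForm_apply, Φ.apply_symm_apply]

/-- In coordinates making `x` idempotent, every multiple of `y` annihilates `x` on both sides, so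
the integral over the box of size `s` is nonzero for all `t`; no threshold is needed. -/
lemma mem_waveFrontSet_rankOne_of_ne_zero (hϖΛ : ϖ ∈ Λ) (hϖ : ‖(ϖ : F)‖ < 1)
    (hμ : IsFiniteMeasureOnCompacts ((rankOneMeasure F (Fin n)).map Φ.symm)) {x : V}
    {y : Matrix (Fin n) (Fin n) F} (hx : Φ x ≠ 0) (hr : (Φ x).rank ≤ 1) (hy : y ≠ 0)
    (h1 : Φ x * y = 0) (h2 : y * Φ x = 0) :
    (x, traceForm Φ y) ∈ waveFrontSet Λ χ (BruhatDistribution.ofMeasure _ hμ) := by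
  obtain ⟨i₀, g, h, hgh⟩ := exists_twoSided_eq_single hx hr
  refine mem_waveFrontSet_of_setIntegral_box_ne_zero χ Φ Λ hϖΛ hϖ hμ g h hy
    fun s hs => ⟨0, fun t _ => ?_⟩
  have key := setIntegral_rankOneMeasure_ne_zero χ hgh (X := -((t : F) • y))
    (by rw [Matrix.mul_neg, Matrix.mul_smul, h1, smul_zero, neg_zero])
    (by rw [Matrix.neg_mul, Matrix.smul_mul, h2, smul_zero, neg_zero]) hs
  convert key using 2
  · congr 1
    ext z
    change _ ∈ boxMatrices 1 ↔ _ ∈ boxMatrices ‖(s : F)‖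
    rw [smul_mem_boxMatrices, inv_inv, mul_one, twoSided_sub, hgh]
  · ext z
    rw [Matrix.neg_mul, Matrix.trace_neg, Matrix.trace_mul_comm]

/-- Duality turns the box of size `s` around `x` into one of size `s⁻¹` around `t y`, with phase
`tr(x w)` because `x y = 0`. After division by `t` this is a small box around the rank one matrix
`y`. -/
lemma mem_waveFrontSet_corankOne (hϖΛ : ϖ ∈ Λ) (hϖ : ‖(ϖ : F)‖ < 1)
    (hμ : IsFiniteMeasureOnCompacts ((corankOneMeasure F n).map Φ.symm)) {x : V}
    {y : Matrix (Fin n) (Fin n) F} (hy : y ≠ 0) (hr : y.rank ≤ 1)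
    (h1 : Φ x * y = 0) (h2 : y * Φ x = 0) :
    (x, traceForm Φ y) ∈ waveFrontSet Λ χ (BruhatDistribution.ofMeasure _ hμ) := by
  obtain ⟨i₀, g, h, hgh⟩ := exists_twoSided_eq_single hy hr
  refine mem_waveFrontSet_of_setIntegral_box_ne_zero χ Φ Λ hϖΛ hϖ hμ h g hy
    -- The threshold ensures `‖s t‖ > 1`, so that the rescaled radius `‖(s t)⁻¹‖` is below one.
    fun s hs => ⟨‖(s : F)‖⁻¹ + 1, fun t ht => ?_⟩
  have hs0 : 0 < ‖(s : F)‖ := norm_pos_iff.2 s.ne_zero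
  have ht0 : 0 < ‖(t : F)‖ := norm_pos_iff.2 t.ne_zero
  have hst : ‖(((s * t)⁻¹ : Fˣ) : F)‖ < 1 := by
    rw [Units.val_inv_eq_inv_val, norm_inv, Units.val_mul, norm_mul]
    refine inv_lt_one_of_one_lt₀ ?_
    have : ‖(s : F)‖⁻¹ < ‖(t : F)‖ := by linarith
    rwa [inv_lt_iff_one_lt_mul₀' hs0] at this
  have hgt : twoSided (scalarGL F n t * g) h ((t : F) • y) = Matrix.single i₀ i₀ 1 := by
    rw [twoSided_scalarGL_left, twoSided_smul, smul_smul, ← Units.val_mul, inv_mul_cancel,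
      Units.val_one, one_smul, hgh]
  have key := setIntegral_rankOneMeasure_ne_zero χ hgt (X := Φ x)
    (by rw [Matrix.smul_mul, h2, smul_zero]) (by rw [Matrix.mul_smul, h1, smul_zero]) hst
  obtain ⟨c, hc, hFD⟩ := setIntegral_corankOneMeasure χ (scalarGL F n s * h) g (Φ x) ((t : F) • y)
  simp only [twoSided_scalarGL_left] at hFD
  rw [hFD]
  refine mul_ne_zero hc ?_
  convert key using 2
  · congr 1
    ext w
    change _ ∈ boxMatrices 1 ↔ _ ∈ boxMatrices _
    rw [twoSided_scalarGL_right, smul_mem_boxMatrices, mul_one, twoSided_sub, twoSided_smul, hgh,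
      twoSided_scalarGL_left, mul_inv, mul_comm s⁻¹, Units.val_mul, norm_mul]
    have e : twoSided g h w - (t : F) • Matrix.single i₀ i₀ 1 =
        (t : F) • (((t⁻¹ : Fˣ) : F) • twoSided g h w - Matrix.single i₀ i₀ 1) := by
      rw [smul_sub, smul_smul, ← Units.val_mul, mul_inv_cancel, Units.val_one, one_smul]
    rw [e, smul_mem_boxMatrices]
  · ext w
    rw [Matrix.mul_sub, Matrix.mul_smul, h1, smul_zero, sub_zero]

/-- With `p` in the right kernel and `q` in the left kernel of `y`, the matrices `s p ᵗq` with `s ≠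
0` fall under the previous case; letting `s` tend to zero and using closedness gives the point over
zero. -/
lemma mem_waveFrontSet_rankOne_of_eq_zero (hϖΛ : ϖ ∈ Λ) (hϖ : ‖(ϖ : F)‖ < 1)
    (hμ : IsFiniteMeasureOnCompacts ((rankOneMeasure F (Fin n)).map Φ.symm)) {x : V}
    {y : Matrix (Fin n) (Fin n) F} (hx : Φ x = 0) (hy : y ≠ 0) (hdet : y.det = 0) :
    (x, traceForm Φ y) ∈ waveFrontSet Λ χ (BruhatDistribution.ofMeasure _ hμ) := by
  obtain ⟨p, hp, hyp⟩ := Matrix.exists_mulVec_eq_zero_iff.2 hdet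
  obtain ⟨q, hq, hqy⟩ := Matrix.exists_vecMul_eq_zero_iff.2 hdet
  have hcont : Continuous fun s : F => (Φ.symm (s • Matrix.vecMulVec p q), traceForm Φ y) :=
    (Φ.symm.continuous.comp (continuous_id.smul continuous_const)).prodMk continuous_const
  have hlim := (hcont.tendsto 0).mono_left (nhdsWithin_le_nhds (s := {0}ᶜ))
  rw [zero_smul, map_zero, ← map_zero Φ.symm, ← hx, Φ.symm_apply_apply] at hlim
  refine mem_waveFrontSet_of_mem_closure Λ χ (traceForm_ne_zero Φ hy)
    (mem_closure_of_tendsto hlim ?_)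
  filter_upwards [self_mem_nhdsWithin] with s hs
  have hpq : Matrix.vecMulVec p q ≠ 0 := by
    obtain ⟨i, hi⟩ := Function.ne_iff.1 hp
    obtain ⟨j, hj⟩ := Function.ne_iff.1 hq
    intro h0
    have := congrFun (congrFun h0 i) j
    rw [Matrix.vecMulVec_apply] at this
    exact mul_ne_zero hi hj this
  refine mem_waveFrontSet_rankOne_of_ne_zero χ Φ Λ hϖΛ hϖ hμ ?_ ?_ hy ?_ ?_
  · rw [Φ.apply_symm_apply]
    exact smul_ne_zero hs hpq
  · rw [Φ.apply_symm_apply, ← Matrix.smul_vecMulVec]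
    exact Matrix.rank_vecMulVec_le _ _
  · rw [Φ.apply_symm_apply, Matrix.smul_mul, Matrix.vecMulVec_mul, hqy, Matrix.vecMulVec_zero,
      smul_zero]
  · rw [Φ.apply_symm_apply, Matrix.mul_smul, Matrix.mul_vecMulVec, hyp, Matrix.zero_vecMulVec,
      smul_zero]

lemma rank_le_sub_one_of_mul_eq_zero {x y : Matrix (Fin n) (Fin n) F} (hx : x ≠ 0)
    (h : x * y = 0) : y.rank ≤ n - 1 := by
  have h1 := Matrix.rank_add_rank_le_card_of_mul_eq_zero h
  rw [Fintype.card_fin] at h1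
  have h2 : x.rank ≠ 0 := fun h0 => hx (Matrix.eq_zero_of_rank_eq_zero h0)
  omega

/-- The wave front set of the orbital measure of the matrices of rank one. -/
theorem mem_waveFrontSet_rankOne_iff (hn : n ≠ 0) (hϖΛ : ϖ ∈ Λ) (hϖ : ‖(ϖ : F)‖ < 1)
    (hμ : IsFiniteMeasureOnCompacts ((rankOneMeasure F (Fin n)).map Φ.symm)) {x : V}
    {y : Matrix (Fin n) (Fin n) F} :
    (x, traceForm Φ y) ∈ waveFrontSet Λ χ (BruhatDistribution.ofMeasure _ hμ) ↔
      (Φ x).rank ≤ 1 ∧ y.rank ≤ n - 1 ∧ y ≠ 0 ∧ Φ x * y = 0 ∧ y * Φ x = 0 := by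
  constructor
  · intro h
    have hy : y ≠ 0 := fun h0 => h.1 (by rw [h0]; exact map_zero _)
    obtain ⟨h1, h2⟩ := mul_eq_zero_of_mem_waveFrontSet χ Φ Λ (fun g h hg hh => by
      rw [map_twoSided_rankOneMeasure, distribHaarChar_eq_one hg, distribHaarChar_eq_one hh,
        inv_one, mul_one, one_smul]) hμ h
    refine ⟨rank_le_of_mem_waveFrontSet χ Φ Λ (rankOneMeasure_rank_ne hn) hμ h, ?_, hy, h1, h2⟩
    -- Over zero the relation `x y = 0` carries no information, and singularity of `y` comes from
    -- the oscillation argument instead.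
    by_cases hx : Φ x = 0
    · obtain ⟨p, hp, hyp⟩ := Matrix.exists_vecMul_eq_zero_iff.2
        (det_eq_zero_of_mem_waveFrontSet_rankOne χ Φ Λ hμ hx h)
      refine rank_le_sub_one_of_mul_eq_zero (x := Matrix.vecMulVec p p) (fun h0 => hp ?_) ?_
      · rcases Matrix.vecMulVec_eq_zero.1 h0 with h | h <;> exact h
      · rw [Matrix.vecMulVec_mul, hyp, Matrix.vecMulVec_zero]
    · exact rank_le_sub_one_of_mul_eq_zero hx h1
  · rintro ⟨hr, hry, hy, h1, h2⟩
    by_cases hx : Φ x = 0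
    · refine mem_waveFrontSet_rankOne_of_eq_zero χ Φ Λ hϖΛ hϖ hμ hx hy ?_
      by_contra hdet
      have := Matrix.rank_of_det_ne_zero hdet
      rw [Fintype.card_fin] at this
      omega
    · exact mem_waveFrontSet_rankOne_of_ne_zero χ Φ Λ hϖΛ hϖ hμ hx hr hy h1 h2

/-- The wave front set of the orbital measure of the matrices of corank one. -/
theorem mem_waveFrontSet_corankOne_iff (hn : n ≠ 0) (hϖΛ : ϖ ∈ Λ) (hϖ : ‖(ϖ : F)‖ < 1)
    (hμ : IsFiniteMeasureOnCompacts ((corankOneMeasure F n).map Φ.symm)) {x : V}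
    {y : Matrix (Fin n) (Fin n) F} :
    (x, traceForm Φ y) ∈ waveFrontSet Λ χ (BruhatDistribution.ofMeasure _ hμ) ↔
      (Φ x).rank ≤ n - 1 ∧ y.rank ≤ 1 ∧ y ≠ 0 ∧ Φ x * y = 0 ∧ y * Φ x = 0 := by
  constructor
  · intro h
    have hy : y ≠ 0 := fun h0 => h.1 (by rw [h0]; exact map_zero _)
    obtain ⟨h1, h2⟩ := mul_eq_zero_of_mem_waveFrontSet χ Φ Λ (fun g h hg hh => by
      rw [map_twoSided_corankOneMeasure χ hn, distribHaarChar_eq_one hg,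
        distribHaarChar_eq_one hh, one_pow, inv_one, mul_one, one_smul]) hμ h
    exact ⟨rank_le_of_mem_waveFrontSet χ Φ Λ corankOneMeasure_rank_ne hμ h,
      rank_le_one_of_mem_waveFrontSet_corankOne χ Φ Λ hn hμ h, hy, h1, h2⟩
  · rintro ⟨-, hr, hy, h1, h2⟩
    exact mem_waveFrontSet_corankOne χ Φ Λ hϖΛ hϖ hμ hy hr h1 h2

/-- The wave front set of a measure is unchanged by nonzero scaling. -/
lemma waveFrontSet_smul_measure {μ ν : Measure V} {c : ℝ≥0} (hc : c ≠ 0) (hν : ν = c • μ)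
    (hμf : IsFiniteMeasureOnCompacts μ) (hνf : IsFiniteMeasureOnCompacts ν) :
    waveFrontSet Λ χ (BruhatDistribution.ofMeasure ν hνf) =
      waveFrontSet Λ χ (BruhatDistribution.ofMeasure μ hμf) := by
  have h : ∀ φ, tsupport (fourierCutoff χ (BruhatDistribution.ofMeasure ν hνf) φ) =
      tsupport (fourierCutoff χ (BruhatDistribution.ofMeasure μ hμf) φ) := by
    intro φ
    have e : fourierCutoff χ (BruhatDistribution.ofMeasure ν hνf) φ =
        fun ξ => ((c : ℝ) : ℂ) • fourierCutoff χ (BruhatDistribution.ofMeasure μ hμf) φ ξ := by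
      ext ξ
      rw [fourierCutoff_ofMeasure, fourierCutoff_ofMeasure, hν, integral_smul_nnreal_measure,
        NNReal.smul_def, Complex.real_smul, smul_eq_mul]
    rw [e, tsupport, tsupport]
    congr 1
    ext ξ
    rw [Function.mem_support, Function.mem_support, smul_ne_zero_iff]
    exact and_iff_right (by exact_mod_cast hc)
  ext p
  simp only [waveFrontSet, Set.mem_ofPred_eq, h]

end OrbitalMeasure
end

noncomputable section

namespace OrbitalMeasure

set_option linter.unusedSectionVars false

/-! ### Coordinates on a polarized symplectic space -/

variable {F : Type*} [NontriviallyNormedField F]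
  {W : Type*} [NormedAddCommGroup W] [NormedSpace F W] [FiniteDimensional F W]
  (P : PolarizedSymplectic F W) {n : ℕ} (b : Module.Basis (Fin n) F P.X)

/-- Coordinates: those of the `X`-component, and the pairings with the basis of `X`. -/
def coordMap : W →ₗ[F] (Fin n → F) × (Fin n → F) :=
  (b.equivFun.toLinearMap ∘ₗ P.X.projectionOnto P.Y P.isCompl).prod
    (LinearMap.pi fun j => P.form (b j))

lemma coordMap_fst (w : W) : (coordMap P b w).1 = b.equivFun (P.X.projectionOnto P.Y P.isCompl w) :=
  rfl

lemma coordMap_snd (w : W) (j : Fin n) : (coordMap P b w).2 j = P.form (b j) w := rfl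

lemma form_eq_of_mem_X {u : W} (hu : u ∈ P.X) (w : W) : P.form u w = P.form u (P.projY w) := by
  conv_lhs => rw [← P.projX_add_projY w]
  rw [map_add, P.isotropic_X _ hu _ (P.projX_mem w), zero_add]

lemma form_eq_of_mem_Y {u : W} (hu : u ∈ P.Y) (w : W) : P.form u w = P.form u (P.projX w) := by
  conv_lhs => rw [← P.projX_add_projY w]
  rw [map_add, P.isotropic_Y _ hu _ (P.projY_mem w), add_zero]

lemma form_swap (u v : W) : P.form u v = -P.form v u := (P.alt.neg_eq v u).symm

lemma eq_zero_of_mem_Y {v : W} (hv : v ∈ P.Y) (h : ∀ u ∈ P.X, P.form u v = 0) : v = 0 := by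
  refine P.nondegenerate.1 _ fun w => ?_
  rw [form_eq_of_mem_Y P hv, form_swap, h _ (P.projX_mem w), neg_zero]

lemma eq_zero_of_mem_X {v : W} (hv : v ∈ P.X) (h : ∀ u ∈ P.Y, P.form u v = 0) : v = 0 := by
  refine P.nondegenerate.1 _ fun w => ?_
  rw [form_eq_of_mem_X P hv, form_swap, h _ (P.projY_mem w), neg_zero]

lemma coordMap_fst_eq_zero {w : W} : (coordMap P b w).1 = 0 ↔ P.projX w = 0 := by
  rw [coordMap_fst, LinearEquiv.map_eq_zero_iff, ← Submodule.coe_eq_zero]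
  rfl

lemma forall_form_basis_eq_zero (f : P.X →ₗ[F] W) {w : W} (h : ∀ j, P.form (f (b j)) w = 0)
    (u : P.X) : P.form (f u) w = 0 := by
  have h0 : P.form.flip w ∘ₗ f = 0 := b.ext fun j => h j
  exact LinearMap.congr_fun h0 u

lemma coordMap_snd_eq_zero {w : W} : (coordMap P b w).2 = 0 ↔ P.projY w = 0 := by
  constructor
  · intro h
    refine eq_zero_of_mem_Y P (P.projY_mem w) fun u hu => ?_
    rw [← form_eq_of_mem_X P hu]
    exact forall_form_basis_eq_zero P b P.X.subtype (fun j => congrFun h j) ⟨u, hu⟩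
  · intro h
    ext j
    rw [coordMap_snd, form_eq_of_mem_X P (b j).2, h, map_zero, Pi.zero_apply]

lemma coordMap_injective : Function.Injective (coordMap P b) := by
  rw [← LinearMap.ker_eq_bot, LinearMap.ker_eq_bot']
  intro w hw
  rw [← P.projX_add_projY w, (coordMap_fst_eq_zero P b).1 (congrArg Prod.fst hw),
    (coordMap_snd_eq_zero P b).1 (congrArg Prod.snd hw), add_zero]

/-- Injectivity of the coordinates gives the upper bound. For the lower one, nondegeneracy embeds
`X` into the dual of `Y`, so `Y` has dimension at least `n`. -/
lemma finrank_eq_two_mul {F : Type*} [NontriviallyNormedField F]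
    {W : Type*} [NormedAddCommGroup W] [NormedSpace F W] [FiniteDimensional F W]
    (P : PolarizedSymplectic F W) {n : ℕ} (b : Module.Basis (Fin n) F P.X) :
    Module.finrank F W = n + n := by
  refine le_antisymm ?_ ?_
  · have := LinearMap.finrank_le_finrank_of_injective (coordMap_injective P b)
    simpa using this
  · have h1 : Module.finrank F P.X = n := by rw [Module.finrank_eq_card_basis b, Fintype.card_fin]
    have h2 := Submodule.finrank_add_eq_of_isCompl P.isCompl
    let f : P.X →ₗ[F] Module.Dual F P.Y := (P.Y.subtype.dualMap ∘ₗ P.form) ∘ₗ P.X.subtype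
    have hf : Function.Injective f := by
      rw [← LinearMap.ker_eq_bot, LinearMap.ker_eq_bot']
      intro u hu
      refine Subtype.ext (eq_zero_of_mem_X P u.2 fun v hv => ?_)
      rw [form_swap, neg_eq_zero]
      exact LinearMap.congr_fun hu ⟨v, hv⟩
    have h3 := LinearMap.finrank_le_finrank_of_injective hf
    rw [Subspace.dual_finrank_eq] at h3
    omega

lemma basis_card_ne_zero {F : Type*} [NontriviallyNormedField F]
    {W : Type*} [NormedAddCommGroup W] [NormedSpace F W] [FiniteDimensional F W] [Nontrivial W]
    (P : PolarizedSymplectic F W) {n : ℕ} (b : Module.Basis (Fin n) F P.X) : n ≠ 0 := fun h => by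
  have h1 := finrank_eq_two_mul P b
  have h2 := Module.finrank_pos (R := F) (M := W)
  omega

lemma coordMap_torusAct (a : Fˣ) (w : W) :
    coordMap P b (P.torusAct a w) = pairAct a (coordMap P b w) := by
  refine Prod.ext ?_ ?_
  · rw [coordMap_fst, pairAct, coordMap_fst]
    have : P.X.projectionOnto P.Y P.isCompl (P.torusAct a w) =
        (a : F) • P.X.projectionOnto P.Y P.isCompl w := Subtype.ext (P.projX_torusAct a w)
    rw [this, map_smul]
  · ext j
    change P.form (b j) (P.torusAct a w) = ((a⁻¹ : Fˣ) : F) • P.form (b j) w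
    rw [form_eq_of_mem_X P (b j).2,
      P.projY_torusAct, Units.smul_def, map_smul, ← form_eq_of_mem_X P (b j).2]

variable [IsUltrametricDist F] [ProperSpace F] [MeasurableSpace F] [BorelSpace F]

/-- The coordinates as an equivalence. -/
def coordEquiv : W ≃L[F] (Fin n → F) × (Fin n → F) :=
  (LinearEquiv.ofInjectiveOfFinrankEq (coordMap P b) (coordMap_injective P b)
    (by rw [finrank_eq_two_mul P b]; simp)).toContinuousLinearEquiv

lemma coordEquiv_apply (w : W) : coordEquiv P b w = coordMap P b w := rfl

/-- Matrices of endomorphisms of `X`. -/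
def matEquiv : P.EndX ≃L[F] Matrix (Fin n) (Fin n) F :=
  ((LinearMap.toContinuousLinearMap (E := P.X) (F' := P.X) (𝕜 := F)).symm.trans
    (LinearMap.toMatrix b b)).toContinuousLinearEquiv

lemma matEquiv_apply (x : P.EndX) :
    matEquiv P b x = LinearMap.toMatrix b b (x : P.X →ₗ[F] P.X) := rfl

lemma matEquiv_mul (x y : P.EndX) : matEquiv P b (x * y) = matEquiv P b x * matEquiv P b y := by
  rw [matEquiv_apply, matEquiv_apply, matEquiv_apply, ← LinearMap.toMatrix_mul]
  rfl

lemma matEquiv_mul_eq_zero (x y : P.EndX) : matEquiv P b x * matEquiv P b y = 0 ↔ x * y = 0 := by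
  rw [← matEquiv_mul, map_eq_zero_iff _ (matEquiv P b).injective]

lemma rank_matEquiv (x : P.EndX) : (matEquiv P b x).rank = P.rank x := by
  rw [Matrix.rank_eq_finrank_range_toLin _ b b, matEquiv_apply, Matrix.toLin_toMatrix]
  rfl

lemma traceCovector_eq (y : P.EndX) :
    P.traceCovector y = traceForm (matEquiv P b) (matEquiv P b y) := by
  ext e
  rw [traceForm_apply, ← matEquiv_mul]
  exact LinearMap.trace_eq_matrix_trace F b _

lemma matEquiv_mulVec (x : P.EndX) (w : W) : (matEquiv P b x).mulVec (coordMap P b w).1 =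
    b.equivFun (x (P.X.projectionOnto P.Y P.isCompl w)) := by
  rw [coordMap_fst, matEquiv_apply]
  exact LinearMap.toMatrix_mulVec_repr b b _ _

lemma form_eq_dotProduct (u : P.X) (w : W) :
    P.form u w = (coordMap P b w).2 ⬝ᵥ b.equivFun u := by
  have h : (P.form.flip w ∘ₗ P.X.subtype) u = _ :=
    congrArg (P.form.flip w ∘ₗ P.X.subtype) (b.sum_equivFun u).symm
  rw [map_sum] at h
  refine h.trans (Finset.sum_congr rfl fun j _ => ?_)
  rw [map_smul, smul_eq_mul, mul_comm]
  rfl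

lemma projX_toSp (x : P.EndX) (w : W) :
    P.projX (P.toSp x w) = x (P.X.projectionOnto P.Y P.isCompl w) := by
  conv_lhs => rw [← P.projX_add_projY w]
  have h1 := P.toSp_apply_X x (P.X.projectionOnto P.Y P.isCompl w)
  have h2 := P.toSp_mem_Y x (P.Y.projectionOnto P.X P.isCompl.symm w)
  rw [Submodule.coe_projectionOnto_apply] at h1 h2
  rw [map_add, map_add, PolarizedSymplectic.projX, h1]
  have h3 : P.X.projection P.Y P.isCompl (P.toSp x (P.projY w)) = 0 := by
    rw [← Submodule.coe_projectionOnto_apply,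
      (Submodule.projectionOnto_apply_eq_zero_iff P.isCompl).2 h2]
    rfl
  rw [h3, add_zero, ← Submodule.coe_projectionOnto_apply, Submodule.projectionOnto_apply_left]

lemma form_apply_eq (x : P.EndX) (w : W) :
    P.form (x (P.X.projectionOnto P.Y P.isCompl w)) w =
      (matEquiv P b x * rankOne (coordMap P b w)).trace := by
  rw [form_eq_dotProduct P b, trace_mul_rankOne, matEquiv_mulVec]

/-- The moment map in coordinates. -/
lemma form_toSp_self (x : P.EndX) (w : W) : P.form (P.toSp x w) w =
    (matEquiv P b x * ((2 : F) • rankOne (coordMap P b w))).trace := by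
  rw [Matrix.mul_smul, Matrix.trace_smul, ← form_apply_eq]
  have h1 := P.form_toSp x (P.projX w) w
  have h2 : P.toSp x (P.projX w) = x (P.X.projectionOnto P.Y P.isCompl w) := by
    have := P.toSp_apply_X x (P.X.projectionOnto P.Y P.isCompl w)
    rwa [Submodule.coe_projectionOnto_apply] at this
  -- The two components contribute equally, since `toSp x` is skew for the form; this is the source
  -- of the factor `2`.
  have h3 : P.form (P.toSp x w) w = P.form (P.projX (P.toSp x w)) w +
      P.form (P.projY (P.toSp x w)) w := by
    rw [← LinearMap.add_apply, ← map_add, P.projX_add_projY]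
  have h4 : P.form (P.projY (P.toSp x w)) w = -P.form (P.projX w) (P.toSp x w) := by
    rw [form_eq_of_mem_Y P (P.projY_mem _), form_swap, ← form_eq_of_mem_X P (P.projX_mem w)]
  rw [h2] at h1
  rw [h3, h4, projX_toSp, smul_eq_mul]
  linear_combination -h1

lemma momentMap_eq (w : W) : P.momentMap w =
    traceForm (matEquiv P b) ((2 : F) • rankOne (coordMap P b w)) := by
  ext x
  exact form_toSp_self P b x w

/-- By skewness `toSp x` acts on coordinates by `p ↦ x p` and `q ↦ -ᵗx q`; the two conditions are
the vanishing of its components. -/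
lemma toSp_eq_zero_iff (x : P.EndX) (w : W) : P.toSp x w = 0 ↔
    (matEquiv P b x).mulVec (coordMap P b w).1 = 0 ∧
      Matrix.vecMul (coordMap P b w).2 (matEquiv P b x) = 0 := by
  have hX : (matEquiv P b x).mulVec (coordMap P b w).1 = 0 ↔ P.projX (P.toSp x w) = 0 := by
    rw [matEquiv_mulVec, projX_toSp, LinearEquiv.map_eq_zero_iff, Submodule.coe_eq_zero]
  have hY : Matrix.vecMul (coordMap P b w).2 (matEquiv P b x) = 0 ↔ P.projY (P.toSp x w) = 0 := by
    rw [← coordMap_snd_eq_zero P b]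
    have : ∀ j, Matrix.vecMul (coordMap P b w).2 (matEquiv P b x) j =
        -(coordMap P b (P.toSp x w)).2 j := by
      intro j
      rw [coordMap_snd]
      have h1 := P.form_toSp x (b j) w
      rw [P.toSp_apply_X, form_eq_dotProduct P b] at h1
      have h2 : b.equivFun (x (b j)) = fun i => matEquiv P b x i j := by
        ext i
        rw [matEquiv_apply, LinearMap.toMatrix_apply]
        rfl
      rw [h2] at h1
      exact eq_neg_of_add_eq_zero_left h1
    constructor
    · intro h
      ext j
      have := this j
      rw [h, Pi.zero_apply] at this
      rw [Pi.zero_apply]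
      exact neg_eq_zero.1 this.symm
    · intro h
      ext j
      rw [this, h, Pi.zero_apply, neg_zero]
  rw [hX, hY]
  constructor
  · intro h
    rw [h, map_zero, map_zero]
    exact ⟨rfl, rfl⟩
  · rintro ⟨h1, h2⟩
    rw [← P.projX_add_projY (P.toSp x w), h1, h2, add_zero]

end OrbitalMeasure
end

noncomputable section

namespace OrbitalMeasure

set_option linter.unusedSectionVars false

/-! ### The quotient measure -/

variable {F : Type*} [NontriviallyNormedField F]
  {W : Type*} [NormedAddCommGroup W] [NormedSpace F W] [FiniteDimensional F W]
  (P : PolarizedSymplectic F W) {n : ℕ} (b : Module.Basis (Fin n) F P.X)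
  [IsUltrametricDist F] [ProperSpace F] [MeasurableSpace F] [BorelSpace F]
  [MeasurableSpace W] [BorelSpace W] (dw : Measure W) [dw.IsAddHaarMeasure]
  (da : Measure Fˣ) [da.IsHaarMeasure]

lemma continuous_coordMap : Continuous (coordMap P b) := (coordEquiv P b).continuous

lemma exists_map_coordEquiv : ∃ k : ℝ≥0, k ≠ 0 ∧
    dw.map (coordEquiv P b) = k • (vecHaar F (Fin n)).prod (vecHaar F (Fin n)) := by
  have h : (dw.map (coordEquiv P b)).IsAddHaarMeasure :=
    (coordEquiv P b).isAddHaarMeasure_map dw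
  have h' : ((vecHaar F (Fin n)).prod (vecHaar F (Fin n))).IsAddHaarMeasure :=
    Measure.prod.instIsAddHaarMeasure _ _
  exact ⟨_, (Measure.addHaarScalarFactor_pos_of_isAddHaarMeasure _ _).ne',
    Measure.isAddLeftInvariant_eq_smul _ _⟩

lemma mem_regularSet_iff {w : W} :
    w ∈ P.regularSet ↔ (coordMap P b w).1 ≠ 0 ∧ (coordMap P b w).2 ≠ 0 := by
  rw [Ne, Ne, coordMap_fst_eq_zero, coordMap_snd_eq_zero]
  rfl

lemma measurableSet_regularSet : MeasurableSet P.regularSet := by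
  have b := Module.finBasis F P.X
  have h : P.regularSet = coordMap P b ⁻¹' ({x | x.1 ≠ 0} ∩ {x | x.2 ≠ 0}) := by
    ext w
    exact mem_regularSet_iff P b
  rw [h]
  exact (((isOpen_ne.preimage continuous_fst).inter (isOpen_ne.preimage continuous_snd)).preimage
    (continuous_coordMap P b)).measurableSet

lemma torusAct_mem_regularSet {a : Fˣ} {w : W} :
    P.torusAct a w ∈ P.regularSet ↔ w ∈ P.regularSet := by
  change P.projX (P.torusAct a w) ≠ 0 ∧ P.projY (P.torusAct a w) ≠ 0 ↔ _
  rw [P.projX_torusAct, P.projY_torusAct, smul_ne_zero_iff_ne, smul_ne_zero_iff_ne]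
  rfl

lemma torusAct_eq (a : Fˣ) (w : W) :
    P.torusAct a w = (coordEquiv P b).symm (pairAct a (coordEquiv P b w)) := by
  rw [coordEquiv_apply, ← coordMap_torusAct, ← coordEquiv_apply,
    ContinuousLinearEquiv.symm_apply_apply]

lemma measurable_torusAct : Measurable (Function.uncurry P.torusAct) := by
  have b := Module.finBasis F P.X
  have h : Function.uncurry P.torusAct = fun z => (coordEquiv P b).symm
      (Function.uncurry pairAct (z.1, coordEquiv P b z.2)) := by
    ext z
    exact torusAct_eq P b z.1 z.2
  rw [h]
  exact (coordEquiv P b).symm.continuous.measurable.comp (measurable_pairAct.comp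
    (measurable_fst.prodMk ((coordEquiv P b).continuous.measurable.comp measurable_snd)))

lemma map_torusAct (a : Fˣ) : dw.map (P.torusAct a) = dw := by
  have b := Module.finBasis F P.X
  obtain ⟨k, -, hk⟩ := exists_map_coordEquiv P b dw
  have he := (coordEquiv P b).continuous.measurable
  have hes := (coordEquiv P b).symm.continuous.measurable
  have hp : Measurable (pairAct a : (Fin (Module.finrank F P.X) → F) ×
      (Fin (Module.finrank F P.X) → F) → _) :=
    measurable_pairAct.comp measurable_prodMk_left
  have h : P.torusAct a = (coordEquiv P b).symm ∘ pairAct a ∘ coordEquiv P b :=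
    funext (torusAct_eq P b a)
  rw [h, ← Measure.map_map hes (hp.comp he), ← Measure.map_map hp he, hk, Measure.map_smul,
    map_pairAct, ← hk, Measure.map_map hes he]
  have : ((coordEquiv P b).symm ∘ coordEquiv P b : W → W) = id :=
    funext (coordEquiv P b).symm_apply_apply
  rw [this, Measure.map_id]

/-- The vectors the `X`-coordinates of which have norm one. -/
def unitSection : Set W := coordMap P b ⁻¹' unitPairs F (Fin n)

lemma measurableSet_unitSection : MeasurableSet (unitSection P b) :=
  (continuous_coordMap P b).measurable measurableSet_unitPairs

/-- The quotient of `dw` by `da`. -/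
def quotientMeasure : Measure P.OrbitSpace :=
  (da (unitSphere F))⁻¹ • ((dw.restrict (unitSection P b)).comap
    (Subtype.val : P.regularSet → W)).map (Quotient.mk P.orbitSetoid)

lemma lintegral_quotientMeasure {g : P.OrbitSpace → ℝ≥0∞} (hg : Measurable g) {G : W → ℝ≥0∞}
    (h : ∀ r : P.regularSet, g (Quotient.mk _ r) = G r) :
    ∫⁻ q, g q ∂quotientMeasure P b dw da = (da (unitSphere F))⁻¹ *
      ∫⁻ w, (P.regularSet ∩ unitSection P b).indicator (fun _ => 1) w * G w ∂dw := by
  have hR := measurableSet_regularSet P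
  rw [quotientMeasure, lintegral_smul_measure, smul_eq_mul]
  congr 1
  rw [lintegral_map hg measurable_quotient_mk'']
  simp only [h]
  rw [lintegral_subtype_comap hR, Measure.restrict_restrict hR,
    ← lintegral_indicator (hR.inter (measurableSet_unitSection P b))]
  congr 1
  ext w
  by_cases hw : w ∈ P.regularSet ∩ unitSection P b
  · rw [Set.indicator_of_mem hw, Set.indicator_of_mem hw, one_mul]
  · rw [Set.indicator_of_notMem hw, Set.indicator_of_notMem hw, zero_mul]

lemma measurable_orbitIntegral {φ : W → ℝ≥0∞} (hφ : Measurable φ) :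
    Measurable (P.orbitIntegral da φ) := by
  refine measurable_from_quotient.2 ?_
  have h : Measurable fun w : W => ∫⁻ a : Fˣ, φ (P.torusAct a w) ∂da :=
    Measurable.lintegral_prod_right ((hφ.comp (measurable_torusAct P)).comp measurable_swap)
  exact h.comp measurable_subtype_coe

/-- Regularity is torus invariant, and the parameters bringing a regular `w` into the section form a
translate of the unit group. The constant is the one divided out in `quotientMeasure`. -/
lemma lintegral_unitSection_torusAct (w : W) :
    ∫⁻ a : Fˣ, (P.regularSet ∩ unitSection P b).indicator (fun _ => 1) (P.torusAct a w) ∂da =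
      da (unitSphere F) * P.regularSet.indicator (fun _ => 1) w := by
  by_cases hw : w ∈ P.regularSet
  · rw [Set.indicator_of_mem hw, mul_one,
      ← measure_norm_smul_eq_one da ((mem_regularSet_iff P b).1 hw).1]
    have hm : MeasurableSet {a : Fˣ | ‖(a : F) • (coordMap P b w).1‖ = 1} :=
      (isClosed_eq ((Units.continuous_val.smul continuous_const).norm)
        continuous_const).measurableSet
    rw [← lintegral_indicator_one hm]
    congr 1
    ext a
    have hiff : P.torusAct a w ∈ P.regularSet ∩ unitSection P b ↔
        a ∈ {a : Fˣ | ‖(a : F) • (coordMap P b w).1‖ = 1} := by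
      rw [Set.mem_inter_iff, torusAct_mem_regularSet, unitSection, Set.mem_preimage,
        coordMap_torusAct]
      exact and_iff_right hw
    by_cases ha : a ∈ {a : Fˣ | ‖(a : F) • (coordMap P b w).1‖ = 1}
    · rw [Set.indicator_of_mem ha, Set.indicator_of_mem (hiff.2 ha), Pi.one_apply]
    · rw [Set.indicator_of_notMem ha, Set.indicator_of_notMem (fun h => ha (hiff.1 h))]
  · rw [Set.indicator_of_notMem hw, mul_zero]
    refine (lintegral_congr fun a => ?_).trans lintegral_zero
    exact Set.indicator_of_notMem (fun h => hw ((torusAct_mem_regularSet P).1 h.1)) _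

/-- Unfolding moves the orbit integral from `φ` to the indicator of the section, where it is
constant on the regular set and cancels the normalization. -/
lemma isQuotientMeasure_quotientMeasure :
    P.IsQuotientMeasure dw da (quotientMeasure P b dw da) := by
  intro φ hφ
  have i1 : SecondCountableTopology W := (coordEquiv P b).toHomeomorph.secondCountableTopology
  have i2 : LocallyCompactSpace W :=
    (coordEquiv P b).toHomeomorph.isClosedEmbedding.locallyCompactSpace
  have hR := measurableSet_regularSet P
  rw [lintegral_quotientMeasure P b dw da (measurable_orbitIntegral P da hφ)
    (G := fun w => ∫⁻ a : Fˣ, φ (P.torusAct a w) ∂da) fun r => rfl,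
    lintegral_mul_orbit dw da P.torusAct (measurable_torusAct P) (map_torusAct P dw)
      (fun a w => by rw [← P.torusAct_mul, inv_mul_cancel, P.torusAct_one])
      (measurable_const.indicator (hR.inter (measurableSet_unitSection P b))) hφ]
  simp only [lintegral_unitSection_torusAct]
  have e : ∀ w, φ w * (da (unitSphere F) * P.regularSet.indicator (fun _ => 1) w) =
      da (unitSphere F) * P.regularSet.indicator φ w := by
    intro w
    by_cases hw : w ∈ P.regularSet
    · rw [Set.indicator_of_mem hw, Set.indicator_of_mem hw, mul_one, mul_comm]
    · rw [Set.indicator_of_notMem hw, Set.indicator_of_notMem hw, mul_zero, mul_zero]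
  simp only [e]
  rw [lintegral_const_mul _ (hφ.indicator hR), ← mul_assoc,
    ENNReal.inv_mul_cancel (measure_unitSphere_ne_zero da) (measure_unitSphere_ne_top da), one_mul,
    lintegral_indicator hR]

/-- Test the defining identity on the part of the section lying over `A`: its orbit integral is a
finite nonzero constant times the indicator of `A`, so `dw` and `da` determine `m A`. -/
lemma isQuotientMeasure_unique {m m' : Measure P.OrbitSpace} (hm : P.IsQuotientMeasure dw da m)
    (hm' : P.IsQuotientMeasure dw da m') : m' = m := by
  have b := Module.finBasis F P.X
  have hR := measurableSet_regularSet P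
  have hD := measurableSet_unitSection P b
  have key : ∀ m : Measure P.OrbitSpace, P.IsQuotientMeasure dw da m → ∀ A : Set P.OrbitSpace,
      MeasurableSet A → da (unitSphere F) * m A = ∫⁻ w in P.regularSet,
        ((P.regularSet ∩ unitSection P b) ∩
          (Subtype.val '' (Quotient.mk P.orbitSetoid ⁻¹' A))).indicator
          (fun _ => 1) w ∂dw := by
    intro m hm A hA
    have hA' : MeasurableSet (Subtype.val '' (Quotient.mk P.orbitSetoid ⁻¹' A) : Set W) :=
      hR.subtype_image (measurable_quotient_mk'' hA)
    rw [hm _ (measurable_const.indicator ((hR.inter hD).inter hA'))]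
    rw [← lintegral_indicator_one hA, ← lintegral_const_mul _ (measurable_one.indicator hA)]
    refine lintegral_congr fun q => ?_
    induction q using Quotient.inductionOn with
    | h r =>
      change _ = ∫⁻ a : Fˣ, _ ∂da
      have hmem : ∀ a : Fˣ, P.torusAct a r ∈
          (Subtype.val '' (Quotient.mk P.orbitSetoid ⁻¹' A) : Set W) ↔ Quotient.mk _ r ∈ A := by
        intro a
        let r₀ : P.regularSet := ⟨P.torusAct a r, (torusAct_mem_regularSet P).2 r.2⟩
        have hq : Quotient.mk P.orbitSetoid r₀ = Quotient.mk _ r :=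
          (Quotient.sound (⟨a, rfl⟩ : ∃ a : Fˣ, P.torusAct a (r : W) = r₀)).symm
        rw [← hq]
        constructor
        · rintro ⟨r', hr', he⟩
          have : r' = r₀ := Subtype.ext he
          rw [← this]
          exact hr'
        · intro h
          exact ⟨r₀, h, rfl⟩
      by_cases hr : Quotient.mk _ r ∈ A
      · have h1 := lintegral_unitSection_torusAct P b da (r : W)
        rw [Set.indicator_of_mem r.2, mul_one] at h1
        rw [Set.indicator_of_mem hr, Pi.one_apply, mul_one, ← h1]
        refine lintegral_congr fun a => ?_
        rw [← Set.indicator_indicator (P.regularSet ∩ unitSection P b)]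
        by_cases ha : P.torusAct a r ∈ P.regularSet ∩ unitSection P b
        · rw [Set.indicator_of_mem ha, Set.indicator_of_mem ha,
            Set.indicator_of_mem ((hmem a).2 hr)]
        · rw [Set.indicator_of_notMem ha, Set.indicator_of_notMem ha]
      · rw [Set.indicator_of_notMem hr, mul_zero]
        refine (lintegral_zero.symm.trans (lintegral_congr fun a => ?_))
        exact (Set.indicator_of_notMem (fun h => hr ((hmem a).1 h.2)) _).symm
  ext A hA
  have h := (key m' hm' A hA).trans (key m hm A hA).symm
  exact (ENNReal.mul_right_inj (measure_unitSphere_ne_zero da) (measure_unitSphere_ne_top da)).1 h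

/-- The map from orbits to matrices of rank one. -/
def orbitMatrix : P.OrbitSpace → Matrix (Fin n) (Fin n) F :=
  Quotient.lift (fun w : P.regularSet => rankOne (coordMap P b w)) (by
    rintro w w' ⟨a, ha⟩
    simp only [← ha, coordMap_torusAct, rankOne_pairAct])

lemma measurable_orbitMatrix : Measurable (orbitMatrix P b) := by
  refine measurable_from_quotient.2 ?_
  exact ((continuous_rankOne.comp (continuous_coordMap P b)).comp continuous_subtype_val).measurable

/-- The quotient measure is carried to a multiple of the orbital measure. -/
lemma exists_map_orbitMatrix (hn : n ≠ 0) : ∃ C : ℝ≥0, C ≠ 0 ∧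
    (quotientMeasure P b dw da).map (orbitMatrix P b) = C • rankOneMeasure F (Fin n) := by
  obtain ⟨k, hk0, hk⟩ := exists_map_coordEquiv P b dw
  have he := (coordEquiv P b).continuous.measurable
  have hR := measurableSet_regularSet P
  have hu0 := measure_unitSphere_ne_zero da
  have hut := measure_unitSphere_ne_top da
  refine ⟨(da (unitSphere F)).toNNReal⁻¹ * k, mul_ne_zero (inv_ne_zero ?_) hk0, ?_⟩
  · rw [Ne, ENNReal.toNNReal_eq_zero_iff]
    exact not_or.2 ⟨hu0, hut⟩
  -- The section inside the regular set omits the pairs with `q = 0`, which the rank one measure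
  -- includes; `n ≠ 0` makes them negligible.
  have hnull : (vecHaar F (Fin n)).prod (vecHaar F (Fin n)) (Set.univ ×ˢ {0}) = 0 := by
    have : Nonempty (Fin n) := ⟨⟨0, Nat.pos_of_ne_zero hn⟩⟩
    have hnb : (nhdsWithin (0 : Fin n → F) {0}ᶜ).NeBot := Module.punctured_nhds_neBot F _ 0
    have h0 : vecHaar F (Fin n) {0} = 0 := measure_singleton _
    rw [Measure.prod_prod, h0, mul_zero]
  ext S hS
  have hSm : MeasurableSet (rankOne ⁻¹' S : Set ((Fin n → F) × (Fin n → F))) :=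
    continuous_rankOne.measurable hS
  rw [Measure.map_apply (measurable_orbitMatrix P b) hS, ← lintegral_indicator_one
    (measurable_orbitMatrix P b hS), lintegral_quotientMeasure P b dw da
    (measurable_one.indicator (measurable_orbitMatrix P b hS))
    (G := (coordEquiv P b ⁻¹' (rankOne ⁻¹' S)).indicator 1) fun r => rfl]
  have h1 : ∀ w, (P.regularSet ∩ unitSection P b).indicator (fun _ => (1 : ℝ≥0∞)) w *
      (coordEquiv P b ⁻¹' (rankOne ⁻¹' S)).indicator 1 w =
      ((P.regularSet ∩ unitSection P b) ∩ coordEquiv P b ⁻¹' (rankOne ⁻¹' S)).indicator 1 w := by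
    intro w
    rw [← Set.indicator_indicator (P.regularSet ∩ unitSection P b)]
    by_cases hw : w ∈ P.regularSet ∩ unitSection P b
    · rw [Set.indicator_of_mem hw, Set.indicator_of_mem hw, one_mul]
    · rw [Set.indicator_of_notMem hw, Set.indicator_of_notMem hw, zero_mul]
  simp only [h1]
  rw [lintegral_indicator_one ((hR.inter (measurableSet_unitSection P b)).inter (he hSm))]
  have h2 : (P.regularSet ∩ unitSection P b) ∩ coordEquiv P b ⁻¹' (rankOne ⁻¹' S) =
      coordEquiv P b ⁻¹' ((unitPairs F (Fin n) ∩ rankOne ⁻¹' S) \ (Set.univ ×ˢ {0})) := by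
    ext w
    rw [Set.mem_inter_iff, Set.mem_inter_iff, mem_regularSet_iff P b]
    simp only [Set.mem_preimage, Set.mem_sdiff, Set.mem_inter_iff, Set.mem_prod, Set.mem_univ,
      true_and, Set.mem_singleton_iff, unitSection, coordEquiv_apply]
    constructor
    · rintro ⟨⟨⟨-, h2⟩, h3⟩, h4⟩
      exact ⟨⟨h3, h4⟩, h2⟩
    · rintro ⟨⟨h3, h4⟩, h2⟩
      refine ⟨⟨⟨fun h0 => ?_, h2⟩, h3⟩, h4⟩
      have h5 : ‖(coordMap P b w).1‖ = 1 := h3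
      rw [h0, norm_zero] at h5
      exact zero_ne_one h5
  have hm3 : MeasurableSet ((unitPairs F (Fin n) ∩ rankOne ⁻¹' S) \ (Set.univ ×ˢ {0})) :=
    (measurableSet_unitPairs.inter hSm).diff (MeasurableSet.univ.prod (measurableSet_singleton 0))
  rw [h2, ← Measure.map_apply he hm3, hk, Measure.smul_apply, Measure.smul_apply,
    measure_sdiff_null hnull, rankOneMeasure, Measure.map_apply continuous_rankOne.measurable hS,
    Measure.restrict_apply hSm, Set.inter_comm, ENNReal.smul_def, ENNReal.smul_def, smul_eq_mul,
    smul_eq_mul, ENNReal.coe_mul, ENNReal.coe_inv, ENNReal.coe_toNNReal hut, mul_assoc]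
  rw [Ne, ENNReal.toNNReal_eq_zero_iff]
  exact not_or.2 ⟨hu0, hut⟩

end OrbitalMeasure
end

noncomputable section

namespace OrbitalMeasure

set_option linter.unusedSectionVars false

/-! ### The Cauchy-Harish-Chandra integral -/

section Dilation

variable {F : Type*} [NontriviallyNormedField F] [IsUltrametricDist F] [ProperSpace F]
  [MeasurableSpace F] [BorelSpace F] {n : ℕ} (χ : UnramifiedCharacter F)

/-- The Fourier transform of the orbital measure of rank one, with a dilation. -/
lemma integral_matFourier_smul (hn : n ≠ 0) (u : Fˣ) : ∃ C : ℝ≥0, C ≠ 0 ∧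
    ∀ f : Matrix (Fin n) (Fin n) F → ℂ, IsLocallyConstant f → HasCompactSupport f →
      Continuous (fun z => matFourier χ f ((u : F) • z)) ∧
      Integrable (fun z => matFourier χ f ((u : F) • z)) (rankOneMeasure F (Fin n)) ∧
      ∫ z, matFourier χ f ((u : F) • z) ∂rankOneMeasure F (Fin n) =
        (C : ℝ) * ∫ z, f z ∂corankOneMeasure F n := by
  -- Dilation by `u` is the action of a scalar matrix on one side, so the constant follows from
  -- equivariance: `c` for the Haar measure and `c'` for the corank one measure.
  set g : GL (Fin n) F := scalarGL F n u with hg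
  set c : ℝ≥0 := distribHaarChar F (Matrix.GeneralLinearGroup.det g) ^ n *
    (distribHaarChar F (Matrix.GeneralLinearGroup.det (1 : GL (Fin n) F)) ^ n)⁻¹ with hc
  set c' : ℝ≥0 := distribHaarChar F (Matrix.GeneralLinearGroup.det g) ^ (n - 1) *
    (distribHaarChar F (Matrix.GeneralLinearGroup.det (1 : GL (Fin n) F)) ^ (n - 1))⁻¹ with hc'
  have hc0 : c ≠ 0 := mul_ne_zero (pow_ne_zero _ (distribHaarChar_ne_zero _))
    (inv_ne_zero (pow_ne_zero _ (distribHaarChar_ne_zero _)))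
  have hc0' : c' ≠ 0 := mul_ne_zero (pow_ne_zero _ (distribHaarChar_ne_zero _))
    (inv_ne_zero (pow_ne_zero _ (distribHaarChar_ne_zero _)))
  refine ⟨c⁻¹ * c', mul_ne_zero (inv_ne_zero hc0) hc0', fun f hf hfc => ?_⟩
  have hT : IsLocallyConstant (f ∘ twoSided g 1) := hf.comp_continuous (twoSided g 1).continuous
  have hTc : HasCompactSupport (f ∘ twoSided g 1) := hfc.comp_homeomorph _
  have hcC : ((c : ℝ) : ℂ) ≠ 0 := by exact_mod_cast hc0
  have e : (fun z => matFourier χ f ((u : F) • z)) =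
      fun z => ((c : ℝ) : ℂ)⁻¹ * matFourier χ (f ∘ twoSided g 1) z := by
    ext z
    have e1 : twoSided 1 g z = (u : F) • z := by
      have := twoSided_scalarGL_right u 1 1 z
      rw [mul_one] at this
      rw [hg, this, twoSided_apply, inv_one, Units.val_one, Matrix.one_mul, Matrix.mul_one]
    rw [matFourier_comp_twoSided, ← hc, e1, inv_mul_cancel_left₀ hcC]
  have hcont := continuous_matFourier χ hT.continuous hTc
  rw [e]
  refine ⟨continuous_const.mul hcont, (hcont.integrable_of_hasCompactSupport
    (hasCompactSupport_matFourier χ hT hTc)).const_mul _, ?_⟩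
  have h3 := (twoSided g 1).measurableEmbedding.integral_map (μ := corankOneMeasure F n) f
  rw [map_twoSided_corankOneMeasure χ hn, ← hc', integral_smul_nnreal_measure, NNReal.smul_def,
    Complex.real_smul] at h3
  rw [integral_const_mul, ← integral_corankOneMeasure χ hT hTc]
  refine (congrArg _ h3.symm).trans ?_
  push_cast
  ring

end Dilation

variable {F : Type*} [NontriviallyNormedField F]
  {W : Type*} [NormedAddCommGroup W] [NormedSpace F W] [FiniteDimensional F W]
  (P : PolarizedSymplectic F W) {n : ℕ} (b : Module.Basis (Fin n) F P.X)
  [IsUltrametricDist F] [ProperSpace F] [MeasurableSpace F] [BorelSpace F]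
  (χ : UnramifiedCharacter F)

section Chc

variable [MeasurableSpace W] [BorelSpace W] (dw : Measure W) [dw.IsAddHaarMeasure]
  (da : Measure Fˣ) [da.IsHaarMeasure] (dx : Measure P.EndX) [dx.IsAddHaarMeasure]

lemma integrable_chi_mul (ψ : SchwartzBruhat P.EndX) (w : W) :
    Integrable (fun x => (χ.toAddChar (P.form (P.toSp x w) w) : ℂ) * (ψ : P.EndX → ℂ) x) dx := by
  have h1 : Continuous fun x : P.EndX => chi χ (P.form (P.toSp x w) w) :=
    (continuous_chi χ).comp (P.momentMap w).continuous
  exact (h1.mul ψ.2.1.continuous).integrable_of_hasCompactSupport ψ.2.2.mul_left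

lemma exists_map_matEquiv : ∃ k : ℝ≥0, k ≠ 0 ∧ dx.map (matEquiv P b) = k • matHaar F (Fin n) := by
  have h : (dx.map (matEquiv P b)).IsAddHaarMeasure := (matEquiv P b).isAddHaarMeasure_map dx
  exact ⟨_, (Measure.addHaarScalarFactor_pos_of_isAddHaarMeasure _ _).ne',
    Measure.isAddLeftInvariant_eq_smul _ _⟩

/-- The phase is the trace pairing with twice the orbit matrix, so the inner integral is a matrix
Fourier transform; `k` compares the Haar measures. -/
lemma innerIntegral_eq {k : ℝ≥0} (hk : dx.map (matEquiv P b) = k • matHaar F (Fin n))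
    (ψ : P.EndX → ℂ) (q : P.OrbitSpace) : P.innerIntegral χ dx ψ q =
      (k : ℝ) * matFourier χ (ψ ∘ (matEquiv P b).symm) ((2 : F) • orbitMatrix P b q) := by
  induction q using Quotient.inductionOn with
  | h w =>
    have h1 := (matEquiv P b).toHomeomorph.measurableEmbedding.integral_map (μ := dx)
      (fun e => chi χ (e * ((2 : F) • rankOne (coordMap P b w))).trace *
        (ψ ∘ (matEquiv P b).symm) e)
    change ∫ e, _ ∂dx.map (matEquiv P b) = _ at h1
    rw [hk, integral_smul_nnreal_measure, NNReal.smul_def, Complex.real_smul] at h1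
    refine Eq.trans ?_ h1.symm
    refine integral_congr_ae (.of_forall fun x => ?_)
    change chi χ _ * ψ x = chi χ (matEquiv P b x * _).trace *
      ψ ((matEquiv P b).symm (matEquiv P b x))
    rw [form_toSp_self P b, ContinuousLinearEquiv.symm_apply_apply]

/-- The iterated integral is a multiple of the orbital measure of corank one. -/
lemma exists_integral_innerIntegral [CharZero F] (hn : n ≠ 0) : ∃ K : ℝ≥0, K ≠ 0 ∧
    ∀ ψ : SchwartzBruhat P.EndX,
      Integrable (P.innerIntegral χ dx ψ) (quotientMeasure P b dw da) ∧
      ∫ q, P.innerIntegral χ dx ψ q ∂quotientMeasure P b dw da =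
        ∫ x, (ψ : P.EndX → ℂ) x ∂(K • (corankOneMeasure F n).map (matEquiv P b).symm) := by
  obtain ⟨k, hk0, hk⟩ := exists_map_matEquiv P b dx
  obtain ⟨C, hC0, hC⟩ := exists_map_orbitMatrix P b dw da hn
  -- The dilation by `2` comes from the moment map and is invertible in characteristic zero.
  obtain ⟨K, hK0, hK⟩ := integral_matFourier_smul χ hn (Units.mk0 (2 : F) two_ne_zero)
  refine ⟨k * (C * K), mul_ne_zero hk0 (mul_ne_zero hC0 hK0), fun ψ => ?_⟩
  obtain ⟨h1, h2, h3⟩ := hK ((ψ : P.EndX → ℂ) ∘ (matEquiv P b).symm)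
    (ψ.2.1.comp_continuous (matEquiv P b).symm.continuous)
    (ψ.2.2.comp_homeomorph (matEquiv P b).symm.toHomeomorph)
  rw [Units.val_mk0] at h1 h2 h3
  have e : P.innerIntegral χ dx ψ = fun q => ((k : ℝ) : ℂ) *
      (fun z => matFourier χ ((ψ : P.EndX → ℂ) ∘ (matEquiv P b).symm) ((2 : F) • z))
        (orbitMatrix P b q) := funext (innerIntegral_eq P b χ dx hk ψ)
  have hm := (measurable_orbitMatrix P b).aemeasurable (μ := quotientMeasure P b dw da)
  rw [e]
  constructor
  · refine Integrable.const_mul ?_ _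
    refine (integrable_map_measure h1.aestronglyMeasurable hm).1 ?_
    rw [hC]
    exact h2.smul_measure_nnreal
  · rw [integral_const_mul, ← integral_map hm h1.aestronglyMeasurable, hC,
      integral_smul_nnreal_measure, h3, integral_smul_nnreal_measure]
    have h4 := (matEquiv P b).symm.toHomeomorph.measurableEmbedding.integral_map
      (μ := corankOneMeasure F n) (ψ : P.EndX → ℂ)
    change ∫ e, _ ∂(corankOneMeasure F n).map (matEquiv P b).symm = _ at h4
    rw [h4]
    simp only [NNReal.smul_def, Complex.real_smul, NNReal.coe_mul, Complex.ofReal_mul]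
    change _ = _ * ∫ z, ((ψ : P.EndX → ℂ) ∘ (matEquiv P b).symm) z ∂_
    ring

end Chc

/-! ### Orbital measures transported to endomorphisms -/

section Orbital

variable {M : Measure (Matrix (Fin n) (Fin n) F)}

/-- The matrix of an automorphism. -/
def glMatrix (g : P.X ≃L[F] P.X) : GL (Fin n) F where
  val := matEquiv P b (g : P.X →L[F] P.X)
  inv := matEquiv P b (g.symm : P.X →L[F] P.X)
  val_inv := by
    rw [← matEquiv_mul]
    have : (g : P.X →L[F] P.X) * (g.symm : P.X →L[F] P.X) = 1 := by ext x; simp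
    rw [this]
    exact LinearMap.toMatrix_one b
  inv_val := by
    rw [← matEquiv_mul]
    have : (g.symm : P.X →L[F] P.X) * (g : P.X →L[F] P.X) = 1 := by ext x; simp
    rw [this]
    exact LinearMap.toMatrix_one b

lemma det_glMatrix (g : P.X ≃L[F] P.X) :
    Matrix.GeneralLinearGroup.det (glMatrix P b g) = LinearEquiv.det g.toLinearEquiv := by
  ext
  rw [LinearEquiv.coe_det]
  exact LinearMap.det_toMatrix b _

/-- Orbital measures on matrices give orbital measures on endomorphisms. -/
lemma isRankOrbitMeasure_map [IsFiniteMeasureOnCompacts M] {k : ℕ} (hM0 : M ≠ 0)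
    (hMk : M {z | z.rank ≠ k} = 0)
    (hM : ∀ g h : GL (Fin n) F, M.map (twoSided g h) =
      (distribHaarChar F (Matrix.GeneralLinearGroup.det g) ^ k *
        (distribHaarChar F (Matrix.GeneralLinearGroup.det h) ^ k)⁻¹ : ℝ≥0) • M)
    {K : ℝ≥0} (hK : K ≠ 0) : P.IsRankOrbitMeasure k (K • M.map (matEquiv P b).symm) := by
  have hms := (matEquiv P b).symm.continuous.measurable
  refine ⟨?_, ?_, ?_, fun g h => ?_⟩
  · intro h0
    have h1 : M.map (matEquiv P b).symm = 0 := by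
      rw [← one_smul ℝ≥0 (M.map _), ← inv_mul_cancel₀ hK, mul_smul, h0, smul_zero]
    exact hM0 ((Measure.map_eq_zero_iff hms.aemeasurable).1 h1)
  · have h1 : IsFiniteMeasureOnCompacts (M.map (matEquiv P b).symm) :=
      Measure.IsFiniteMeasureOnCompacts.map M (matEquiv P b).symm.toHomeomorph
    exact ⟨fun s hs => by
      rw [Measure.smul_apply, ENNReal.smul_def, smul_eq_mul]
      exact ENNReal.mul_lt_top ENNReal.coe_lt_top hs.measure_lt_top⟩
  · have h1 : M.map (matEquiv P b).symm {x | P.rank x ≠ k} = 0 := by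
      have h2 := (matEquiv P b).symm.toHomeomorph.measurableEmbedding.map_apply M
        {x | P.rank x ≠ k}
      refine h2.trans ?_
      convert hMk using 2
      ext z
      change P.rank ((matEquiv P b).symm z) ≠ k ↔ _
      rw [← rank_matEquiv P b, ContinuousLinearEquiv.apply_symm_apply]
      rfl
    rw [Measure.smul_apply, h1, smul_zero]
  · set f : P.EndX → P.EndX := fun x =>
      (g.symm : P.X →L[F] P.X) ∘L x ∘L (h : P.X →L[F] P.X) with hf
    have hfc : Continuous f := by fun_prop
    have hcomp : f ∘ (matEquiv P b).symm =
        (matEquiv P b).symm ∘ twoSided (glMatrix P b g) (glMatrix P b h) := by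
      ext1 z
      refine (matEquiv P b).injective ?_
      rw [Function.comp_apply, Function.comp_apply, ContinuousLinearEquiv.apply_symm_apply,
        twoSided_apply]
      change matEquiv P b ((g.symm : P.X →L[F] P.X) * ((matEquiv P b).symm z * (h : P.X →L[F] P.X)))
        = _
      rw [matEquiv_mul, matEquiv_mul, ContinuousLinearEquiv.apply_symm_apply, ← Matrix.mul_assoc]
      rfl
    rw [Measure.map_smul, Measure.map_map hfc.measurable hms, hcomp,
      ← Measure.map_map hms (twoSided _ _).continuous.measurable, hM, Measure.map_smul,
      det_glMatrix, det_glMatrix, smul_comm]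

end Orbital

lemma isRankOrbitMeasure_rankOne (hn : n ≠ 0) {K : ℝ≥0} (hK : K ≠ 0) :
    P.IsRankOrbitMeasure 1 (K • (rankOneMeasure F (Fin n)).map (matEquiv P b).symm) :=
  isRankOrbitMeasure_map P b (rankOneMeasure_ne_zero hn) (rankOneMeasure_rank_ne hn)
    (fun g h => by rw [map_twoSided_rankOneMeasure, pow_one, pow_one]) hK

lemma isRankOrbitMeasure_corankOne (χ : UnramifiedCharacter F) (hn : n ≠ 0) {K : ℝ≥0} (hK : K ≠ 0) :
    P.IsRankOrbitMeasure (n - 1) (K • (corankOneMeasure F n).map (matEquiv P b).symm) :=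
  isRankOrbitMeasure_map P b (corankOneMeasure_ne_zero hn) corankOneMeasure_rank_ne
    (map_twoSided_corankOneMeasure χ hn) hK

/-! ### Wave front sets on endomorphisms and the moment map -/

section WaveFrontSets

variable (Λ : Subgroup Fˣ) {ϖ : Fˣ}

lemma exists_eq_traceCovector (ξ : StrongDual F P.EndX) : ∃ y, ξ = P.traceCovector y := by
  have b := Module.finBasis F P.X
  refine ⟨(matEquiv P b).symm (covMatrix (matEquiv P b) ξ), ?_⟩
  rw [traceCovector_eq P b, ContinuousLinearEquiv.apply_symm_apply, traceForm_covMatrix]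

lemma waveFrontSet_rankOne (hϖΛ : ϖ ∈ Λ) (hϖ : ‖(ϖ : F)‖ < 1) (hn : n ≠ 0) {K : ℝ≥0} (hK : K ≠ 0)
    (hμ : IsFiniteMeasureOnCompacts (K • (rankOneMeasure F (Fin n)).map (matEquiv P b).symm)) :
    waveFrontSet Λ χ (BruhatDistribution.ofMeasure _ hμ) =
      {p | ∃ x y : P.EndX, p = (x, P.traceCovector y) ∧ P.rank x ≤ 1 ∧ P.rank y ≤ n - 1 ∧ y ≠ 0 ∧
        x * y = 0 ∧ y * x = 0} := by
  have hμ' : IsFiniteMeasureOnCompacts ((rankOneMeasure F (Fin n)).map (matEquiv P b).symm) :=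
    Measure.IsFiniteMeasureOnCompacts.map _ (matEquiv P b).symm.toHomeomorph
  rw [waveFrontSet_smul_measure χ Λ hK rfl hμ' hμ]
  have key : ∀ x y : P.EndX, (x, P.traceCovector y) ∈
      waveFrontSet Λ χ (BruhatDistribution.ofMeasure _ hμ') ↔ P.rank x ≤ 1 ∧ P.rank y ≤ n - 1 ∧
        y ≠ 0 ∧ x * y = 0 ∧ y * x = 0 := by
    intro x y
    rw [traceCovector_eq P b, mem_waveFrontSet_rankOne_iff χ _ Λ hn hϖΛ hϖ, rank_matEquiv,
      rank_matEquiv, matEquiv_mul_eq_zero, matEquiv_mul_eq_zero,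
      map_ne_zero_iff _ (matEquiv P b).injective]
  ext ⟨x, ξ⟩
  obtain ⟨y, rfl⟩ := exists_eq_traceCovector P ξ
  constructor
  · exact fun h => ⟨x, y, rfl, (key x y).1 h⟩
  · rintro ⟨x', y', he, h⟩
    rw [he]
    exact (key x' y').2 h

lemma waveFrontSet_corankOne (hϖΛ : ϖ ∈ Λ) (hϖ : ‖(ϖ : F)‖ < 1) (hn : n ≠ 0) {K : ℝ≥0}
    (hK : K ≠ 0)
    (hμ : IsFiniteMeasureOnCompacts (K • (corankOneMeasure F n).map (matEquiv P b).symm)) :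
    waveFrontSet Λ χ (BruhatDistribution.ofMeasure _ hμ) =
      {p | ∃ x y : P.EndX, p = (x, P.traceCovector y) ∧ P.rank x ≤ n - 1 ∧ P.rank y ≤ 1 ∧ y ≠ 0 ∧
        x * y = 0 ∧ y * x = 0} := by
  have hμ' : IsFiniteMeasureOnCompacts ((corankOneMeasure F n).map (matEquiv P b).symm) :=
    Measure.IsFiniteMeasureOnCompacts.map _ (matEquiv P b).symm.toHomeomorph
  rw [waveFrontSet_smul_measure χ Λ hK rfl hμ' hμ]
  have key : ∀ x y : P.EndX, (x, P.traceCovector y) ∈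
      waveFrontSet Λ χ (BruhatDistribution.ofMeasure _ hμ') ↔ P.rank x ≤ n - 1 ∧ P.rank y ≤ 1 ∧
        y ≠ 0 ∧ x * y = 0 ∧ y * x = 0 := by
    intro x y
    rw [traceCovector_eq P b, mem_waveFrontSet_corankOne_iff χ _ Λ hn hϖΛ hϖ, rank_matEquiv,
      rank_matEquiv, matEquiv_mul_eq_zero, matEquiv_mul_eq_zero,
      map_ne_zero_iff _ (matEquiv P b).injective]
  ext ⟨x, ξ⟩
  obtain ⟨y, rfl⟩ := exists_eq_traceCovector P ξ
  constructor
  · exact fun h => ⟨x, y, rfl, (key x y).1 h⟩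
  · rintro ⟨x', y', he, h⟩
    rw [he]
    exact (key x' y').2 h

/-- A matrix unit is visibly a product of a column and a row, and the two-sided action respects such
products. -/
lemma exists_rankOne_eq {y : Matrix (Fin n) (Fin n) F} (hy : y ≠ 0) (hr : y.rank ≤ 1) :
    ∃ x, rankOne x = y := by
  obtain ⟨i₀, g, h, hgh⟩ := exists_twoSided_eq_single hy hr
  refine ⟨((g : Matrix (Fin n) (Fin n) F).mulVec (Pi.single i₀ 1),
    Matrix.vecMul (Pi.single i₀ 1) ((h⁻¹ : GL (Fin n) F) : Matrix (Fin n) (Fin n) F)), ?_⟩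
  rw [← (twoSided g h).symm_apply_apply y, hgh, rankOne, Matrix.single_eq_single_vecMulVec_single]
  change _ = (g : Matrix (Fin n) (Fin n) F) * _ * ((h⁻¹ : GL (Fin n) F) : Matrix (Fin n) (Fin n) F)
  rw [Matrix.mul_vecMulVec, Matrix.vecMulVec_mul]

/-- The conormal vectors to the endomorphisms of corank one, described by the moment map. -/
lemma conormal_eq {F : Type*} [NontriviallyNormedField F]
    {W : Type*} [NormedAddCommGroup W] [NormedSpace F W] [FiniteDimensional F W]
    (P : PolarizedSymplectic F W) {n : ℕ} (b : Module.Basis (Fin n) F P.X)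
    [IsUltrametricDist F] [ProperSpace F] [MeasurableSpace F] [BorelSpace F] [CharZero F] :
    {p : P.EndX × StrongDual F P.EndX | ∃ x y : P.EndX, p = (x, P.traceCovector y) ∧
      P.rank x ≤ n - 1 ∧ P.rank y ≤ 1 ∧ y ≠ 0 ∧ x * y = 0 ∧ y * x = 0} =
    {p | ∃ w : W, p.2 = P.momentMap w ∧ P.momentMap w ≠ 0 ∧ P.toSp p.1 w = 0} := by
  have h2 : (2 : F) ≠ 0 := two_ne_zero
  have hvec : ∀ {p q : Fin n → F}, Matrix.vecMulVec p q = 0 ↔ p = 0 ∨ q = 0 :=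
    Matrix.vecMulVec_eq_zero
  ext ⟨x, ξ⟩
  constructor
  · rintro ⟨x', y, he, -, hr, hy, h1, h1'⟩
    obtain ⟨rfl, rfl⟩ := Prod.mk.inj he
    rw [← rank_matEquiv P b] at hr
    rw [← matEquiv_mul_eq_zero P b] at h1 h1'
    have hy' : matEquiv P b y ≠ 0 := (map_ne_zero_iff _ (matEquiv P b).injective).2 hy
    obtain ⟨⟨p, q⟩, hpq⟩ := exists_rankOne_eq hy' hr
    -- The factor `2⁻¹` compensates the `2` in the moment map.
    obtain ⟨w, hw⟩ := (coordEquiv P b).surjective ((2 : F)⁻¹ • p, q)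
    rw [coordEquiv_apply] at hw
    have hτ : P.momentMap w = P.traceCovector y := by
      rw [momentMap_eq P b, traceCovector_eq P b, hw, ← hpq, rankOne, rankOne,
        Matrix.smul_vecMulVec, smul_smul, mul_inv_cancel₀ h2, one_smul]
    rw [← hpq, rankOne] at hy' h1 h1'
    have hp : p ≠ 0 := fun h => hy' (hvec.2 (Or.inl h))
    have hq : q ≠ 0 := fun h => hy' (hvec.2 (Or.inr h))
    refine ⟨w, hτ.symm, ?_, ?_⟩
    · rw [hτ, traceCovector_eq P b]
      exact traceForm_ne_zero _ ((map_ne_zero_iff _ (matEquiv P b).injective).2 hy)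
    · rw [toSp_eq_zero_iff P b, hw]
      rw [Matrix.mul_vecMulVec] at h1
      rw [Matrix.vecMulVec_mul] at h1'
      refine ⟨?_, (hvec.1 h1').resolve_left hp⟩
      rw [Matrix.mulVec_smul]
      exact smul_eq_zero_of_right _ ((hvec.1 h1).resolve_right hq)
  · rintro ⟨w, hξ, hτ, hw⟩
    obtain ⟨h1, h1'⟩ := (toSp_eq_zero_iff P b x w).1 hw
    set y := (matEquiv P b).symm ((2 : F) • rankOne (coordMap P b w)) with hy
    have hΦy : matEquiv P b y = (2 : F) • rankOne (coordMap P b w) :=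
      ContinuousLinearEquiv.apply_symm_apply _ _
    have hτy : P.traceCovector y = P.momentMap w := by
      rw [traceCovector_eq P b, momentMap_eq P b, hΦy]
    have hy0 : y ≠ 0 := by
      intro h0
      refine hτ ?_
      rw [momentMap_eq P b, ← hΦy, h0, map_zero, map_zero]
    have hxy : matEquiv P b x * matEquiv P b y = 0 := by
      rw [hΦy, Matrix.mul_smul, rankOne, Matrix.mul_vecMulVec, h1, Matrix.zero_vecMulVec, smul_zero]
    have hyx : matEquiv P b y * matEquiv P b x = 0 := by
      rw [hΦy, Matrix.smul_mul, rankOne, Matrix.vecMulVec_mul, h1', Matrix.vecMulVec_zero,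
        smul_zero]
    refine ⟨x, y, Prod.ext rfl (hξ.trans hτy.symm), ?_, ?_, hy0,
      (matEquiv_mul_eq_zero P b x y).1 hxy, (matEquiv_mul_eq_zero P b y x).1 hyx⟩
    -- The rank bound on `x` is automatic from `y x = 0` with `y ≠ 0`.
    · rw [← rank_matEquiv P b]
      exact rank_le_sub_one_of_mul_eq_zero
        ((map_ne_zero_iff _ (matEquiv P b).injective).2 hy0) hyx
    · rw [← rank_matEquiv P b, hΦy, rankOne, ← Matrix.smul_vecMulVec]
      exact Matrix.rank_vecMulVec_le _ _

end WaveFrontSets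

end OrbitalMeasure
end

/-! ### The main theorem -/

theorem mainTheorem5 {F : Type*} [NontriviallyNormedField F] [IsUltrametricDist F] [ProperSpace F]
    [CharZero F] [MeasurableSpace F] [BorelSpace F]
    {W : Type*} [NormedAddCommGroup W] [NormedSpace F W] [FiniteDimensional F W]
    [Nontrivial W] [MeasurableSpace W] [BorelSpace W]
    (χ : UnramifiedCharacter F)
    (Λ : Subgroup Fˣ) (hfin : Λ.FiniteIndex) (hΛ : ∃ ϖ ∈ Λ, IsUniformizer (ϖ : F))
    (P : PolarizedSymplectic F W)
    (dw : Measure W) [dw.IsAddHaarMeasure] (da : Measure Fˣ) [da.IsHaarMeasure]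
    (dx : Measure P.EndX) [dx.IsAddHaarMeasure] :
    ∃ m : Measure P.OrbitSpace,
      -- the quotient measure on the orbit space exists and is unique
      P.IsQuotientMeasure dw da m ∧ (∀ m', P.IsQuotientMeasure dw da m' → m' = m) ∧
      ∃ chc : BruhatDistribution P.EndX,
        -- the definition of `chc`, with absolute convergence of each consecutive integral
        (∀ ψ : SchwartzBruhat P.EndX,
          (∀ w : W, Integrable (fun x => (χ.toAddChar (P.form (P.toSp x w) w) : ℂ) *
            (ψ : P.EndX → ℂ) x) dx) ∧
          Integrable (P.innerIntegral χ dx ψ) m ∧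
          chc ψ = ∫ q, P.innerIntegral χ dx ψ q ∂m) ∧
        -- `chc` is the orbital measure of the endomorphisms of corank one
        (∃ (μ : Measure P.EndX) (hμ : P.IsRankOrbitMeasure (Module.finrank F P.X - 1) μ),
          chc = BruhatDistribution.ofMeasure μ hμ.finite_on_compacts ∧
          waveFrontSet Λ χ (BruhatDistribution.ofMeasure μ hμ.finite_on_compacts) =
            {p | ∃ x y : P.EndX, p = (x, P.traceCovector y) ∧
              P.rank x ≤ Module.finrank F P.X - 1 ∧ P.rank y ≤ 1 ∧ y ≠ 0 ∧
              x * y = 0 ∧ y * x = 0}) ∧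
        -- the orbital measure of the endomorphisms of rank one
        (∃ (μ : Measure P.EndX) (hμ : P.IsRankOrbitMeasure 1 μ),
          waveFrontSet Λ χ (BruhatDistribution.ofMeasure μ hμ.finite_on_compacts) =
            {p | ∃ x y : P.EndX, p = (x, P.traceCovector y) ∧
              P.rank x ≤ 1 ∧ P.rank y ≤ Module.finrank F P.X - 1 ∧ y ≠ 0 ∧
              x * y = 0 ∧ y * x = 0}) ∧
        -- the wave front set of `chc`
        waveFrontSet Λ χ chc =
          {p | ∃ w : W, p.2 = P.momentMap w ∧ P.momentMap w ≠ 0 ∧ P.toSp p.1 w = 0} := by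
  obtain ⟨ϖ, hϖΛ, -, hϖ, -⟩ := hΛ
  have b := Module.finBasis F P.X
  have hn := OrbitalMeasure.basis_card_ne_zero P b
  obtain ⟨K, hK, hchc⟩ := OrbitalMeasure.exists_integral_innerIntegral P b χ dw da dx hn
  have hμ := OrbitalMeasure.isRankOrbitMeasure_corankOne P b χ hn hK
  have hμ₁ := OrbitalMeasure.isRankOrbitMeasure_rankOne P b hn one_ne_zero
  have hWF := OrbitalMeasure.waveFrontSet_corankOne P b χ Λ hϖΛ hϖ hn hK hμ.finite_on_compacts
  have hq := OrbitalMeasure.isQuotientMeasure_quotientMeasure P b dw da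
  -- `chc` is taken to be the distribution of the scaled corank one measure. Its equality with that
  -- measure is then definitional, and the iterated integral formula is what `hchc` supplies.
  refine ⟨OrbitalMeasure.quotientMeasure P b dw da, hq,
    fun m' hm' => OrbitalMeasure.isQuotientMeasure_unique P dw da hq hm',
    BruhatDistribution.ofMeasure _ hμ.finite_on_compacts, fun ψ => ?_, ⟨_, hμ, rfl, hWF⟩,
    ⟨_, hμ₁, OrbitalMeasure.waveFrontSet_rankOne P b χ Λ hϖΛ hϖ hn one_ne_zero
      hμ₁.finite_on_compacts⟩, hWF.trans (OrbitalMeasure.conormal_eq P b)⟩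
  exact ⟨OrbitalMeasure.integrable_chi_mul P χ dx ψ, (hchc ψ).1, (hchc ψ).2.symm⟩
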